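/- **Lemma 5 (the multipoint superposition identity).** Points of Euclidean AdS$_2$ are written ${\bf x}=(u,z)$ with $u>0$; $z$ is continued to complex values and all noninteger powers are principal. For a weight $h$ put $$\xi({\bf x},{\bf x}')=\frac{2uu'}{u^2+u'^2+(z-z')^2},\qquad G_h({\bf x},{\bf x}')=\Big(\frac{\xi}{2}\Big)^h{}_2F_1\Big[\tfrac h2,\tfrac h2+\tfrac12;h+\tfrac12\,\Big|\,\xi^2\Big],\qquad c_h=\frac{-2i}{4^h}\frac{\Gamma(2h)}{\Gamma(h)^2},$$ $$\widehat G_h({\bf x},{\bf x}',w)=c_h\Big(\frac{u'}{u'^2+(z'-w)^2}\Big)^{1-h}\Big(\frac{u}{u^2+(z-w)^2}\Big)^{h},$$ $$\widetilde G_h({\bf x},{\bf x}')=c_h\Big(4^h\frac{\Gamma(1-2h)}{\Gamma(1-h)^2}G_h({\bf x},{\bf x}')+4^{1-h}\frac{\Gamma(2h-1)}{\Gamma(h)^2}G_{1-h}({\bf x},{\bf x}')\Big),$$ where for $2h\in\mathbb Z$ the last formula is understood by continuity in $h$. Let $h_1,\dots,h_n>\frac12$, and let ${\bf x}_i=(u_i,z_i)$,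 $i=1,\dots,n$, be points with $u_i>0$ and pairwise distinct $z_i\in\mathbb R$. Let the test function $f({\bf x})=f(u,z)$ be such that the integral on the left-hand side below converges absolutely, and such that for some open set $V\subset\mathbb C$ that contains all the segments $[z_k-iu_k,z_k+iu_k]$: * $f$ is continuous on $(0,\infty)\times V$ and holomorphic in $z\in V$ for every $u>0$; * for every $k$ there is $\delta>0$ with $u^{-h_k}\,\big(\prod_{i\ne k}u^{h_i}\big)\,f(u,z)=O(u^{\delta})$ uniformly in $z\in V$ for $0<u\le1$; * there is $c<1+\sum_i h_i$ with $f(u,z)=O(u^{c})$ uniformly in $z\in V$ for $u\ge1$. For small $\varepsilon_i>0$ and $w_i\in[z_i-iu_i,z_i+iu_i]$ let $C_i(\varepsilon_i)$ be the $\Pi$-shaped contour that consists of the straight segments from $z_i-\varepsilon_i$ to $w_i-\varepsilon_i$, from there to $w_i+\varepsilon_i$, and from there to $z_i+\varepsilon_i$, and let $$C(\varepsilon_1,\dots,\varepsilon_n)=\mathbb R\setminus\bigcup_{i=1}^nU_{\varepsilon_i}(z_i)+\sum_{i=1}^nC_i(\varepsilon_i),$$ where $U_{\varepsilon_i}(z_i)$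 is the $\varepsilon_i$-neighbourhood of $z_i$. Then $$\int_0^\infty\frac{du}{u^2}\int_{\mathbb R}dz\,\prod_{i=1}^nG_{h_i}({\bf x},{\bf x}_i)f({\bf x})=\pi\sum_{k=1}^n\int_0^{u_k}\frac{du}{u^2}\int_{z_k-i(u-u_k)}^{z_k+i(u-u_k)}dz\,\bigg(\prod_{i\ne k}\int_{z_i-iu_i}^{z_i+iu_i}dw_i\,\widehat G_{h_i}({\bf x},{\bf x}_i,w_i)\bigg)\widetilde G_{h_k}({\bf x},{\bf x}_k)f({\bf x})$$ $$+\lim_{\varepsilon_1,\dots,\varepsilon_n\to0^+}\bigg(\prod_{i=1}^n\int_{z_i-iu_i}^{z_i+iu_i}dw_i\bigg)\int_0^\infty\frac{du}{u^2}\int_{C(\varepsilon_1,\dots,\varepsilon_n)}dz\,\bigg(\prod_{k=1}^n\widehat G_{h_k}({\bf x},{\bf x}_k,w_k)\bigg)f({\bf x}).$$ All the iterated integrals on the right-hand side converge absolutely (those under the limit for all sufficiently small $\varepsilon_i$; there the inner integrals for almost every value of the outer variables), and the joint limit exists. -/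

import Mathlib

open Set Filter Topology MeasureTheory

noncomputable section

namespace AdS2

/-! Points of the Poincare half-plane are pairs (u, z) with u > 0; the coordinate z is allowed to be
complex. Noninteger powers are principal ones. -/

/-- The normalisation constant -2i Γ(2h) / (4^h Γ(h)²) of the smearing function. -/
def smearConst (h : ℝ) : ℂ :=
  (-2 * Complex.I / (4 : ℂ) ^ (h : ℂ)) * (Complex.Gamma (2 * h) / Complex.Gamma h ^ 2)

/-- The invariant ξ(x, x') = 2 u u' / (u² + u'² + (z - z')²). -/
def xi (u : ℝ) (z : ℂ) (u' : ℝ) (z' : ℂ) : ℂ :=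
  2 * u * u' / ((u : ℂ) ^ 2 + (u' : ℂ) ^ 2 + (z - z') ^ 2)

/-- The bulk-to-bulk propagator G_h(x, x'). The hypergeometric function is the power series, which
represents it for |ξ| < 1; the integrals below evaluate it only at 0 < ξ < 1, up to null sets. -/
def G (h : ℝ) (u : ℝ) (z : ℂ) (u' : ℝ) (z' : ℂ) : ℂ :=
  (xi u z u' z' / 2) ^ (h : ℂ) *
    ordinaryHypergeometric ((h : ℂ) / 2) ((h : ℂ) / 2 + 1 / 2) ((h : ℂ) + 1 / 2)
      (xi u z u' z' ^ 2)

/-- The bulk-to-boundary propagator K_h(x, w). -/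
def K (h : ℝ) (u : ℝ) (z w : ℂ) : ℂ :=
  ((u : ℂ) / ((u : ℂ) ^ 2 + (z - w) ^ 2)) ^ (h : ℂ)

/-- The smearing function: the bulk-to-boundary propagator of weight 1 - h, times a constant. -/
def smear (h : ℝ) (u : ℝ) (z w : ℂ) : ℂ := smearConst h * K (1 - h) u z w

/-- The modified propagator Ĝ_h(x, x', w). -/
def Ghat (h : ℝ) (u : ℝ) (z : ℂ) (u' : ℝ) (z' w : ℂ) : ℂ := K h u z w * smear h u' z' w

/-- The modified propagator G̃_h as a combination of G_h and G_{1-h}, for weights h at which the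
Gamma factors have no poles (2h not an integer). -/
def GtildeGeneric (h : ℝ) (u : ℝ) (z : ℂ) (u' : ℝ) (z' : ℂ) : ℂ :=
  smearConst h *
    ((4 : ℂ) ^ (h : ℂ) * (Complex.Gamma (1 - 2 * h) / Complex.Gamma (1 - h) ^ 2) * G h u z u' z' +
      (4 : ℂ) ^ (1 - h : ℂ) * (Complex.Gamma (2 * h - 1) / Complex.Gamma h ^ 2) *
        G (1 - h) u z u' z')

/-- The modified propagator G̃_h. The formula of `GtildeGeneric` has removable singularities at the
weights with 2h an integer; G̃_h is its value by continuity in the weight, at every weight. -/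
def Gtilde (h : ℝ) (u : ℝ) (z : ℂ) (u' : ℝ) (z' : ℂ) : ℂ :=
  limUnder (𝓝[≠] h) (fun s : ℝ => GtildeGeneric s u z u' z')

/-- The integral of g over the straight segment from a to b. -/
def segIntegral (a b : ℂ) (g : ℂ → ℂ) : ℂ :=
  (b - a) * ∫ s in (0 : ℝ)..1, g (a + s * (b - a))

/-- Absolute convergence of `segIntegral`. -/
def SegIntegrable (a b : ℂ) (g : ℂ → ℂ) : Prop :=
  IntervalIntegrable (fun s : ℝ => g (a + s * (b - a))) volume 0 1

/-- The n-fold integral of g over the product of the segments from a i to b i. -/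
def multiSegIntegral {n : ℕ} (a b : Fin n → ℂ) (g : (Fin n → ℂ) → ℂ) : ℂ :=
  (∏ i, (b i - a i)) *
    ∫ s in Icc (0 : Fin n → ℝ) 1, g (fun i => a i + s i * (b i - a i))

/-- Absolute convergence of `multiSegIntegral`. -/
def MultiSegIntegrable {n : ℕ} (a b : Fin n → ℂ) (g : (Fin n → ℂ) → ℂ) : Prop :=
  IntegrableOn (fun s : Fin n → ℝ => g (fun i => a i + s i * (b i - a i)))
    (Icc (0 : Fin n → ℝ) 1)

/-- The integral over the Π-shaped contour from p - ε to p + ε through w - ε and w + ε. For Re w = p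
its legs are vertical; it runs above or below the real axis according to the sign of Im w. -/
def bumpIntegral (p : ℝ) (ε : ℝ) (w : ℂ) (g : ℂ → ℂ) : ℂ :=
  segIntegral (p - ε) (w - ε) g + segIntegral (w - ε) (w + ε) g + segIntegral (w + ε) (p + ε) g

def BumpIntegrable (p : ℝ) (ε : ℝ) (w : ℂ) (g : ℂ → ℂ) : Prop :=
  SegIntegrable (p - ε) (w - ε) g ∧ SegIntegrable (w - ε) (w + ε) g ∧
    SegIntegrable (w + ε) (p + ε) g

/-- The real line without the εᵢ-neighbourhoods of the points zᵢ. -/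
def puncturedLine {n : ℕ} (z ε : Fin n → ℝ) : Set ℝ := (⋃ i, Metric.ball (z i) (ε i))ᶜ

/-- The integral over the contour C(ε₁, …, εₙ): the real line in which the εᵢ-neighbourhood of zᵢ is
replaced by the Π-shaped contour through wᵢ - εᵢ and wᵢ + εᵢ. -/
def contourIntegral {n : ℕ} (z ε : Fin n → ℝ) (w : Fin n → ℂ) (g : ℂ → ℂ) : ℂ :=
  (∫ x in puncturedLine z ε, g (x : ℂ)) + ∑ i, bumpIntegral (z i) (ε i) (w i) g

/-- Absolute convergence of `contourIntegral`. -/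
def ContourIntegrable {n : ℕ} (z ε : Fin n → ℝ) (w : Fin n → ℂ) (g : ℂ → ℂ) : Prop :=
  IntegrableOn (fun x : ℝ => g (x : ℂ)) (puncturedLine z ε) ∧
    ∀ i, BumpIntegrable (z i) (ε i) (w i) g

section Terms

variable {n : ℕ} (h u z : Fin n → ℝ) (f : ℝ → ℂ → ℂ)

/-- The lower end z_k - i u_k of the segment of integration of w_k. -/
def wLow (k : Fin n) : ℂ := z k - Complex.I * u k

/-- The upper end z_k + i u_k of the segment of integration of w_k. -/
def wHigh (k : Fin n) : ℂ := z k + Complex.I * u k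

/-- ∏ G_{h_i}(x, x_i) f(x), at the bulk point x = (r, ζ). -/
def bulkIntegrand (r : ℝ) (ζ : ℂ) : ℂ := (∏ i, G (h i) r ζ (u i) (z i)) * f r ζ

/-- ∫₀^∞ du/u² ∫_ℝ dz ∏ G_{h_i}(x, x_i) f(x). -/
def bulkIntegral : ℂ :=
  ∫ r in Ioi (0 : ℝ), ((r : ℂ) ^ 2)⁻¹ * ∫ ζ : ℝ, bulkIntegrand h u z f r ζ

/-- Absolute convergence of the double integral in `bulkIntegral`. -/
def BulkIntegrable : Prop :=
  IntegrableOn (fun p : ℝ × ℝ => ((p.1 : ℂ) ^ 2)⁻¹ * bulkIntegrand h u z f p.1 p.2)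
    (Ioi (0 : ℝ) ×ˢ (univ : Set ℝ))

/-- (∏_{i ≠ k} ∫ dw_i Ĝ_{h_i}(x, x_i, w_i)) G̃_{h_k}(x, x_k) f(x), at x = (r, ζ). -/
def tildeIntegrand (k : Fin n) (r : ℝ) (ζ : ℂ) : ℂ :=
  (∏ i ∈ Finset.univ.erase k,
      segIntegral (wLow u z i) (wHigh u z i) (fun w => Ghat (h i) r ζ (u i) (z i) w)) *
    Gtilde (h k) r ζ (u k) (z k) * f r ζ

/-- The inner integral over z, from z_k - i(r - u_k) to z_k + i(r - u_k), with its factor 1/r². -/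
def tildeInner (k : Fin n) (r : ℝ) : ℂ :=
  ((r : ℂ) ^ 2)⁻¹ *
    segIntegral (z k - Complex.I * (r - u k)) (z k + Complex.I * (r - u k))
      (tildeIntegrand h u z f k r)

/-- The k-th term with G̃ (without the factor π). -/
def tildeTerm (k : Fin n) : ℂ := ∫ r in Ioo (0 : ℝ) (u k), tildeInner h u z f k r

/-- All integrals in the k-th term with G̃ converge absolutely. -/
def TildeConverges (k : Fin n) : Prop :=
  (∀ r ∈ Ioo (0 : ℝ) (u k), ∀ v : ℝ, ∀ i, i ≠ k →
    SegIntegrable (wLow u z i) (wHigh u z i)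
      (fun w => Ghat (h i) r (z k + Complex.I * v) (u i) (z i) w)) ∧
  (∀ r ∈ Ioo (0 : ℝ) (u k),
    SegIntegrable (z k - Complex.I * (r - u k)) (z k + Complex.I * (r - u k))
      (tildeIntegrand h u z f k r)) ∧
  IntegrableOn (tildeInner h u z f k) (Ioo (0 : ℝ) (u k))

/-- ∏ Ĝ_{h_k}(x, x_k, w_k) f(x), at x = (r, ζ). -/
def hatIntegrand (w : Fin n → ℂ) (r : ℝ) (ζ : ℂ) : ℂ :=
  (∏ k, Ghat (h k) r ζ (u k) (z k) (w k)) * f r ζ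

/-- The integral over the contour C(ε₁, …, εₙ), with the factor 1/r². -/
def hatInner (ε : Fin n → ℝ) (w : Fin n → ℂ) (r : ℝ) : ℂ :=
  ((r : ℂ) ^ 2)⁻¹ * contourIntegral z ε w (hatIntegrand h u z f w r)

/-- The term with all propagators replaced by Ĝ, at given ε₁, …, εₙ. -/
def hatTerm (ε : Fin n → ℝ) : ℂ :=
  multiSegIntegral (wLow u z) (wHigh u z)
    (fun w => ∫ r in Ioi (0 : ℝ), hatInner h u z f ε w r)

/-- All iterated integrals in `hatTerm` converge absolutely (the inner ones at almost every point). -/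
def HatConverges (ε : Fin n → ℝ) : Prop :=
  (∀ᵐ s : Fin n → ℝ ∂(volume.restrict (Icc (0 : Fin n → ℝ) 1)),
    let w : Fin n → ℂ := fun i => wLow u z i + s i * (wHigh u z i - wLow u z i)
    (∀ᵐ r : ℝ ∂(volume.restrict (Ioi (0 : ℝ))),
      ContourIntegrable z ε w (hatIntegrand h u z f w r)) ∧
    IntegrableOn (hatInner h u z f ε w) (Ioi (0 : ℝ))) ∧
  MultiSegIntegrable (wLow u z) (wHigh u z)
    (fun w => ∫ r in Ioi (0 : ℝ), hatInner h u z f ε w r)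

/-- Admissible test functions f(r, ζ), r > 0, for n propagators of weights h_i ending at (u_i, z_i).
The set V is a complex neighbourhood of the segments [z_k - i u_k, z_k + i u_k], so that it contains
all Π-shaped contours of small width. The bound at r → 0 says that r^{-h_k} times the product of f and
of the other propagators, which behave like r^{h_i}, vanishes like a positive power of r. -/
structure IsTestFunction : Prop where
  exists_nhds : ∃ V : Set ℂ, IsOpen V ∧
    (∀ k, ∀ t ∈ Icc (-u k) (u k), (z k : ℂ) + Complex.I * t ∈ V) ∧
    ContinuousOn (fun p : ℝ × ℂ => f p.1 p.2) (Ioi (0 : ℝ) ×ˢ V) ∧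
    (∀ r : ℝ, 0 < r → DifferentiableOn ℂ (f r) V) ∧
    (∀ k, ∃ δ > (0 : ℝ), ∃ M : ℝ, ∀ r ∈ Ioc (0 : ℝ) 1, ∀ ζ ∈ V,
      ‖f r ζ‖ ≤ M * r ^ (h k - ∑ i ∈ Finset.univ.erase k, h i + δ)) ∧
    (∃ c < 1 + ∑ i, h i, ∃ M : ℝ, ∀ r : ℝ, 1 ≤ r → ∀ ζ ∈ V, ‖f r ζ‖ ≤ M * r ^ c)
  integrable : BulkIntegrable h u z f

end Terms

end AdS2

end

open AdS2

namespace AdS2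

/-! One propagator. On the segment w = z' + it, Ĝ is a constant times `smearWeight` times `kernel`.
A Möbius substitution turns its integral over the segment into the Legendre integral `legendreQ`
taken along a horizontal line, and that line can be moved back to the real axis. The same
`legendreQ` represents G_h, so the w-integral of Ĝ is G_h at every real z ≠ z'
(`segIntegral_Ghat_eq_G`). By the connection formula between the weights h and 1 - h, the
combination G̃ is a multiple of the Legendre function of the first kind (`Gtilde_eq`).

The local identity is `segIntegral_bumpIntegral`. For 0 < h < 1 the Π-contour can be collapsed onto
a real interval and the two sides of the vertical line through z', because the singularities of the
kernel there are integrable. The real interval smears to G. The jump across the vertical line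
smears, after an exchange of integrations, to an Euler integral for `legendreP`, that is, to G̃ on
the segment |Im z| < u' - u. The Π-contour itself never meets the branch cut of the kernel, so both
sides are holomorphic in h on Re h > 0, and the identity theorem removes the restriction h < 1.

Several propagators. The contour is a punctured line and n bumps. Over the punctured line, Fubini
replaces every Ĝ by G (`integral_punctured`). On the k-th bump the w_i with i ≠ k are integrated
first. The resulting function `smearedOthers` is holomorphic in z there, since Re z stays away from
the other z_i, so the local identity applies with it as the test function (`integral_bump`): it
returns the missing interval of the bulk integral minus π times the k-th G̃ term. Summation gives
`hatTerm_eq`: for all sufficiently small widths the Ĝ term equals the bulk integral minus π times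
the sum of the G̃ terms. It is eventually constant, so the limit needs no estimate.

Absolute convergence. Off the bumps, the product of the Ĝ is at most the product of the |G| times
integrable densities in the w_i, by the lower bound `exists_le_norm_G`; so the assumed convergence
of the bulk integral suffices. On the bumps, the kernel is at most r^(1-h-η) |x|^(-1+η) for r ≤ 1
and r^(-h) for r > 1, up to constants, and with the bounds on f this leaves an integrable function
of r. The G̃ terms are then integrable because the local identity writes them as a difference of
integrable functions. -/

/-! ### Holomorphic parameter integrals and horizontal contour shifts. -/

theorem differentiableOn_integral {X : Type*} [MeasurableSpace X] {μ : Measure X} {U : Set ℂ}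
    (hU : IsOpen U) {F : ℂ → X → ℂ} (hm : ∀ h ∈ U, AEStronglyMeasurable (F h) μ)
    (hd : ∀ᵐ x ∂μ, DifferentiableOn ℂ (fun h => F h x) U)
    (hb : ∀ h₀ ∈ U, ∃ s ∈ 𝓝 h₀, ∃ b : X → ℝ, Integrable b μ ∧ ∀ᵐ x ∂μ, ∀ h ∈ s, ‖F h x‖ ≤ b x) :
    DifferentiableOn ℂ (fun h => ∫ x, F h x ∂μ) U := by
  intro h₀ hh₀
  obtain ⟨s, hs, b, hbi, hbs⟩ := hb h₀ hh₀
  obtain ⟨ρ, hρ, hρs⟩ := Metric.mem_nhds_iff.1 (Filter.inter_mem hs (hU.mem_nhds hh₀))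
  have hsub : ∀ h ∈ Metric.ball h₀ (ρ / 2), Metric.closedBall h (ρ / 4) ⊆ s ∩ U := by
    intro h hh y hy
    apply hρs
    rw [Metric.mem_ball] at hh ⊢
    rw [Metric.mem_closedBall] at hy
    calc dist y h₀ ≤ dist y h + dist h h₀ := dist_triangle _ _ _
      _ < ρ := by linarith
  have hself : ∀ h ∈ Metric.ball h₀ (ρ / 2), h ∈ s ∩ U := fun h hh =>
    hsub h hh (Metric.mem_closedBall_self (by positivity))
  have h0mem : h₀ ∈ Metric.ball h₀ (ρ / 2) := Metric.mem_ball_self (by positivity)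
  refine (hasDerivAt_integral_of_dominated_loc_of_deriv_le (F := F)
    (F' := fun h x => deriv (fun h => F h x) h) (bound := fun x => b x / (ρ / 4))
    (Metric.ball_mem_nhds h₀ (half_pos hρ)) ?_ ?_ ?_ ?_ ?_ ?_).2.differentiableAt.differentiableWithinAt
  · filter_upwards [hU.mem_nhds hh₀] with h hh using hm h hh
  · refine hbi.mono' (hm h₀ hh₀) ?_
    filter_upwards [hbs] with x hx using hx h₀ (hself _ h0mem).1
  -- The derivative is measurable in x as an almost everywhere limit of difference quotients, taken
  -- along steps that stay inside U.
  · obtain ⟨v, hv0, hvt⟩ : ∃ v : ℕ → ℂ, (∀ n, v n ∈ {y : ℂ | y ≠ 0 ∧ h₀ + y ∈ U}) ∧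
        Tendsto v atTop (𝓝[≠] 0) := by
      have h1 : Tendsto (fun y : ℂ => h₀ + y) (𝓝[≠] 0) (𝓝 h₀) := by
        have : Tendsto (fun y : ℂ => h₀ + y) (𝓝 0) (𝓝 (h₀ + 0)) := by
          exact (continuous_const.add continuous_id).tendsto _
        rw [add_zero] at this
        exact this.mono_left nhdsWithin_le_nhds
      have h2 : ∀ᶠ y in 𝓝[≠] (0 : ℂ), y ≠ 0 ∧ h₀ + y ∈ U :=
        (eventually_mem_nhdsWithin).and (h1 (hU.mem_nhds hh₀))
      obtain ⟨v, hv⟩ := (exists_seq_tendsto (𝓝[≠] (0 : ℂ)))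
      obtain ⟨N, hN⟩ := eventually_atTop.1 (hv.eventually h2)
      exact ⟨fun n => v (n + N), fun n => hN _ (Nat.le_add_left _ _),
        hv.comp (tendsto_add_atTop_nat N)⟩
    refine aestronglyMeasurable_of_tendsto_ae atTop
      (f := fun n x => (v n)⁻¹ • (F (h₀ + v n) x - F h₀ x)) ?_ ?_
    · intro n
      exact ((hm _ (hv0 n).2).sub (hm _ hh₀)).const_smul ((v n)⁻¹ : ℂ)
    · filter_upwards [hd] with x hx
      have := (hx.differentiableAt (hU.mem_nhds hh₀)).hasDerivAt
      rw [hasDerivAt_iff_tendsto_slope_zero] at this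
      exact this.comp hvt
  · filter_upwards [hbs, hd] with x hx hdx h hh
    -- Cauchy's estimate on circles of radius ρ/4 turns the bound on F into a bound on its
    -- derivative.
    refine Complex.norm_deriv_le_of_forall_mem_sphere_norm_le (by positivity) ?_ ?_
    · refine (hdx.mono ?_).diffContOnCl
      exact (Metric.closure_ball_subset_closedBall.trans (hsub h hh)).trans inter_subset_right
    · intro z hz
      exact hx z (hsub h hh (Metric.sphere_subset_closedBall hz)).1
  · exact hbi.div_const _
  · filter_upwards [hd] with x hx h hh
    exact (hx.differentiableAt (hU.mem_nhds (hself h hh).2)).hasDerivAt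

/-- Cauchy's theorem on the rectangles with base [-T, T]; the vertical sides contribute at most |ψ|
b(±T), which tends to 0. -/
theorem integral_horizontal_shift {H : ℂ → ℂ} {ψ : ℝ}
    (hd : ∀ x y : ℝ, y ∈ uIcc 0 ψ → DifferentiableAt ℂ H (x + y * Complex.I)) {b : ℝ → ℝ}
    (hb : Integrable b) (hbt : Tendsto b atTop (𝓝 0)) (hbb : Tendsto b atBot (𝓝 0))
    (hle : ∀ x y : ℝ, y ∈ uIcc 0 ψ → ‖H (x + y * Complex.I)‖ ≤ b x) :
    ∫ x : ℝ, H (x + ψ * Complex.I) = ∫ x : ℝ, H x := by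
  have hcont : ∀ y ∈ uIcc 0 ψ, Continuous (fun x : ℝ => H (x + y * Complex.I)) := by
    intro y hy
    rw [continuous_iff_continuousAt]
    intro x
    exact ContinuousAt.comp (f := fun x : ℝ => (x : ℂ) + y * Complex.I) (g := H)
      (hd x y hy).continuousAt (by fun_prop)
  have hint : ∀ y ∈ uIcc 0 ψ, Integrable (fun x : ℝ => H (x + y * Complex.I)) := fun y hy =>
    hb.mono' (hcont y hy).aestronglyMeasurable (ae_of_all _ fun x => hle x y hy)
  have h0 : Integrable (fun x : ℝ => H x) := by simpa using hint 0 left_mem_uIcc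
  have hrect : ∀ T : ℝ, (∫ x in (-T)..T, H x) - (∫ x in (-T)..T, H (x + ψ * Complex.I)) =
      -(Complex.I * ∫ y in (0 : ℝ)..ψ, H (T + y * Complex.I)) +
      Complex.I * ∫ y in (0 : ℝ)..ψ, H ((-T : ℝ) + y * Complex.I) := by
    intro T
    have := Complex.integral_boundary_rect_eq_zero_of_differentiableOn H ((-T : ℝ) : ℂ)
      (T + ψ * Complex.I) (by
        intro z hz
        have := hd z.re z.im (by simpa using hz.2)
        rw [Complex.re_add_im] at this
        exact this.differentiableWithinAt)
    simp at this
    simp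
    linear_combination this
  have hside : ∀ l : Filter ℝ, Tendsto b l (𝓝 0) →
      Tendsto (fun T : ℝ => ∫ y in (0 : ℝ)..ψ, H (T + y * Complex.I)) l (𝓝 0) := by
    intro l hl
    refine squeeze_zero_norm (a := fun T => b T * |ψ - 0|) (fun T => ?_) (by simpa using hl.mul_const |ψ|)
    exact intervalIntegral.norm_integral_le_of_norm_le_const fun y hy => hle T y (uIoc_subset_uIcc hy)
  have hl1 := (intervalIntegral_tendsto_integral h0 tendsto_neg_atTop_atBot tendsto_id).sub
    (intervalIntegral_tendsto_integral (hint ψ right_mem_uIcc) tendsto_neg_atTop_atBot tendsto_id)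
  have hl2 : Tendsto (fun T : ℝ => -(Complex.I * ∫ y in (0 : ℝ)..ψ, H (T + y * Complex.I)) +
      Complex.I * ∫ y in (0 : ℝ)..ψ, H ((-T : ℝ) + y * Complex.I)) atTop (𝓝 0) := by
    have a1 := ((hside atTop hbt).const_mul Complex.I).neg
    have a2 := ((hside atBot hbb).comp tendsto_neg_atTop_atBot).const_mul Complex.I
    simpa using! a1.add a2
  have := tendsto_nhds_unique hl1 (hl2.congr fun T => (hrect T).symm)
  exact (sub_eq_zero.1 this).symm

/-! ### Möbius substitutions between intervals and the line. -/

/-- The increasing diffeomorphism of the line onto the interval `(α, β)` given by a Moebius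
transformation of the exponential. -/
noncomputable def expMoebius (α β c s : ℝ) : ℝ := (α * c + β * Real.exp s) / (c + Real.exp s)

section Moebius

variable {α β c : ℝ} {E : Type*} [NormedAddCommGroup E] [NormedSpace ℝ E]

theorem hasDerivAt_expMoebius (hc : 0 < c) (s : ℝ) :
    HasDerivAt (expMoebius α β c) ((β - α) * c * Real.exp s / (c + Real.exp s) ^ 2) s := by
  have hpos : c + Real.exp s ≠ 0 := by positivity
  have h := (((Real.hasDerivAt_exp s).const_mul β).const_add (α * c)).div
    ((Real.hasDerivAt_exp s).const_add c) hpos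
  refine h.congr_deriv ?_
  congr 1
  ring

theorem strictMono_expMoebius (hc : 0 < c) (hab : α < β) : StrictMono (expMoebius α β c) := by
  apply strictMono_of_deriv_pos
  intro s
  rw [(hasDerivAt_expMoebius hc s).deriv]
  have : 0 < β - α := sub_pos.2 hab
  positivity

theorem expMoebius_mem (hc : 0 < c) (hab : α < β) (s : ℝ) : expMoebius α β c s ∈ Ioo α β := by
  have := Real.exp_pos s
  unfold expMoebius
  constructor
  · rw [lt_div_iff₀ (by positivity)]; nlinarith
  · rw [div_lt_iff₀ (by positivity)]; nlinarith

theorem range_expMoebius (hc : 0 < c) (hab : α < β) : expMoebius α β c '' univ = Ioo α β := by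
  rw [image_univ]
  apply Subset.antisymm
  · rintro _ ⟨s, rfl⟩; exact expMoebius_mem hc hab s
  · rintro t ⟨h1, h2⟩
    have h1' : 0 < t - α := sub_pos.2 h1
    have h2' : 0 < β - t := sub_pos.2 h2
    refine ⟨Real.log (c * (t - α) / (β - t)), ?_⟩
    unfold expMoebius
    rw [Real.exp_log (by positivity)]
    have hne : c + c * (t - α) / (β - t) ≠ 0 := by positivity
    rw [div_eq_iff hne]
    field_simp
    ring

/-- Endpoint singularities become exponential behaviour at ±∞, which makes integrals over different
intervals comparable on the line. The parameter c only translates s by log c. -/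
theorem setIntegral_Ioo_eq_expMoebius (hc : 0 < c) (hab : α < β) (f : ℝ → E) :
    ∫ t in Ioo α β, f t =
      ∫ s : ℝ, ((β - α) * c * Real.exp s / (c + Real.exp s) ^ 2) • f (expMoebius α β c s) := by
  rw [← range_expMoebius hc hab, integral_image_eq_integral_abs_deriv_smul MeasurableSet.univ
    (fun s _ => (hasDerivAt_expMoebius hc s).hasDerivWithinAt)
    (strictMono_expMoebius hc hab).injective.injOn, Measure.restrict_univ]
  congr 1; ext s
  rw [abs_of_pos]
  have : 0 < β - α := sub_pos.2 hab
  positivity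

theorem integrableOn_Ioo_iff_expMoebius (hc : 0 < c) (hab : α < β) (f : ℝ → E) :
    IntegrableOn f (Ioo α β) ↔ Integrable fun s : ℝ =>
      ((β - α) * c * Real.exp s / (c + Real.exp s) ^ 2) • f (expMoebius α β c s) := by
  rw [← range_expMoebius hc hab, integrableOn_image_iff_integrableOn_abs_deriv_smul
    MeasurableSet.univ (fun s _ => (hasDerivAt_expMoebius hc s).hasDerivWithinAt)
    (strictMono_expMoebius hc hab).injective.injOn, integrableOn_univ]
  have : ∀ s, |(β - α) * c * Real.exp s / (c + Real.exp s) ^ 2| =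
      (β - α) * c * Real.exp s / (c + Real.exp s) ^ 2 := by
    intro s
    rw [abs_of_pos]
    have : 0 < β - α := sub_pos.2 hab
    positivity
  simp_rw [this]

end Moebius

/-! ### Binomial expansion, moments, and the Legendre integral for G. -/

/-- The coefficients of the binomial series `(1 - y) ^ (-c)`. -/
noncomputable def binomCoeff (c : ℝ) (n : ℕ) : ℝ := (ascPochhammer ℝ n).eval c / n.factorial

theorem binomCoeff_zero (c : ℝ) : binomCoeff c 0 = 1 := by simp [binomCoeff]

theorem binomCoeff_succ (c : ℝ) (n : ℕ) :
    binomCoeff c (n + 1) = binomCoeff c n * ((c + n) / (n + 1)) := by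
  unfold binomCoeff
  rw [ascPochhammer_succ_eval, Nat.factorial_succ]
  push_cast
  have : (n.factorial : ℝ) ≠ 0 := by positivity
  field_simp

theorem binomCoeff_nonneg {c : ℝ} (hc : 0 ≤ c) (n : ℕ) : 0 ≤ binomCoeff c n := by
  induction n with
  | zero => simp [binomCoeff_zero]
  | succ n ih => rw [binomCoeff_succ]; positivity

theorem hasSum_binomCoeff (c : ℝ) {y : ℝ} (hy : |y| < 1) :
    HasSum (fun n => binomCoeff c n * y ^ n) ((1 - y) ^ (-c)) := by
  have h := (Real.one_div_one_sub_rpow_hasFPowerSeriesOnBall_zero c).hasSum (y := y)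
    (by simpa [enorm_eq_nnnorm, ← NNReal.coe_lt_coe] using hy)
  have hpos : 0 < 1 - y := by linarith [(abs_lt.1 hy).2]
  rw [Real.rpow_neg hpos.le, ← one_div]
  rw [zero_add] at h
  have he : (fun n => binomCoeff c n * y ^ n) = fun n => (FormalMultilinearSeries.ofScalars ℝ
      (fun n => Ring.choose (c + (n : ℝ) - 1) n) n) fun _ => y := by
    ext n
    rw [FormalMultilinearSeries.ofScalars_apply_eq, smul_eq_mul]
    congr 1
    rw [← Ring.multichoose_eq]
    have := Ring.factorial_nsmul_multichoose_eq_ascPochhammer c n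
    rw [Polynomial.ascPochhammer_smeval_eq_eval] at this
    rw [binomCoeff, ← this, nsmul_eq_mul]
    field_simp
  rw [he]
  exact h

/-- Termwise integration of the binomial series. -/
theorem hasSum_integral_binom {X : Type*} [MeasurableSpace X] {μ : Measure X} {m τ : X → ℝ}
    (hm : Integrable m μ) (hτ : AEStronglyMeasurable τ μ) (hτ1 : ∀ᵐ x ∂μ, |τ x| ≤ 1) (c : ℝ)
    {y : ℝ} (hy0 : 0 ≤ y) (hy : y < 1) :
    HasSum (fun n => binomCoeff c n * y ^ n * ∫ x, τ x ^ n * m x ∂μ)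
      (∫ x, (1 - y * τ x) ^ (-c) * m x ∂μ) := by
  have hpow : ∀ n : ℕ, ∀ᵐ x ∂μ, ‖τ x ^ n * m x‖ ≤ ‖m x‖ := by
    intro n
    filter_upwards [hτ1] with x hx
    rw [norm_mul, norm_pow, Real.norm_eq_abs]
    exact mul_le_of_le_one_left (norm_nonneg _) (pow_le_one₀ (abs_nonneg _) hx)
  have hint : ∀ n : ℕ, Integrable (fun x => τ x ^ n * m x) μ := fun n =>
    hm.mono ((hτ.pow n).mul hm.1) (hpow n)
  have hF : ∀ n : ℕ, Integrable (fun x => binomCoeff c n * y ^ n * (τ x ^ n * m x)) μ :=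
    fun n => (hint n).const_mul _
  have hs : Summable fun n => ∫ x, ‖binomCoeff c n * y ^ n * (τ x ^ n * m x)‖ ∂μ := by
    have h1 : Summable fun n => |binomCoeff c n * y ^ n| * ∫ x, ‖m x‖ ∂μ :=
      ((hasSum_binomCoeff c (by rwa [abs_of_nonneg hy0])).summable.abs).mul_right _
    refine Summable.of_nonneg_of_le (fun n => integral_nonneg fun x => norm_nonneg _) (fun n => ?_) h1
    simp_rw [norm_mul (binomCoeff c n * y ^ n)]
    rw [integral_const_mul _ _, Real.norm_eq_abs]
    gcongr ?_ * ?_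
    exact integral_mono_ae (hint n).norm hm.norm (hpow n)
  have h := hasSum_integral_of_summable_integral_norm hF hs
  have hc : ∀ n, ∫ x, binomCoeff c n * y ^ n * (τ x ^ n * m x) ∂μ =
      binomCoeff c n * y ^ n * ∫ x, τ x ^ n * m x ∂μ := fun n => integral_const_mul _ _
  simp_rw [hc] at h
  have e : ∫ x, (1 - y * τ x) ^ (-c) * m x ∂μ =
      ∫ x, ∑' n, binomCoeff c n * y ^ n * (τ x ^ n * m x) ∂μ := by
   refine integral_congr_ae ?_
   filter_upwards [hτ1] with x hx
   have hlt : |y * τ x| < 1 := by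
    rw [abs_mul, abs_of_nonneg hy0]
    calc y * |τ x| ≤ y * 1 := by gcongr
      _ < 1 := by linarith
   have h2 := (hasSum_binomCoeff c hlt).mul_right (m x)
   rw [← h2.tsum_eq]
   congr 1; ext n
   rw [mul_pow]; ring
  rw [e]
  exact h

/-- An affine rescaling of the convergent Beta integral. -/
theorem integrableOn_rpow_mul_rpow {p q a b : ℝ} (hp : -1 < p) (hq : -1 < q) (hab : a < b) :
    IntegrableOn (fun x => (x - a) ^ p * (b - x) ^ q) (Ioo a b) := by
  have h0 : IntervalIntegrable (fun x : ℝ => x ^ p * (1 - x) ^ q) volume 0 1 := by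
    have := (Complex.betaIntegral_convergent (u := p + 1) (v := q + 1) (by simp; linarith)
      (by simp; linarith)).norm
    rw [intervalIntegrable_iff_integrableOn_Ioo_of_le zero_le_one] at this ⊢
    refine this.congr_fun (fun x hx => ?_) measurableSet_Ioo
    have h1 : (1 : ℂ) - x = ((1 - x : ℝ) : ℂ) := by push_cast; rfl
    simp only [add_sub_cancel_right]
    rw [norm_mul, h1, ← Complex.ofReal_cpow hx.1.le, ← Complex.ofReal_cpow (by linarith [hx.2]),
      Complex.norm_real, Complex.norm_real, Real.norm_of_nonneg (Real.rpow_nonneg hx.1.le _),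
      Real.norm_of_nonneg (Real.rpow_nonneg (by linarith [hx.2]) _)]
  have hba : 0 < b - a := sub_pos.2 hab
  have h1 := (h0.comp_mul_left (c := (b - a)⁻¹)).comp_sub_right a
  rw [intervalIntegrable_iff_integrableOn_Ioo_of_le (by simp; linarith)] at h1
  have h2 : Ioo (0 / (b - a)⁻¹ + a) (1 / (b - a)⁻¹ + a) = Ioo a b := by simp
  rw [h2] at h1
  have h3 : IntegrableOn _ (Ioo a b) := h1.const_mul ((b - a) ^ p * (b - a) ^ q)
  refine h3.congr_fun (fun x hx => ?_) measurableSet_Ioo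
  have e1 : x - a = (b - a) * ((b - a)⁻¹ * (x - a)) := by field_simp
  have e2 : b - x = (b - a) * (1 - (b - a)⁻¹ * (x - a)) := by field_simp; ring
  have p1 : 0 ≤ (b - a)⁻¹ * (x - a) := by have := sub_pos.2 hx.1; positivity
  have p2 : 0 ≤ 1 - (b - a)⁻¹ * (x - a) := by
    have := sub_pos.2 hx.2
    rw [e2] at this
    exact (pos_of_mul_pos_right this hba.le).le
  dsimp only
  rw [e2, Real.mul_rpow hba.le p2]
  have e3 : (x - a) ^ p = (b - a) ^ p * ((b - a)⁻¹ * (x - a)) ^ p := by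
    rw [← Real.mul_rpow hba.le p1, ← e1]
  rw [e3]
  ring

theorem integrableOn_sq_sub_sq_rpow {p R : ℝ} (hp : -1 < p) (hR : 0 < R) :
    IntegrableOn (fun t => (R ^ 2 - t ^ 2) ^ p) (Ioo (-R) R) := by
  refine (integrableOn_rpow_mul_rpow hp hp (neg_lt_self hR)).congr_fun (fun x hx => ?_)
    measurableSet_Ioo
  dsimp only
  rw [← Real.mul_rpow (by linarith [hx.1]) (by linarith [hx.2])]
  congr 1; ring

/-- The moments of the weight `(1 - t²)^(h-1)` on `(-1, 1)`. -/
noncomputable def ballMoment (h : ℝ) (n : ℕ) : ℝ :=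
  ∫ t in Ioo (-1 : ℝ) 1, t ^ n * (1 - t ^ 2) ^ (h - 1)

theorem integrableOn_pow_mul_one_sub_sq {h : ℝ} (hh : 0 < h) (n : ℕ) :
    IntegrableOn (fun t => t ^ n * (1 - t ^ 2) ^ (h - 1)) (Ioo (-1 : ℝ) 1) := by
  have h1 := integrableOn_sq_sub_sq_rpow (p := h - 1) (by linarith) one_pos
  simp only [one_pow] at h1
  refine Integrable.mono h1 ((by fun_prop : Measurable fun t : ℝ => t ^ n * (1 - t ^ 2) ^ (h - 1))).aestronglyMeasurable ?_
  filter_upwards [ae_restrict_mem measurableSet_Ioo] with t ht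
  rw [norm_mul, norm_pow, Real.norm_eq_abs]
  exact mul_le_of_le_one_left (norm_nonneg _) (pow_le_one₀ (abs_nonneg _) (abs_lt.2 ht).le)

/-- The primitive vanishes at ±1 because h > 0. This is the integration by parts behind the
recursion of the moments. -/
theorem integral_deriv_pow_mul_one_sub_sq {h : ℝ} (hh : 0 < h) (n : ℕ) {f' : ℝ → ℝ}
    (hf' : ∀ t ∈ Ioo (-1 : ℝ) 1, HasDerivAt (fun t : ℝ => t ^ n * (1 - t ^ 2) ^ h) (f' t) t)
    (hi : IntegrableOn f' (Ioo (-1 : ℝ) 1)) : ∫ t in Ioo (-1 : ℝ) 1, f' t = 0 := by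
  rw [← integral_Ioc_eq_integral_Ioo, ← intervalIntegral.integral_of_le (by norm_num),
    intervalIntegral.integral_eq_sub_of_hasDerivAt_of_le (by norm_num) ?_ hf'
      ((intervalIntegrable_iff_integrableOn_Ioo_of_le (by norm_num)).2 hi)]
  · simp [Real.zero_rpow hh.ne']
  · refine Continuous.continuousOn ?_
    exact (continuous_pow n).mul ((continuous_const.sub (continuous_pow 2)).rpow_const
      fun _ => Or.inr hh.le)

theorem hasDerivAt_one_sub_sq_rpow {h t : ℝ} (ht : t ∈ Ioo (-1 : ℝ) 1) :
    HasDerivAt (fun t : ℝ => (1 - t ^ 2) ^ h) (-(2 * h * t) * (1 - t ^ 2) ^ (h - 1)) t := by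
  have hpos : 0 < 1 - t ^ 2 := by nlinarith [ht.1, ht.2]
  have := (((hasDerivAt_pow 2 t).const_sub 1).rpow_const (p := h) (Or.inl hpos.ne'))
  convert this using 1
  push_cast; ring

theorem ballMoment_one {h : ℝ} (hh : 0 < h) : ballMoment h 1 = 0 := by
  have := integral_deriv_pow_mul_one_sub_sq hh 0
    (f' := fun t => -(2 * h) * (t ^ 1 * (1 - t ^ 2) ^ (h - 1))) (fun t ht => by
      simpa [mul_assoc] using hasDerivAt_one_sub_sq_rpow (h := h) ht)
    ((integrableOn_pow_mul_one_sub_sq hh 1).const_mul _)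
  rw [integral_const_mul] at this
  rcases mul_eq_zero.1 this with h0 | h0
  · linarith
  · exact h0

theorem ballMoment_add_two {h : ℝ} (hh : 0 < h) (n : ℕ) :
    (n + 1 + 2 * h) * ballMoment h (n + 2) = (n + 1) * ballMoment h n := by
  have key := integral_deriv_pow_mul_one_sub_sq hh (n + 1)
    (f' := fun t => (n + 1) * (t ^ n * (1 - t ^ 2) ^ (h - 1)) -
      (n + 1 + 2 * h) * (t ^ (n + 2) * (1 - t ^ 2) ^ (h - 1))) (fun t ht => by
      have hpos : 0 < 1 - t ^ 2 := by nlinarith [ht.1, ht.2]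
      have := (hasDerivAt_pow (n + 1) t).mul (hasDerivAt_one_sub_sq_rpow (h := h) ht)
      refine this.congr_deriv ?_
      have e : (1 - t ^ 2) ^ h = (1 - t ^ 2) ^ (h - 1) * (1 - t ^ 2) := by
        rw [← Real.rpow_add_one hpos.ne']; congr 1; ring
      rw [e]; push_cast; ring)
    (Integrable.sub (Integrable.const_mul (integrableOn_pow_mul_one_sub_sq hh n) _)
      (Integrable.const_mul (integrableOn_pow_mul_one_sub_sq hh (n + 2)) _))
  rw [integral_sub (Integrable.const_mul (integrableOn_pow_mul_one_sub_sq hh n) _)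
      (Integrable.const_mul (integrableOn_pow_mul_one_sub_sq hh (n + 2)) _), integral_const_mul,
      integral_const_mul] at key
  unfold ballMoment
  linarith

theorem ballMoment_odd {h : ℝ} (hh : 0 < h) (n : ℕ) : ballMoment h (2 * n + 1) = 0 := by
  induction n with
  | zero => simpa using ballMoment_one hh
  | succ n ih =>
    have := ballMoment_add_two hh (2 * n + 1)
    rw [ih, mul_zero] at this
    rcases mul_eq_zero.1 this with h0 | h0
    · have : (0 : ℝ) < ((2 * n + 1 : ℕ) : ℝ) + 1 + 2 * h := by positivity
      linarith
    · exact h0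

/-- Both sides obey the same recursion in n, with ratio (h+2n)(h+2n+1) / ((2n+2)(2n+1+2h)). -/
theorem binomCoeff_mul_ballMoment_even {h : ℝ} (hh : 0 < h) (n : ℕ) :
    binomCoeff h (2 * n) * ballMoment h (2 * n) = ballMoment h 0 *
      (((n.factorial : ℝ)⁻¹) * (ascPochhammer ℝ n).eval (h / 2) *
        (ascPochhammer ℝ n).eval (h / 2 + 1 / 2) * ((ascPochhammer ℝ n).eval (h + 1 / 2))⁻¹) := by
  induction n with
  | zero => simp [binomCoeff_zero]
  | succ n ih =>
    have h1 := ballMoment_add_two hh (2 * n)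
    have hne : ((2 * n : ℕ) : ℝ) + 1 + 2 * h ≠ 0 := by positivity
    have h2 : ballMoment h (2 * n + 2) =
        (((2 * n : ℕ) : ℝ) + 1) / (((2 * n : ℕ) : ℝ) + 1 + 2 * h) * ballMoment h (2 * n) := by
      field_simp; linarith
    have e : 2 * (n + 1) = 2 * n + 1 + 1 := by ring
    rw [e, binomCoeff_succ, binomCoeff_succ, h2, ascPochhammer_succ_eval, ascPochhammer_succ_eval,
      ascPochhammer_succ_eval, Nat.factorial_succ]
    have hp : (ascPochhammer ℝ n).eval (h + 1 / 2) ≠ 0 := (ascPochhammer_pos n _ (by positivity)).ne'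
    calc _ = (binomCoeff h (2 * n) * ballMoment h (2 * n)) *
        ((h + 2 * n) * (h + 2 * n + 1) / ((2 * n + 2) * (2 * n + 1 + 2 * h))) := by
          push_cast
          push_cast at hne
          field_simp
          ring
      _ = _ := by
          rw [ih]
          push_cast
          push_cast at hne
          have hne' : h + 1 / 2 + (n : ℝ) ≠ 0 := by positivity
          field_simp
          ring

theorem ascPochhammer_eval_ofReal (n : ℕ) (x : ℝ) :
    (ascPochhammer ℂ n).eval (x : ℂ) = (((ascPochhammer ℝ n).eval x : ℝ) : ℂ) := by
  rw [← ascPochhammer_map Complex.ofRealHom, Polynomial.eval_map]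
  exact Polynomial.eval₂_at_apply Complex.ofRealHom x

/-- Expand (1 - yt)^(-h) and integrate term by term: the odd moments vanish and the even ones
reproduce the hypergeometric coefficients. -/
theorem ballMoment_zero_mul_hypergeometric {h : ℝ} (hh : 0 < h) {y : ℝ} (hy0 : 0 ≤ y) (hy : y < 1) :
    (ballMoment h 0 : ℂ) * ordinaryHypergeometric ((h : ℂ) / 2) ((h : ℂ) / 2 + 1 / 2)
      ((h : ℂ) + 1 / 2) ((y : ℂ) ^ 2) =
      ((∫ t in Ioo (-1 : ℝ) 1, (1 - y * t) ^ (-h) * (1 - t ^ 2) ^ (h - 1) : ℝ) : ℂ) := by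
  have hm := integrableOn_pow_mul_one_sub_sq hh 0
  simp only [pow_zero, one_mul] at hm
  have hs := hasSum_integral_binom (τ := fun t => t) hm aestronglyMeasurable_id (by
    filter_upwards [ae_restrict_mem measurableSet_Ioo] with t ht using (abs_lt.2 ht).le) h hy0 hy
  change HasSum (fun n => binomCoeff h n * y ^ n * ballMoment h n) _ at hs
  have hinj : Function.Injective (fun n : ℕ => 2 * n) := fun a b hab => by simpa using hab
  rw [← hinj.hasSum_iff (fun n hn => by
    have hodd : Odd n := by
      rw [← Nat.not_even_iff_odd]
      rintro ⟨k, rfl⟩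
      exact hn ⟨k, by simp [two_mul]⟩
    obtain ⟨k, rfl⟩ := hodd
    rw [ballMoment_odd hh, mul_zero])] at hs
  have hs' := (Complex.hasSum_ofReal.2 hs)
  rw [← hs'.tsum_eq, ordinaryHypergeometric_eq_tsum, ← tsum_mul_left]
  congr 1; ext n
  have e1 : (h : ℂ) / 2 = ((h / 2 : ℝ) : ℂ) := by push_cast; rfl
  have e2 : (h : ℂ) / 2 + 1 / 2 = ((h / 2 + 1 / 2 : ℝ) : ℂ) := by push_cast; rfl
  have e3 : (h : ℂ) + 1 / 2 = ((h + 1 / 2 : ℝ) : ℂ) := by push_cast; rfl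
  rw [e2, e3, e1, ascPochhammer_eval_ofReal, ascPochhammer_eval_ofReal, ascPochhammer_eval_ofReal]
  have := binomCoeff_mul_ballMoment_even hh n
  simp only [Function.comp, smul_eq_mul]
  rw [mul_right_comm (binomCoeff h (2 * n)), this, pow_mul]
  push_cast
  ring

/-- Twice the Legendre function of the second kind of degree `h - 1` at the point `1 / ξ`. -/
noncomputable def legendreQ (h : ℂ) (ξ : ℝ) : ℂ :=
  ∫ θ : ℝ, ((ξ / (1 + √(1 - ξ ^ 2) * Real.cosh θ) : ℝ) : ℂ) ^ h

/-- With t = tanh(s/2) the integrand becomes a power of 2ξ / (2 + (1-ξ)e^s + (1+ξ)e^(-s)).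
Translating s by log((1+ξ)/√(1-ξ²)) balances the two exponentials into a cosh. -/
theorem integral_one_sub_mul_rpow_eq {h ξ : ℝ} (hξ0 : 0 < ξ) (hξ1 : ξ < 1) :
    (ξ / 2) ^ h * ∫ t in Ioo (-1 : ℝ) 1, (1 - ξ * t) ^ (-h) * (1 - t ^ 2) ^ (h - 1) =
      1 / 2 * ∫ θ : ℝ, (ξ / (1 + √(1 - ξ ^ 2) * Real.cosh θ)) ^ h := by
  have hρ : 0 < √(1 - ξ ^ 2) := Real.sqrt_pos.2 (by nlinarith)
  have hρ2 : √(1 - ξ ^ 2) ^ 2 = 1 - ξ ^ 2 := Real.sq_sqrt (by nlinarith)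
  set ρ := √(1 - ξ ^ 2) with hρdef
  have hr : 0 < (1 + ξ) / ρ := by positivity
  rw [setIntegral_Ioo_eq_expMoebius one_pos (by norm_num : (-1 : ℝ) < 1), ← integral_const_mul,
    ← integral_const_mul, ← integral_sub_right_eq_self (fun θ => 1 / 2 * (ξ / (1 + ρ * Real.cosh θ)) ^ h)
      (Real.log ((1 + ξ) / ρ))]
  congr 1; ext s
  have he := Real.exp_pos s
  have hcosh : 1 + ρ * Real.cosh (s - Real.log ((1 + ξ) / ρ)) =
      1 + ((1 - ξ) * Real.exp s + (1 + ξ) / Real.exp s) / 2 := by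
    rw [Real.cosh_eq, neg_sub, Real.exp_sub, Real.exp_sub, Real.exp_log hr]
    have : 1 + ξ ≠ 0 := by positivity
    field_simp
    have : Real.exp s ^ 2 * ρ ^ 2 = Real.exp s ^ 2 * (1 - ξ ^ 2) := by rw [hρ2]
    linear_combination this
  rw [hcosh]
  unfold expMoebius
  set e := Real.exp s
  have hA : 0 < 1 - ((-1 * 1 + 1 * e) / (1 + e)) ^ 2 := by
    have : 1 - ((-1 * 1 + 1 * e) / (1 + e)) ^ 2 = 4 * e / (1 + e) ^ 2 := by field_simp; ring
    rw [this]; positivity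
  have hB : 1 - ξ * ((-1 * 1 + 1 * e) / (1 + e)) = ((1 + ξ) + (1 - ξ) * e) / (1 + e) := by
    field_simp; ring
  have hξ' : 0 < 1 - ξ := by linarith
  have hBpos : 0 < ((1 + ξ) + (1 - ξ) * e) / (1 + e) := by positivity
  rw [hB, Real.rpow_sub_one hA.ne', Real.rpow_neg hBpos.le]
  have h1 : ξ / (1 + ((1 - ξ) * e + (1 + ξ) / e) / 2) =
      (ξ / 2) * (1 - ((-1 * 1 + 1 * e) / (1 + e)) ^ 2) / (((1 + ξ) + (1 - ξ) * e) / (1 + e)) := by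
    have h2 : 1 + ((1 - ξ) * e + (1 + ξ) / e) / 2 ≠ 0 := by positivity
    rw [div_eq_div_iff h2 hBpos.ne']
    field_simp
    ring
  rw [h1, Real.div_rpow (by positivity) hBpos.le, Real.mul_rpow (by positivity) hA.le]
  have h2 : (1 - -1) * 1 * e / (1 + e) ^ 2 = (1 - ((-1 * 1 + 1 * e) / (1 + e)) ^ 2) / 2 := by
    field_simp; ring
  rw [h2, smul_eq_mul]
  generalize 1 - ((-1 * 1 + 1 * e) / (1 + e)) ^ 2 = A at *
  field_simp

theorem legendreQ_ofReal {h ξ : ℝ} (hξ0 : 0 < ξ) :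
    legendreQ h ξ = ((∫ θ : ℝ, (ξ / (1 + √(1 - ξ ^ 2) * Real.cosh θ)) ^ h : ℝ) : ℂ) := by
  rw [legendreQ, ← integral_complex_ofReal]
  congr 1; ext θ
  have := Real.cosh_pos θ
  exact (Complex.ofReal_cpow (by positivity) _).symm

/-- The mass of the weight is 2^(2h-1) B(h, h) = 2^(2h-1) Γ(h)²/Γ(2h), and the constant c_h is
normalised by it. -/
theorem smearConst_mul_ballMoment {h : ℝ} (hh : 0 < h) :
    Complex.I * smearConst h * ballMoment h 0 = 1 := by
  have hJ : (ballMoment h 0 : ℂ) = 2 ^ (2 * (h : ℂ) - 1) * Complex.betaIntegral h h := by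
    have := Complex.betaIntegral_scaled h h (a := 2) two_pos
    rw [← two_mul, Complex.ofReal_ofNat] at this
    rw [← this, ballMoment, ← integral_Ioc_eq_integral_Ioo, ← intervalIntegral.integral_of_le
      (by norm_num), ← intervalIntegral.integral_ofReal]
    have h2 := intervalIntegral.integral_comp_add_right (a := -1) (b := 1)
      (fun x : ℝ => (x : ℂ) ^ ((h : ℂ) - 1) * ((2 : ℂ) - x) ^ ((h : ℂ) - 1)) 1
    norm_num at h2
    rw [← h2]
    refine intervalIntegral.integral_congr fun t ht => ?_
    rw [uIcc_of_le (by norm_num)] at ht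
    have e1 : (t : ℂ) + 1 = ((t + 1 : ℝ) : ℂ) := by push_cast; rfl
    have e2 : (2 : ℂ) - ((t + 1 : ℝ) : ℂ) = ((1 - t : ℝ) : ℂ) := by push_cast; ring
    have e3 : (h : ℂ) - 1 = ((h - 1 : ℝ) : ℂ) := by push_cast; rfl
    rw [e1, e2, e3, ← Complex.ofReal_cpow (by linarith [ht.1]),
      ← Complex.ofReal_cpow (by linarith [ht.2]), ← Complex.ofReal_mul,
      ← Real.mul_rpow (by linarith [ht.1]) (by linarith [ht.2])]
    norm_num
    congr 1; ring
  have hΓ := Complex.Gamma_mul_Gamma_eq_betaIntegral (s := h) (t := h) (by simpa) (by simpa)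
  have hΓ0 : Complex.Gamma h ≠ 0 := Complex.Gamma_ne_zero_of_re_pos (by simpa)
  have h4 : (4 : ℂ) ^ (h : ℂ) = 2 ^ (2 * (h : ℂ) - 1) * 2 := by
    have e : (4 : ℂ) = ((2 : ℝ) : ℂ) * ((2 : ℝ) : ℂ) := by norm_num
    rw [e, Complex.mul_cpow_ofReal_nonneg zero_le_two zero_le_two, Complex.ofReal_ofNat,
      Complex.cpow_sub _ _ two_ne_zero, Complex.cpow_one, two_mul, Complex.cpow_add _ _ two_ne_zero]
    field_simp
  have h2 : (2 : ℂ) ^ (2 * (h : ℂ) - 1) ≠ 0 := by simp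
  rw [smearConst, hJ, h4]
  field_simp
  rw [Complex.I_sq, sq, hΓ, two_mul]
  ring

/-- The integral of (1-ξt)^(-h) (1-t²)^(h-1) is evaluated twice: by series it gives the
hypergeometric function in G, by substitution the Legendre integral. -/
theorem G_eq_legendreQ {h u u' ξ : ℝ} {z z' : ℂ} (hh : 0 < h) (hξ0 : 0 < ξ) (hξ1 : ξ < 1)
    (hξ : xi u z u' z' = ξ) :
    G h u z u' z' = Complex.I * smearConst h / 2 * legendreQ h ξ := by
  have hJ := smearConst_mul_ballMoment hh
  have hJ0 : (ballMoment h 0 : ℂ) ≠ 0 := right_ne_zero_of_mul_eq_one hJ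
  have h1 := ballMoment_zero_mul_hypergeometric hh hξ0.le hξ1
  have h2 := congrArg (fun x : ℝ => (x : ℂ)) (integral_one_sub_mul_rpow_eq (h := h) hξ0 hξ1)
  simp only [Complex.ofReal_mul] at h2
  rw [← h1, ← legendreQ_ofReal hξ0, Complex.ofReal_cpow (by positivity)] at h2
  rw [G, hξ]
  push_cast at h2
  have hI : Complex.I * smearConst h = (ballMoment h 0 : ℂ)⁻¹ := eq_inv_of_mul_eq_one_left hJ
  rw [hI]
  generalize ordinaryHypergeometric ((h : ℂ) / 2) ((h : ℂ) / 2 + 1 / 2) ((h : ℂ) + 1 / 2)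
    ((ξ : ℂ) ^ 2) = F at h2 ⊢
  field_simp
  linear_combination 2 * h2

/-- A positive factor does not change the argument, so principal powers split without a branch
correction. -/
theorem ofReal_mul_cpow {r : ℝ} (hr : 0 < r) {z : ℂ} (hz : z ≠ 0) (s : ℂ) :
    ((r : ℂ) * z) ^ s = (r : ℂ) ^ s * z ^ s := by
  have hr0 : (r : ℂ) ≠ 0 := Complex.ofReal_ne_zero.2 hr.ne'
  rw [Complex.cpow_def_of_ne_zero (mul_ne_zero hr0 hz), Complex.cpow_def_of_ne_zero hr0,
    Complex.cpow_def_of_ne_zero hz, Complex.log_ofReal_mul hr hz, Complex.ofReal_log hr.le, add_mul,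
    Complex.exp_add]

theorem ofReal_div_mem_slitPlane {r : ℝ} (hr : 0 < r) {w : ℂ} (hw : w ∈ Complex.slitPlane) :
    (r : ℂ) / w ∈ Complex.slitPlane := by
  have hw0 : 0 < Complex.normSq w := Complex.normSq_pos.2 (Complex.slitPlane_ne_zero hw)
  rw [Complex.mem_slitPlane_iff] at hw ⊢
  rw [Complex.div_re, Complex.div_im]
  simp only [Complex.ofReal_re, Complex.ofReal_im, zero_mul, zero_div, add_zero, zero_sub]
  rcases hw with h | h
  · left; positivity
  · right
    rw [neg_ne_zero]
    positivity

/-! ### Shifting the Legendre integral within the strip |Im θ| < π. -/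

theorem integrable_exp_neg_mul_abs {a : ℝ} (ha : 0 < a) :
    Integrable fun x : ℝ => Real.exp (-a * |x|) := by
  have h1 : IntegrableOn (fun x : ℝ => Real.exp (-a * |x|)) (Ioi 0) :=
    (exp_neg_integrableOn_Ioi 0 ha).congr_fun (fun x hx => by
      simp only [abs_of_pos (mem_Ioi.1 hx)]) measurableSet_Ioi
  have h2 : IntegrableOn (fun x : ℝ => Real.exp (-a * |x|)) (Iic 0) := by
    rw [← neg_zero, ← integrableOn_Ici_iff_integrableOn_Ioi] at h1
    have := h1.comp_neg
    simpa using this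
  rw [← integrableOn_univ, ← Iic_union_Ioi (a := (0 : ℝ))]
  exact h2.union h1

theorem exp_abs_le_two_mul_cosh (x : ℝ) : Real.exp |x| ≤ 2 * Real.cosh x := by
  rw [← Real.cosh_abs, Real.cosh_eq]
  have := Real.exp_pos (-|x|)
  linarith

theorem cosh_add_mul_I (x y : ℝ) : Complex.cosh (x + y * Complex.I) =
    (Real.cosh x * Real.cos y : ℝ) + (Real.sinh x * Real.sin y : ℝ) * Complex.I := by
  rw [Complex.cosh_add, Complex.cosh_mul_I, Complex.sinh_mul_I]
  push_cast
  ring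

theorem one_add_mul_cosh_eq (ρ x y : ℝ) : 1 + (ρ : ℂ) * Complex.cosh (x + y * Complex.I) =
    (1 + ρ * (Real.cosh x * Real.cos y) : ℝ) + (ρ * (Real.sinh x * Real.sin y) : ℝ) * Complex.I := by
  rw [cosh_add_mul_I]; push_cast; ring

/-- The imaginary part ρ sinh x sin y vanishes in the strip only for x = 0 or y = 0, and there the
real part is positive, in the first case because ρ < 1. -/
theorem one_add_mul_cosh_mem_slitPlane {ρ x y : ℝ} (hρ0 : 0 < ρ) (hρ1 : ρ < 1) (hy : |y| < Real.pi) :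
    1 + (ρ : ℂ) * Complex.cosh (x + y * Complex.I) ∈ Complex.slitPlane := by
  rw [one_add_mul_cosh_eq, Complex.mem_slitPlane_iff]
  simp only [Complex.add_re, Complex.ofReal_re, Complex.mul_re, Complex.I_re, mul_zero,
    Complex.ofReal_im, Complex.I_im, mul_one, sub_self, add_zero, Complex.add_im, Complex.mul_im,
    zero_add]
  by_cases hx : x = 0
  · left
    rw [hx, Real.cosh_zero, one_mul]
    nlinarith [Real.neg_one_le_cos y]
  by_cases hy0 : y = 0
  · left
    rw [hy0, Real.cos_zero, mul_one]
    have := Real.cosh_pos x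
    positivity
  · right
    refine mul_ne_zero hρ0.ne' (mul_ne_zero (by simpa using hx) ?_)
    intro hs
    rw [Real.sin_eq_zero_iff_of_lt_of_lt (abs_lt.1 hy).1 (abs_lt.1 hy).2] at hs
    exact hy0 hs

/-- Rests on |1 + ρ cosh(x+iy)|² = (ρ cosh x + cos y)² + (1-ρ²) sin² y. If cos y ≥ 0 or ρ cosh x >
2, the first square suffices. Otherwise the second term does, since for cos y < 0 it is at least its
value at ψ. The bound is uniform in |y| ≤ |ψ| and grows like cosh x, as the shift requires. -/
theorem le_norm_one_add_mul_cosh {ρ x y ψ : ℝ} (hρ0 : 0 < ρ) (hρ1 : ρ < 1) (hψ : |ψ| < Real.pi)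
    (hy : |y| ≤ |ψ|) : √((1 - ρ ^ 2) * Real.sin ψ ^ 2) / 2 * (ρ * Real.cosh x) ≤
      ‖1 + (ρ : ℂ) * Complex.cosh (x + y * Complex.I)‖ := by
  have hc := Real.cosh_pos x
  have hX : 0 < ρ * Real.cosh x := by positivity
  have hnn : 0 ≤ (1 - ρ ^ 2) * Real.sin ψ ^ 2 := mul_nonneg (by nlinarith) (sq_nonneg _)
  refine (pow_le_pow_iff_left₀ (by positivity) (norm_nonneg _) two_ne_zero).1 ?_
  rw [← Complex.normSq_eq_norm_sq, one_add_mul_cosh_eq, Complex.normSq_add_mul_I, mul_pow, div_pow,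
    Real.sq_sqrt hnn]
  have hcos : Real.cos ψ ≤ Real.cos y := by
    rw [← Real.cos_abs ψ, ← Real.cos_abs y]
    exact Real.cos_le_cos_of_nonneg_of_le_pi (abs_nonneg _) hψ.le hy
  have e : (1 + ρ * (Real.cosh x * Real.cos y)) ^ 2 + (ρ * (Real.sinh x * Real.sin y)) ^ 2 =
      (ρ * Real.cosh x + Real.cos y) ^ 2 + (1 - Real.cos y ^ 2) * (1 - ρ ^ 2) := by
    have h1 := Real.cosh_sq x
    have h2 := Real.sin_sq_add_cos_sq y
    have h3 : Real.sinh x ^ 2 = Real.cosh x ^ 2 - 1 := by linarith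
    have h4 : Real.sin y ^ 2 = 1 - Real.cos y ^ 2 := by linarith
    calc _ = (1 + ρ * (Real.cosh x * Real.cos y)) ^ 2 + ρ ^ 2 * (Real.sinh x ^ 2 * Real.sin y ^ 2) := by ring
      _ = _ := by rw [h3, h4]; ring
  have hs : Real.sin ψ ^ 2 = 1 - Real.cos ψ ^ 2 := by linarith [Real.sin_sq_add_cos_sq ψ]
  rw [e, hs]
  set X := ρ * Real.cosh x
  have hm1' := Real.neg_one_le_cos y
  set m := Real.cos y
  set m0 := Real.cos ψ
  have hm1 : m ≤ 1 := Real.cos_le_one y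
  have hm0 : -1 ≤ m0 := Real.neg_one_le_cos ψ
  have hd0 : 0 < 1 - ρ ^ 2 := by nlinarith
  have hd1 : 1 - ρ ^ 2 ≤ 1 := by nlinarith
  have hmm : m ^ 2 ≤ 1 := by nlinarith
  have hb1 : (1 - ρ ^ 2) * (1 - m0 ^ 2) ≤ 1 := by
    linarith [mul_nonneg hd0.le (sq_nonneg m0)]
  have hb0 : 0 ≤ (1 - ρ ^ 2) * (1 - m0 ^ 2) := by rw [hs] at hnn; exact hnn
  have h3 : 0 ≤ (1 - m ^ 2) * (1 - ρ ^ 2) := mul_nonneg (by linarith) hd0.le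
  have h1 : m < 0 → (1 - ρ ^ 2) * (1 - m0 ^ 2) ≤ (1 - m ^ 2) * (1 - ρ ^ 2) := fun hm => by
    rw [mul_comm]
    exact mul_le_mul_of_nonneg_right (by nlinarith) hd0.le
  clear_value X m m0
  generalize (1 - ρ ^ 2) * (1 - m0 ^ 2) = b at *
  generalize (1 - m ^ 2) * (1 - ρ ^ 2) = d at *
  have h4 : b / 2 ^ 2 * X ^ 2 ≤ X ^ 2 / 4 := by
    have := mul_nonneg (sub_nonneg.2 hb1) (sq_nonneg X)
    linarith
  by_cases hm : 0 ≤ m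
  · have := mul_nonneg hX.le hm
    have e3 : (X + m) ^ 2 = X ^ 2 + 2 * (X * m) + m ^ 2 := by ring
    have := sq_nonneg X
    have := sq_nonneg m
    linarith
  · push Not at hm
    by_cases hX2 : X ≤ 2
    · have h5 : X ^ 2 ≤ 4 := by nlinarith
      have h6 : b / 2 ^ 2 * X ^ 2 ≤ b := by
        have := mul_nonneg hb0 (sub_nonneg.2 h5)
        linarith
      have := sq_nonneg (X + m)
      linarith [h1 hm]
    · push Not at hX2
      have hXm : X / 2 ≤ X + m := by linarith
      have h2 : X ^ 2 / 4 ≤ (X + m) ^ 2 := by nlinarith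
      linarith

/-- The integral defining `legendreQ` may be taken along any horizontal line of the strip
`|Im θ| < π`. -/
theorem legendreQ_eq_integral_shift {h ξ ψ : ℝ} (hh : 0 < h) (hξ0 : 0 < ξ) (hξ1 : ξ < 1)
    (hψ : |ψ| < Real.pi) (hψ0 : Real.sin ψ ≠ 0) :
    ∫ θ : ℝ, ((ξ : ℂ) / (1 + (√(1 - ξ ^ 2) : ℝ) * Complex.cosh (θ + ψ * Complex.I))) ^ (h : ℂ) =
      legendreQ h ξ := by
  have hρ0 : 0 < √(1 - ξ ^ 2) := Real.sqrt_pos.2 (by nlinarith)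
  have hρ1 : √(1 - ξ ^ 2) < 1 := by
    rw [Real.sqrt_lt' one_pos]; nlinarith
  have hyψ : ∀ y ∈ uIcc 0 ψ, |y| ≤ |ψ| := fun y hy => by
    simpa using abs_sub_left_of_mem_uIcc hy
  set ρ := √(1 - ξ ^ 2)
  set κ := √((1 - ρ ^ 2) * Real.sin ψ ^ 2) / 2 * ρ with hκdef
  have hκ : 0 < κ := by
    have : 0 < (1 - ρ ^ 2) * Real.sin ψ ^ 2 := mul_pos (by nlinarith) (by positivity)
    have := Real.sqrt_pos.2 this
    positivity
  rw [integral_horizontal_shift (H := fun ζ => ((ξ : ℂ) / (1 + (ρ : ℂ) * Complex.cosh ζ)) ^ (h : ℂ))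
    (b := fun x => (2 * ξ / κ) ^ h * Real.exp (-h * |x|))]
  · rw [legendreQ]
    congr 1; ext θ
    push_cast
    rfl
  · intro x y hy
    have hm := one_add_mul_cosh_mem_slitPlane (x := x) hρ0 hρ1 ((hyψ y hy).trans_lt hψ)
    refine DifferentiableAt.cpow_const ?_ (ofReal_div_mem_slitPlane hξ0 hm)
    refine DifferentiableAt.div (by fun_prop) ?_ (Complex.slitPlane_ne_zero hm)
    exact (Complex.differentiable_cosh _).const_mul (ρ : ℂ) |>.const_add 1
  · exact (integrable_exp_neg_mul_abs hh).const_mul _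
  · rw [← mul_zero ((2 * ξ / κ) ^ h)]
    refine Tendsto.const_mul _ (Real.tendsto_exp_atBot.comp ?_)
    exact tendsto_abs_atTop_atTop.const_mul_atTop_of_neg (neg_lt_zero.2 hh)
  · rw [← mul_zero ((2 * ξ / κ) ^ h)]
    refine Tendsto.const_mul _ (Real.tendsto_exp_atBot.comp ?_)
    exact tendsto_abs_atBot_atTop.const_mul_atTop_of_neg (neg_lt_zero.2 hh)
  · intro x y hy
    have h1 := le_norm_one_add_mul_cosh (x := x) hρ0 hρ1 hψ (hyψ y hy)
    have h2 := exp_abs_le_two_mul_cosh x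
    have hcp := Real.cosh_pos x
    rw [Complex.norm_cpow_real, norm_div, Complex.norm_of_nonneg hξ0.le]
    have h3 : Real.exp (-h * |x|) = (Real.exp (-|x|)) ^ h := by
      rw [← Real.exp_mul]; congr 1; ring
    rw [h3, ← Real.mul_rpow (by positivity) (by positivity)]
    refine Real.rpow_le_rpow (by positivity) ?_ hh.le
    have h4 : κ * (Real.exp |x| / 2) ≤ ‖1 + (ρ : ℂ) * Complex.cosh (x + y * Complex.I)‖ := by
      refine le_trans ?_ h1
      rw [hκdef, mul_assoc]
      gcongr
      linarith
    calc ξ / ‖1 + (ρ : ℂ) * Complex.cosh (x + y * Complex.I)‖ ≤ ξ / (κ * (Real.exp |x| / 2)) := by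
          gcongr
      _ = 2 * ξ / κ * Real.exp (-|x|) := by
          rw [Real.exp_neg]; field_simp

/-! ### Smearing the kernel over a segment. -/

/-- The weight `(u' / (u'² - t²))^(1-h)` of the smearing function on the segment `w = z' + i t`. -/
noncomputable def smearWeight (h : ℂ) (u' t : ℝ) : ℂ := ((u' / (u' ^ 2 - t ^ 2) : ℝ) : ℂ) ^ (1 - h)

/-- The kernel `(u / (u² + ζ²))^h`. -/
noncomputable def kernel (h : ℂ) (u : ℝ) (ζ : ℂ) : ℂ := ((u : ℂ) / ((u : ℂ) ^ 2 + ζ ^ 2)) ^ h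

theorem add_sq_mem_slitPlane {u D y : ℝ} (hD : D ≠ 0) :
    (u : ℂ) ^ 2 + (D + y * Complex.I) ^ 2 ∈ Complex.slitPlane := by
  have e : (u : ℂ) ^ 2 + (D + y * Complex.I) ^ 2 =
      ((u ^ 2 + D ^ 2 - y ^ 2 : ℝ) : ℂ) + ((2 * D * y : ℝ) : ℂ) * Complex.I := by
    push_cast
    linear_combination (y : ℂ) ^ 2 * Complex.I_sq
  rw [e, Complex.mem_slitPlane_iff]
  simp only [Complex.add_re, Complex.ofReal_re, Complex.mul_re, Complex.I_re, mul_zero,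
    Complex.ofReal_im, Complex.I_im, mul_one, sub_self, add_zero, Complex.add_im, Complex.mul_im,
    zero_add]
  by_cases hy : y = 0
  · left
    have : 0 < D ^ 2 := by positivity
    rw [hy]; nlinarith [sq_nonneg u]
  · right; positivity

/-- With t = u' tanh(s/2) and C = cosh²(s/2), one has (u² + (D-it)²) C = (B/2)(1 + ρ cosh(s + iψ)),
where B = u² + u'² + D² and Bρ e^(iψ) = u² + D² - u'² - 2iu'D. The powers of C from weight, kernel
and Jacobian cancel, and what is left is the Legendre integral along Im θ = ψ. -/
theorem integral_smearWeight_mul_kernel {h u u' D : ℝ} (hh : 0 < h) (hu : 0 < u) (hu' : 0 < u')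
    (hD : D ≠ 0) :
    ∫ t in Ioo (-u') u', smearWeight h u' t * kernel h u (D - t * Complex.I) =
      1 / 2 * legendreQ h (2 * u * u' / (u ^ 2 + u' ^ 2 + D ^ 2)) := by
  have hB : 0 < u ^ 2 + u' ^ 2 + D ^ 2 := by positivity
  have hD2 : 0 < D ^ 2 := by positivity
  set B := u ^ 2 + u' ^ 2 + D ^ 2 with hBdef
  set ξ := 2 * u * u' / B with hξdef
  have hξ0 : 0 < ξ := by positivity
  have hξ1 : ξ < 1 := by
    rw [hξdef, div_lt_one hB]; nlinarith [sq_nonneg (u - u')]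
  set ρ := √(1 - ξ ^ 2) with hρdef
  have hρ2 : ρ ^ 2 = 1 - ξ ^ 2 := Real.sq_sqrt (by nlinarith)
  have hρ0 : 0 < ρ := Real.sqrt_pos.2 (by nlinarith)
  have hρ1 : ρ < 1 := by rw [hρdef, Real.sqrt_lt' one_pos]; nlinarith
  -- The argument of α is the height ψ of the shifted line; its imaginary part is nonzero since D ≠
  -- 0, which keeps ψ away from 0 and ±π.
  let α : ℂ := ⟨u ^ 2 + D ^ 2 - u' ^ 2, -(2 * u' * D)⟩
  have hαn : ‖α‖ = B * ρ := by
    rw [← Real.sqrt_sq (norm_nonneg α), ← Complex.normSq_eq_norm_sq, Complex.normSq_mk,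
      ← Real.sqrt_sq (by positivity : 0 ≤ B * ρ), mul_pow, hρ2, hξdef, div_pow]
    congr 1
    have : B ^ 2 * (1 - (2 * u * u') ^ 2 / B ^ 2) = B ^ 2 - (2 * u * u') ^ 2 := by field_simp
    rw [this, hBdef]; ring
  have hα0 : α ≠ 0 := by
    intro h0
    rw [h0, norm_zero] at hαn
    have : 0 < B * ρ := by positivity
    linarith
  set ψ := Complex.arg α with hψdef
  have hcos : B * ρ * Real.cos ψ = u ^ 2 + D ^ 2 - u' ^ 2 := by
    rw [← hαn, hψdef, Complex.norm_mul_cos_arg]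
  have hsin : B * ρ * Real.sin ψ = -(2 * u' * D) := by
    rw [← hαn, hψdef, Complex.norm_mul_sin_arg]
  have hsin0 : Real.sin ψ ≠ 0 := by
    intro h0
    rw [h0, mul_zero] at hsin
    have : 2 * u' * D ≠ 0 := by positivity
    exact this (by linarith)
  have hψπ : |ψ| < Real.pi := by
    rw [abs_lt]
    refine ⟨Complex.neg_pi_lt_arg α, lt_of_le_of_ne (Complex.arg_le_pi α) fun h0 => ?_⟩
    rw [h0] at hsin0
    simp at hsin0
  rw [← legendreQ_eq_integral_shift hh hξ0 hξ1 hψπ hsin0, ← integral_const_mul,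
    setIntegral_Ioo_eq_expMoebius one_pos (neg_lt_self hu')]
  congr 1; ext s
  have he := Real.exp_pos s
  have hC : 0 < Real.cosh s := Real.cosh_pos s
  have hm := one_add_mul_cosh_mem_slitPlane (x := s) hρ0 hρ1 hψπ
  set t := expMoebius (-u') u' 1 s with ht
  set C := (1 + Real.cosh s) / 2 with hCdef
  have hCpos : 0 < C := by positivity
  have hce : C = (1 + Real.exp s) ^ 2 / (4 * Real.exp s) := by
    rw [hCdef, Real.cosh_eq, Real.exp_neg]; field_simp; ring
  have htC : t * C = u' * Real.sinh s / 2 := by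
    rw [hce, ht, expMoebius, Real.sinh_eq, Real.exp_neg]; field_simp; ring
  have ht2C : t ^ 2 * C = u' ^ 2 * (Real.cosh s - 1) / 2 := by
    rw [hce, ht, expMoebius, Real.cosh_eq, Real.exp_neg]; field_simp; ring
  have hjac : (u' - -u') * 1 * Real.exp s / (1 + Real.exp s) ^ 2 = u' / (2 * C) := by
    rw [hce]; field_simp; ring
  have hweight : u' / (u' ^ 2 - t ^ 2) = C / u' := by
    have h1 : (u' ^ 2 - t ^ 2) * C = u' ^ 2 := by
      rw [sub_mul, ht2C, hCdef]; ring
    have h2 : u' ^ 2 - t ^ 2 ≠ 0 := by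
      intro h0
      rw [h0, zero_mul] at h1
      have : 0 < u' ^ 2 := by positivity
      linarith
    rw [div_eq_div_iff h2 hu'.ne']; linarith
  have hZ : ((u : ℂ) ^ 2 + (D - t * Complex.I) ^ 2) * C =
      (B / 2 : ℝ) * (1 + (ρ : ℂ) * Complex.cosh (s + ψ * Complex.I)) := by
    rw [one_add_mul_cosh_eq]
    have e1 : (u ^ 2 + D ^ 2) * C - t ^ 2 * C = B / 2 * (1 + ρ * (Real.cosh s * Real.cos ψ)) := by
      rw [ht2C, hCdef]
      linear_combination (-Real.cosh s / 2) * hcos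
    have e2 : -(2 * D) * (t * C) = B / 2 * (ρ * (Real.sinh s * Real.sin ψ)) := by
      rw [htC]
      linear_combination (-Real.sinh s / 2) * hsin
    have e1' := congrArg (fun x : ℝ => (x : ℂ)) e1
    have e2' := congrArg (fun x : ℝ => (x : ℂ)) e2
    push_cast at e1' e2' ⊢
    linear_combination e1' + Complex.I * e2' + (t : ℂ) ^ 2 * C * Complex.I_sq
  set W := 1 + (ρ : ℂ) * Complex.cosh (s + ψ * Complex.I) with hW
  have hW0 : W ≠ 0 := Complex.slitPlane_ne_zero hm
  have hCC : (C : ℂ) ≠ 0 := Complex.ofReal_ne_zero.2 hCpos.ne'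
  have hBC : (B : ℂ) ≠ 0 := Complex.ofReal_ne_zero.2 hB.ne'
  have huC : (u' : ℂ) ≠ 0 := Complex.ofReal_ne_zero.2 hu'.ne'
  have hbase : (u : ℂ) / ((u : ℂ) ^ 2 + (D - t * Complex.I) ^ 2) =
      ((C / u' : ℝ) : ℂ) * ((ξ : ℂ) / W) := by
    have hZ0 : (u : ℂ) ^ 2 + (D - t * Complex.I) ^ 2 ≠ 0 := by
      intro h0
      rw [h0, zero_mul] at hZ
      have : ((B / 2 : ℝ) : ℂ) ≠ 0 := Complex.ofReal_ne_zero.2 (by positivity)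
      exact mul_ne_zero this hW0 hZ.symm
    rw [hξdef]
    push_cast at hZ ⊢
    field_simp
    linear_combination -2 * (u : ℂ) * hZ
  have hξW : (ξ : ℂ) / W ≠ 0 := div_ne_zero (Complex.ofReal_ne_zero.2 hξ0.ne') hW0
  have hCu : ((C / u' : ℝ) : ℂ) ≠ 0 := Complex.ofReal_ne_zero.2 (by positivity)
  rw [smearWeight, kernel, hjac, hweight, hbase, ofReal_mul_cpow (by positivity) hξW,
    Complex.cpow_sub _ _ hCu, Complex.cpow_one, Complex.real_smul]
  have hne : ((C / u' : ℝ) : ℂ) ^ (h : ℂ) ≠ 0 :=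
    fun h0 => hCu ((Complex.cpow_eq_zero_iff _ _).1 h0).1
  push_cast at hne ⊢
  field_simp

/-! ### Euler integrals for the Legendre function of the first kind. -/

/-- The Legendre function of the first kind of degree `h - 1` at the point `1 / ξ`, in terms of
`κ = 2ξ / (1 + ξ)`. -/
noncomputable def legendreP (h : ℂ) (κ : ℝ) : ℂ :=
  (κ : ℂ) ^ (1 - h) * ordinaryHypergeometric (1 - h) (1 - h) 1 ((1 - κ : ℝ) : ℂ)

/-- The moment is Γ(1-h+n) Γ(h) / n!, and the reflection formula gives Γ(1-h) Γ(h) = π / sin(πh). -/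
theorem beta_moment {h : ℝ} (hh0 : 0 < h) (hh1 : h < 1) (n : ℕ) :
    ∫ x in Ioo (0 : ℝ) 1, x ^ n * (x ^ (-h) * (1 - x) ^ (h - 1)) =
      Real.pi / Real.sin (Real.pi * h) * binomCoeff (1 - h) n := by
  have hint : ((∫ x in Ioo (0 : ℝ) 1, x ^ n * (x ^ (-h) * (1 - x) ^ (h - 1)) : ℝ) : ℂ) =
      Complex.betaIntegral (1 - h + n) h := by
    rw [← integral_complex_ofReal, Complex.betaIntegral, intervalIntegral.integral_of_le zero_le_one,
      integral_Ioc_eq_integral_Ioo]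
    refine setIntegral_congr_fun measurableSet_Ioo fun x hx => ?_
    have e1 : (1 : ℂ) - x = ((1 - x : ℝ) : ℂ) := by push_cast; rfl
    have e2 : (1 - (h : ℂ) + n - 1) = ((-h + n : ℝ) : ℂ) := by push_cast; ring
    have e3 : (h : ℂ) - 1 = ((h - 1 : ℝ) : ℂ) := by push_cast; rfl
    rw [e1, e2, e3, ← Complex.ofReal_cpow hx.1.le, ← Complex.ofReal_cpow (by linarith [hx.2]),
      ← Complex.ofReal_mul, Real.rpow_add hx.1, Real.rpow_natCast]
    congr 1; ring
  have hre : ∀ k : ℕ, (1 - h : ℂ) ≠ -k := by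
    intro k hk
    have := congrArg Complex.re hk
    simp at this
    have : (0 : ℝ) ≤ k := k.cast_nonneg
    linarith
  have hΓ := Complex.Gamma_mul_Gamma_eq_betaIntegral (s := 1 - h + n) (t := h)
    (by simp; positivity) (by simpa)
  have hsum : (1 - h + n : ℂ) + h = n + 1 := by ring
  have hΓ2 := Complex.Gamma_add_nat_div_Gamma_eq (n := n) _ hre
  have hΓ3 := Complex.Gamma_mul_Gamma_one_sub (h : ℂ)
  have hΓ0 : Complex.Gamma (1 - h) ≠ 0 := Complex.Gamma_ne_zero hre
  rw [div_eq_iff hΓ0] at hΓ2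
  rw [hsum, Complex.Gamma_nat_eq_factorial, ← hint, hΓ2] at hΓ
  have e4 : (1 : ℂ) - h = ((1 - h : ℝ) : ℂ) := by push_cast; rfl
  have hfac : (n.factorial : ℂ) ≠ 0 := by exact_mod_cast n.factorial_ne_zero
  have e5 : (ascPochhammer ℂ n).eval (1 - h : ℂ) = (binomCoeff (1 - h) n : ℂ) * n.factorial := by
    rw [e4, ascPochhammer_eval_ofReal, binomCoeff]
    push_cast
    field_simp
  rw [e5] at hΓ
  apply Complex.ofReal_injective
  push_cast
  rw [← hΓ3]
  apply mul_left_cancel₀ hfac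
  linear_combination -hΓ

theorem integrableOn_beta_weight {h : ℝ} (hh0 : 0 < h) (hh1 : h < 1) :
    IntegrableOn (fun x : ℝ => x ^ (-h) * (1 - x) ^ (h - 1)) (Ioo 0 1) := by
  simpa using integrableOn_rpow_mul_rpow (p := -h) (q := h - 1) (by linarith) (by linarith)
    (zero_lt_one' ℝ)

/-- Euler's integral: expand the factor with parameter 1 - κ < 1 and integrate term by term against
the beta weight. -/
theorem integral_euler_eq_legendreP {h κ : ℝ} (hh0 : 0 < h) (hh1 : h < 1) (hκ0 : 0 < κ)
    (hκ1 : κ ≤ 1) :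
    ((κ ^ (1 - h) * ∫ x in Ioo (0 : ℝ) 1,
      (1 - (1 - κ) * x) ^ (-(1 - h)) * (x ^ (-h) * (1 - x) ^ (h - 1)) : ℝ) : ℂ) =
      Real.pi / Real.sin (Real.pi * h) * legendreP h κ := by
  have hs := hasSum_integral_binom (τ := fun x => x) (integrableOn_beta_weight hh0 hh1)
    aestronglyMeasurable_id (by
      filter_upwards [ae_restrict_mem measurableSet_Ioo] with t ht
      rw [abs_of_pos ht.1]; exact ht.2.le) (1 - h) (y := 1 - κ) (by linarith) (by linarith)
  have hs' := (Complex.hasSum_ofReal.2 hs)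
  rw [Complex.ofReal_mul, ← hs'.tsum_eq, legendreP, ordinaryHypergeometric_eq_tsum,
    mul_left_comm, Complex.ofReal_cpow hκ0.le]
  push_cast
  rw [← tsum_mul_left (a := (Real.pi / Complex.sin (Real.pi * h) : ℂ))]
  congr 1
  refine tsum_congr fun n => ?_
  have e4 : (1 : ℂ) - h = ((1 - h : ℝ) : ℂ) := by push_cast; rfl
  rw [beta_moment hh0 hh1, ascPochhammer_eval_one, smul_eq_mul, e4, ascPochhammer_eval_ofReal,
    binomCoeff]
  push_cast
  ring

/-- The integrand on the left has branch points v ± u and ±u'. The substitution sends v + u and u'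
to e^s = 0 and ∞, and c is chosen so that v - u goes to -1; then -u' goes to -1/κ with κ =
4uu'/((u+u')² - v²). In x = e^s/(1+e^s) the Euler integrand has the same four branch points, so the
pullbacks differ by a constant factor. -/
theorem moebius_pullback_eq {h u u' v : ℝ} (hu : 0 < u) (hv : |v| < u' - u) (s : ℝ) :
    ((u' - (v + u)) * ((u' + u - v) / (2 * u)) * Real.exp s /
        ((u' + u - v) / (2 * u) + Real.exp s) ^ 2) •
      ((u' / (u' ^ 2 - (expMoebius (v + u) u' ((u' + u - v) / (2 * u)) s) ^ 2)) ^ (1 - h) *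
        (u / ((expMoebius (v + u) u' ((u' + u - v) / (2 * u)) s - v) ^ 2 - u ^ 2)) ^ h) =
    (1 / 2 * (4 * u * u' / ((u + u') ^ 2 - v ^ 2)) ^ (1 - h)) *
      (((1 - 0) * 1 * Real.exp s / (1 + Real.exp s) ^ 2) •
      ((1 - (1 - 4 * u * u' / ((u + u') ^ 2 - v ^ 2)) * expMoebius 0 1 1 s) ^ (-(1 - h)) *
        ((expMoebius 0 1 1 s) ^ (-h) * (1 - expMoebius 0 1 1 s) ^ (h - 1)))) := by
  obtain ⟨hv1, hv2⟩ := abs_lt.1 hv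
  have hu' : 0 < u' := by linarith [abs_nonneg v]
  have hp : 0 < u' - u - v := by linarith
  have hq : 0 < u' + u + v := by linarith
  have hr : 0 < u' + u - v := by linarith
  have he := Real.exp_pos s
  have hκeq : 4 * u * u' / ((u + u') ^ 2 - v ^ 2) = 4 * u * u' / ((u' + u + v) * (u' + u - v)) := by
    congr 1; ring
  rw [hκeq]
  set κ := 4 * u * u' / ((u' + u + v) * (u' + u - v)) with hκ
  have hκ0 : 0 < κ := by positivity
  unfold expMoebius
  set e := Real.exp s
  set γ := (u' + u - v) / (2 * u) with hγ
  have hγ0 : 0 < γ := by positivity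
  have hx : (0 * 1 + 1 * e) / (1 + e) = e / (1 + e) := by ring
  rw [hx]
  have hX : u' / (u' ^ 2 - (((v + u) * γ + u' * e) / (γ + e)) ^ 2) =
      u' * (γ + e) ^ 2 / ((u' - u - v) * γ * ((u' + u + v) * γ + 2 * u' * e)) := by
    have : u' ^ 2 - (((v + u) * γ + u' * e) / (γ + e)) ^ 2 =
        ((u' - u - v) * γ * ((u' + u + v) * γ + 2 * u' * e)) / (γ + e) ^ 2 := by
      field_simp; ring
    rw [this]; field_simp
  have hY : u / ((((v + u) * γ + u' * e) / (γ + e) - v) ^ 2 - u ^ 2) =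
      (γ + e) ^ 2 / (2 * (u' - u - v) * γ * e * (1 + e)) := by
    have h2γ : u' = 2 * u * γ - u + v := by rw [hγ]; field_simp; ring
    have : (((v + u) * γ + u' * e) / (γ + e) - v) ^ 2 - u ^ 2 =
        u * (2 * (u' - u - v) * γ * e * (1 + e)) / (γ + e) ^ 2 := by
      rw [h2γ]; field_simp; ring
    rw [this]; field_simp
  have hκ' : κ = 2 * u' / ((u' + u + v) * γ) := by rw [hκ, hγ]; field_simp; ring
  rw [hX, hY]
  have hW : (1 - (1 - κ) * (e / (1 + e))) = (1 + κ * e) / (1 + e) := by field_simp; ring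
  have hW2 : 1 - e / (1 + e) = 1 / (1 + e) := by field_simp; ring
  rw [hW, hW2]
  have hXp : 0 < u' * (γ + e) ^ 2 / ((u' - u - v) * γ * ((u' + u + v) * γ + 2 * u' * e)) := by
    positivity
  have hYp : 0 < (γ + e) ^ 2 / (2 * (u' - u - v) * γ * e * (1 + e)) := by positivity
  have hZp : 0 < (1 + κ * e) / (κ * e * (1 + e)) := by positivity
  have hYX : (γ + e) ^ 2 / (2 * (u' - u - v) * γ * e * (1 + e)) =
      (u' * (γ + e) ^ 2 / ((u' - u - v) * γ * ((u' + u + v) * γ + 2 * u' * e))) *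
        ((1 + κ * e) / (κ * e * (1 + e))) := by
    rw [hκ']; field_simp
  have hl : ∀ X Z : ℝ, 0 < X → 0 < Z → X ^ (1 - h) * (X * Z) ^ h = X * Z ^ h := by
    intro X Z hX hZ
    rw [Real.mul_rpow hX.le hZ.le, ← mul_assoc, ← Real.rpow_add hX, sub_add_cancel, Real.rpow_one]
  rw [hYX, hl _ _ hXp hZp]
  have hr2 : ((1 + κ * e) / (1 + e)) ^ (-(1 - h)) *
      ((e / (1 + e)) ^ (-h) * (1 / (1 + e)) ^ (h - 1)) * κ ^ (1 - h) =
      κ * (1 + e) ^ 2 / (1 + κ * e) * ((1 + κ * e) / (κ * e * (1 + e))) ^ h := by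
    have h1 : 0 < 1 + κ * e := by positivity
    have h2 : 0 < 1 + e := by positivity
    rw [Real.div_rpow h1.le h2.le, Real.div_rpow he.le h2.le, Real.div_rpow zero_le_one h2.le,
      Real.div_rpow h1.le (by positivity), Real.mul_rpow (by positivity) h2.le,
      Real.mul_rpow hκ0.le he.le, Real.one_rpow, neg_sub, Real.rpow_sub h1, Real.rpow_sub h2,
      Real.rpow_sub hκ0, Real.rpow_neg he.le, Real.rpow_neg h2.le, Real.rpow_one, Real.rpow_one,
      Real.rpow_one]
    have := Real.rpow_pos_of_pos h1 h
    have := Real.rpow_pos_of_pos h2 h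
    have := Real.rpow_pos_of_pos hκ0 h
    have := Real.rpow_pos_of_pos he h
    field_simp
  simp only [smul_eq_mul]
  calc _ = e * κ / (2 * (1 + κ * e)) * ((1 + κ * e) / (κ * e * (1 + e))) ^ h := by
        rw [← mul_assoc]
        congr 1
        rw [hκ']
        field_simp
        ring
    _ = 1 / 2 * ((1 - 0) * 1 * e / (1 + e) ^ 2) *
        (((1 + κ * e) / (1 + e)) ^ (-(1 - h)) *
      ((e / (1 + e)) ^ (-h) * (1 / (1 + e)) ^ (h - 1)) * κ ^ (1 - h)) := by
        rw [hr2]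
        field_simp
        ring
    _ = _ := by ring

/-- After transport to the Euler form, the extra factor has a base at least κ > 0 and is bounded, so
the beta weight decides. -/
theorem integrableOn_spacelike {h u u' v : ℝ} (hh0 : 0 < h) (hh1 : h < 1) (hu : 0 < u)
    (hv : |v| < u' - u) :
    IntegrableOn (fun t => (u' / (u' ^ 2 - t ^ 2)) ^ (1 - h) * (u / ((t - v) ^ 2 - u ^ 2)) ^ h)
      (Ioo (v + u) u') := by
  obtain ⟨hv1, hv2⟩ := abs_lt.1 hv
  have hu' : 0 < u' := by linarith [abs_nonneg v]
  rw [integrableOn_Ioo_iff_expMoebius (c := (u' + u - v) / (2 * u))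
    (div_pos (by linarith) (by linarith)) (by linarith)]
  simp_rw [moebius_pullback_eq hu hv]
  refine Integrable.const_mul ?_ _
  rw [← integrableOn_Ioo_iff_expMoebius (α := 0) (β := 1) (c := 1) one_pos zero_lt_one (fun x =>
    (1 - (1 - 4 * u * u' / ((u + u') ^ 2 - v ^ 2)) * x) ^ (-(1 - h)) *
      (x ^ (-h) * (1 - x) ^ (h - 1)))]
  have hden : 0 < (u + u') ^ 2 - v ^ 2 := by nlinarith
  have hκ0 : 0 < 4 * u * u' / ((u + u') ^ 2 - v ^ 2) := by positivity
  have hκ1 : 4 * u * u' / ((u + u') ^ 2 - v ^ 2) ≤ 1 := by rw [div_le_one hden]; nlinarith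
  set κ := 4 * u * u' / ((u + u') ^ 2 - v ^ 2)
  refine Integrable.bdd_mul (c := κ ^ (-(1 - h))) (integrableOn_beta_weight hh0 hh1)
    (Measurable.pow_const (by fun_prop) _).aestronglyMeasurable ?_
  filter_upwards [ae_restrict_mem measurableSet_Ioo] with x hx
  have hlow : κ ≤ 1 - (1 - κ) * x := by nlinarith [hx.1, hx.2]
  rw [Real.norm_of_nonneg (Real.rpow_nonneg (by linarith) _)]
  exact Real.rpow_le_rpow_of_nonpos hκ0 hlow (by linarith)

/-- This evaluates the smeared jump of the kernel across its cut, at height v. -/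
theorem integral_spacelike {h u u' v : ℝ} (hh0 : 0 < h) (hh1 : h < 1) (hu : 0 < u)
    (hv : |v| < u' - u) :
    ((∫ t in Ioo (v + u) u',
      (u' / (u' ^ 2 - t ^ 2)) ^ (1 - h) * (u / ((t - v) ^ 2 - u ^ 2)) ^ h : ℝ) : ℂ) =
      Real.pi / (2 * Real.sin (Real.pi * h)) *
        legendreP h (4 * u * u' / ((u + u') ^ 2 - v ^ 2)) := by
  obtain ⟨hv1, hv2⟩ := abs_lt.1 hv
  have hu' : 0 < u' := by linarith [abs_nonneg v]
  have hden : 0 < (u + u') ^ 2 - v ^ 2 := by nlinarith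
  have hκ0 : 0 < 4 * u * u' / ((u + u') ^ 2 - v ^ 2) := by positivity
  have hκ1 : 4 * u * u' / ((u + u') ^ 2 - v ^ 2) ≤ 1 := by rw [div_le_one hden]; nlinarith
  have h1 := integral_euler_eq_legendreP hh0 hh1 hκ0 hκ1
  rw [setIntegral_Ioo_eq_expMoebius (c := (u' + u - v) / (2 * u))
    (div_pos (by linarith) (by linarith)) (by linarith)]
  simp_rw [moebius_pullback_eq hu hv]
  rw [integral_const_mul, ← setIntegral_Ioo_eq_expMoebius (α := 0) (β := 1) (c := 1) one_pos
    zero_lt_one (fun x => (1 - (1 - 4 * u * u' / ((u + u') ^ 2 - v ^ 2)) * x) ^ (-(1 - h)) *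
      (x ^ (-h) * (1 - x) ^ (h - 1))), mul_assoc, Complex.ofReal_mul, h1]
  push_cast
  have hs : Complex.sin (Real.pi * h) ≠ 0 := by
    have : 0 < Real.sin (Real.pi * h) := Real.sin_pos_of_pos_of_lt_pi (by positivity)
      (by nlinarith [Real.pi_pos])
    exact_mod_cast this.ne'
  field_simp

/-! ### Boundary values of the kernel and the connection formula. -/

/-- The boundary values of `kernel` on the imaginary axis, from the right. -/
noncomputable def kernelBdry (h u y : ℝ) : ℂ :=
  if |y| < u then (((u / (u ^ 2 - y ^ 2)) ^ h : ℝ) : ℂ)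
  else (((u / (y ^ 2 - u ^ 2)) ^ h : ℝ) : ℂ) *
    Complex.exp (if 0 < y then -(Real.pi * h * Complex.I) else Real.pi * h * Complex.I)

/-- Factor u² + ζ² = (u + iζ)(u - iζ); the factors have real parts u - y and u + y. -/
theorem norm_add_sq_ge (u x y : ℝ) : |u ^ 2 - y ^ 2| ≤ ‖(u : ℂ) ^ 2 + (x + y * Complex.I) ^ 2‖ := by
  have e : (u : ℂ) ^ 2 + (x + y * Complex.I) ^ 2 =
      (((u - y : ℝ) : ℂ) + (x : ℝ) * Complex.I) * (((u + y : ℝ) : ℂ) + (-x : ℝ) * Complex.I) := by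
    push_cast
    linear_combination ((y : ℂ) ^ 2 + (x : ℂ) ^ 2) * Complex.I_sq
  have h1 : ∀ a b : ℝ, |a| ≤ ‖(a : ℂ) + b * Complex.I‖ := fun a b => by
    simpa using Complex.abs_re_le_norm ((a : ℂ) + b * Complex.I)
  rw [e, norm_mul, show u ^ 2 - y ^ 2 = (u - y) * (u + y) by ring, abs_mul]
  exact mul_le_mul (h1 _ _) (h1 _ _) (abs_nonneg _) (norm_nonneg _)

theorem sq_sub_sq_ne_zero {u y : ℝ} (hu : 0 < u) (hy : |y| ≠ u) : u ^ 2 - y ^ 2 ≠ 0 := by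
  intro h0
  apply hy
  rw [← abs_of_pos hu]
  exact (sq_eq_sq_iff_abs_eq_abs _ _).1 (by linarith)

theorem norm_kernel_le {h u x y : ℝ} (hh : 0 ≤ h) (hu : 0 < u) (hy : |y| ≠ u) :
    ‖kernel h u (x + y * Complex.I)‖ ≤ (u / |u ^ 2 - y ^ 2|) ^ h := by
  have h0 : 0 < |u ^ 2 - y ^ 2| := abs_pos.2 (sq_sub_sq_ne_zero hu hy)
  rw [kernel, Complex.norm_cpow_real, norm_div, Complex.norm_of_nonneg hu.le]
  refine Real.rpow_le_rpow (by positivity) ?_ hh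
  exact div_le_div_of_nonneg_left hu.le h0 (norm_add_sq_ge u x y)

theorem norm_kernelBdry {h u y : ℝ} (hu : 0 < u) (hy : |y| ≠ u) :
    ‖kernelBdry h u y‖ = (u / |u ^ 2 - y ^ 2|) ^ h := by
  unfold kernelBdry
  split_ifs with h1 h2
  · have : 0 < u ^ 2 - y ^ 2 := by nlinarith [sq_abs y, abs_nonneg y]
    rw [Complex.norm_of_nonneg (Real.rpow_nonneg (by positivity) _), abs_of_pos this]
  all_goals
    have hlt : u < |y| := lt_of_le_of_ne (not_lt.1 h1) hy.symm
    have : 0 < y ^ 2 - u ^ 2 := by nlinarith [sq_abs y, abs_nonneg y]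
    rw [norm_mul, Complex.norm_of_nonneg (Real.rpow_nonneg (by positivity) _), Complex.norm_exp,
      abs_sub_comm, abs_of_pos this]
    simp

/-- For |y| > u the base approaches the negative axis, with imaginary part of the sign of -y, so its
argument tends to -π for y > 0 and to π for y < 0. -/
theorem tendsto_kernel_kernelBdry {h u y : ℝ} (hu : 0 < u) (hy : |y| ≠ u) :
    Tendsto (fun η : ℝ => kernel h u (η + y * Complex.I)) (𝓝[>] 0) (𝓝 (kernelBdry h u y)) := by
  have hne := sq_sub_sq_ne_zero hu hy
  have hbase : Tendsto (fun η : ℝ => (u : ℂ) / ((u : ℂ) ^ 2 + (η + y * Complex.I) ^ 2)) (𝓝[>] 0)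
      (𝓝 ((u / (u ^ 2 - y ^ 2) : ℝ) : ℂ)) := by
    have hden : (u : ℂ) ^ 2 + (((0 : ℝ) : ℂ) + y * Complex.I) ^ 2 = ((u ^ 2 - y ^ 2 : ℝ) : ℂ) := by
      push_cast; linear_combination (y : ℂ) ^ 2 * Complex.I_sq
    have hc : ContinuousAt (fun η : ℝ => (u : ℂ) / ((u : ℂ) ^ 2 + (η + y * Complex.I) ^ 2)) 0 := by
      refine ContinuousAt.div (by fun_prop) (by fun_prop) ?_
      rw [hden]; exact Complex.ofReal_ne_zero.2 hne
    have := hc.tendsto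
    rw [hden, ← Complex.ofReal_div] at this
    exact this.mono_left nhdsWithin_le_nhds
  by_cases h1 : |y| < u
  · have hpos : 0 < u ^ 2 - y ^ 2 := by nlinarith [sq_abs y, abs_nonneg y]
    have hb : 0 < u / (u ^ 2 - y ^ 2) := by positivity
    rw [kernelBdry, if_pos h1, Complex.ofReal_cpow hb.le]
    exact (continuousAt_cpow_const (Complex.ofReal_mem_slitPlane.2 hb)).tendsto.comp hbase
  · have hlt : u < |y| := lt_of_le_of_ne (not_lt.1 h1) hy.symm
    have hneg : 0 < y ^ 2 - u ^ 2 := by nlinarith [sq_abs y, abs_nonneg y]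
    have hbneg : u / (u ^ 2 - y ^ 2) < 0 := div_neg_of_pos_of_neg hu (by linarith)
    have hnorm : ‖((u / (u ^ 2 - y ^ 2) : ℝ) : ℂ)‖ = u / (y ^ 2 - u ^ 2) := by
      rw [Complex.norm_real, Real.norm_of_nonpos hbneg.le, ← div_neg, neg_sub]
    have hB : 0 < u / (y ^ 2 - u ^ 2) := by positivity
    have him : ∀ η : ℝ, 0 < η → ((u : ℂ) / ((u : ℂ) ^ 2 + (η + y * Complex.I) ^ 2)).im =
        -(2 * u * η * y / Complex.normSq ((u : ℂ) ^ 2 + (η + y * Complex.I) ^ 2)) := by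
      intro η hη
      have e : ((u : ℂ) ^ 2 + (η + y * Complex.I) ^ 2).im = 2 * η * y := by
        simp [sq, Complex.add_im, Complex.mul_im, Complex.mul_re]; ring
      rw [Complex.div_im, e]
      simp
      ring
    have hns : ∀ η : ℝ, 0 < η → 0 < Complex.normSq ((u : ℂ) ^ 2 + (η + y * Complex.I) ^ 2) :=
      fun η hη => Complex.normSq_pos.2 (Complex.slitPlane_ne_zero (add_sq_mem_slitPlane hη.ne'))
    have hexp : ∀ s : ℂ, Tendsto (fun η : ℝ => Complex.log
        ((u : ℂ) / ((u : ℂ) ^ 2 + (η + y * Complex.I) ^ 2))) (𝓝[>] 0)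
        (𝓝 (Real.log (u / (y ^ 2 - u ^ 2)) + s)) →
        Tendsto (fun η : ℝ => kernel h u (η + y * Complex.I)) (𝓝[>] 0)
          (𝓝 ((((u / (y ^ 2 - u ^ 2)) ^ h : ℝ) : ℂ) * Complex.exp (s * h))) := by
      intro s hs
      have h3 := (Complex.continuous_exp.tendsto _).comp (hs.mul_const (h : ℂ))
      have e : Complex.exp ((Real.log (u / (y ^ 2 - u ^ 2)) + s) * h) =
          (((u / (y ^ 2 - u ^ 2)) ^ h : ℝ) : ℂ) * Complex.exp (s * h) := by
        rw [add_mul, Complex.exp_add, Real.rpow_def_of_pos hB]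
        push_cast
        rfl
      rw [e] at h3
      refine h3.congr' ?_
      filter_upwards [self_mem_nhdsWithin] with η hη
      rw [kernel, Complex.cpow_def_of_ne_zero]
      · rfl
      · exact div_ne_zero (Complex.ofReal_ne_zero.2 hu.ne')
          (Complex.slitPlane_ne_zero (add_sq_mem_slitPlane (ne_of_gt hη)))
    rw [kernelBdry, if_neg h1]
    split_ifs with h2
    · have := Complex.tendsto_log_nhdsWithin_im_neg_of_re_neg_of_im_zero
        (z := ((u / (u ^ 2 - y ^ 2) : ℝ) : ℂ)) (by rw [Complex.ofReal_re]; exact hbneg) (Complex.ofReal_im _)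
      rw [hnorm, sub_eq_add_neg] at this
      have h4 := hexp (-(Real.pi * Complex.I)) (this.comp (tendsto_nhdsWithin_iff.2 ⟨hbase, by
        filter_upwards [self_mem_nhdsWithin] with η hη
        have h5 := hns η hη
        have h6 : (0 : ℝ) < η := hη
        change (_ : ℂ).im < 0
        rw [him η hη, neg_lt_zero]
        positivity⟩))
      convert h4 using 4; ring
    · have hy0 : y < 0 := by
        rcases lt_trichotomy y 0 with h | h | h
        · exact h
        · rw [h, abs_zero] at hlt; linarith
        · exact absurd h h2
      have := Complex.tendsto_log_nhdsWithin_im_nonneg_of_re_neg_of_im_zero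
        (z := ((u / (u ^ 2 - y ^ 2) : ℝ) : ℂ)) (by rw [Complex.ofReal_re]; exact hbneg) (Complex.ofReal_im _)
      rw [hnorm] at this
      have h4 := hexp (Real.pi * Complex.I) (this.comp (tendsto_nhdsWithin_iff.2 ⟨hbase, by
        filter_upwards [self_mem_nhdsWithin] with η hη
        have h5 := hns η hη
        have h6 : (0 : ℝ) < η := hη
        change 0 ≤ (_ : ℂ).im
        rw [him η hη, ← neg_div]
        refine div_nonneg ?_ h5.le
        have : 0 < 2 * u * η := by positivity
        nlinarith⟩))
      convert h4 using 4; ring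

theorem legendreQ_base_le {ξ θ : ℝ} (hξ0 : 0 < ξ) (hξ1 : ξ < 1) :
    ξ / (1 + √(1 - ξ ^ 2) * Real.cosh θ) ≤ 2 / √(1 - ξ ^ 2) * Real.exp (-|θ|) := by
  have hρ : 0 < √(1 - ξ ^ 2) := Real.sqrt_pos.2 (by nlinarith)
  have hc := Real.cosh_pos θ
  have h1 := exp_abs_le_two_mul_cosh θ
  have he := Real.exp_pos |θ|
  rw [Real.exp_neg, div_le_iff₀ (by positivity)]
  calc ξ ≤ 1 := hξ1.le
    _ ≤ (Real.exp |θ|)⁻¹ * (2 * Real.cosh θ) := by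
        rw [inv_mul_eq_div, le_div_iff₀ he, one_mul]; exact h1
    _ = 2 / √(1 - ξ ^ 2) * (Real.exp |θ|)⁻¹ * (√(1 - ξ ^ 2) * Real.cosh θ) := by field_simp
    _ ≤ _ := by
        refine mul_le_mul_of_nonneg_left (by linarith) (by positivity)

theorem legendreQ_base_pos {ξ θ : ℝ} (hξ0 : 0 < ξ) :
    0 < ξ / (1 + √(1 - ξ ^ 2) * Real.cosh θ) := by
  have := Real.cosh_pos θ
  positivity

theorem exp_neg_abs_rpow (h θ : ℝ) : (Real.exp (-|θ|)) ^ h = Real.exp (-h * |θ|) := by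
  rw [← Real.exp_mul]; congr 1; ring

theorem measurable_legendreQ_base (ξ : ℝ) :
    Measurable fun θ : ℝ => ξ / (1 + √(1 - ξ ^ 2) * Real.cosh θ) :=
  (measurable_const.div ((Real.continuous_cosh.measurable.const_mul _).const_add _))

theorem integrable_legendreQ_base {h ξ : ℝ} (hh : 0 < h) (hξ0 : 0 < ξ) (hξ1 : ξ < 1) :
    Integrable fun θ : ℝ => (ξ / (1 + √(1 - ξ ^ 2) * Real.cosh θ)) ^ h := by
  refine ((integrable_exp_neg_mul_abs hh).const_mul ((2 / √(1 - ξ ^ 2)) ^ h)).mono'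
    ((measurable_legendreQ_base ξ).pow_const _).aestronglyMeasurable (ae_of_all _ fun θ => ?_)
  have := legendreQ_base_pos (θ := θ) hξ0
  rw [Real.norm_of_nonneg (Real.rpow_nonneg this.le _), ← exp_neg_abs_rpow,
    ← Real.mul_rpow (by positivity) (by positivity)]
  exact Real.rpow_le_rpow this.le (legendreQ_base_le hξ0 hξ1) hh.le

theorem continuousOn_legendreQ {h : ℝ} (hh : 0 < h) : ContinuousOn (legendreQ h) (Ioo 0 1) := by
  intro ξ₀ hξ₀
  refine ContinuousAt.continuousWithinAt ?_
  have hm : Ioo 0 ((1 + ξ₀) / 2) ∈ 𝓝 ξ₀ := Ioo_mem_nhds hξ₀.1 (by linarith [hξ₀.2])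
  refine continuousAt_of_dominated (bound := fun θ =>
    (2 / √(1 - ((1 + ξ₀) / 2) ^ 2)) ^ h * Real.exp (-h * |θ|)) ?_ ?_
    ((integrable_exp_neg_mul_abs hh).const_mul _) ?_
  · refine Eventually.of_forall fun ξ => ?_
    exact ((Complex.measurable_ofReal.comp (measurable_legendreQ_base ξ)).pow_const _).aestronglyMeasurable
  · filter_upwards [hm] with ξ hξ
    refine ae_of_all _ fun θ => ?_
    have hξ1 : ξ < 1 := by linarith [hξ.2, hξ₀.2]
    have hb := legendreQ_base_pos (θ := θ) hξ.1
    have hρ1 : 0 < √(1 - ((1 + ξ₀) / 2) ^ 2) := Real.sqrt_pos.2 (by nlinarith [hξ₀.1, hξ₀.2])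
    rw [Complex.norm_cpow_real, Complex.norm_of_nonneg hb.le, ← exp_neg_abs_rpow,
      ← Real.mul_rpow (by positivity) (by positivity)]
    refine Real.rpow_le_rpow hb.le ((legendreQ_base_le hξ.1 hξ1).trans ?_) hh.le
    gcongr
    · exact hξ.1.le
    · exact hξ.2.le
  · refine ae_of_all _ fun θ => ?_
    have hb := legendreQ_base_pos (θ := θ) hξ₀.1
    refine (continuousAt_cpow_const (Complex.ofReal_mem_slitPlane.2 hb)).comp
      (f := fun ξ : ℝ => ((ξ / (1 + √(1 - ξ ^ 2) * Real.cosh θ) : ℝ) : ℂ)) ?_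
    refine Complex.continuous_ofReal.continuousAt.comp ?_
    refine ContinuousAt.div continuousAt_id (by fun_prop) ?_
    have := Real.cosh_pos θ
    positivity

theorem integrableOn_smearWeight {h u' : ℝ} (hh : 0 < h) (hu' : 0 < u') :
    IntegrableOn (fun t => (u' / (u' ^ 2 - t ^ 2)) ^ (1 - h)) (Ioo (-u') u') := by
  have h1 : IntegrableOn (fun t => u' ^ (1 - h) * (u' ^ 2 - t ^ 2) ^ (h - 1)) (Ioo (-u') u') :=
    (integrableOn_sq_sub_sq_rpow (p := h - 1) (by linarith) hu').const_mul _
  refine h1.congr_fun (fun t ht => ?_) measurableSet_Ioo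
  have : 0 < u' ^ 2 - t ^ 2 := by nlinarith [ht.1, ht.2]
  dsimp only
  rw [Real.div_rpow hu'.le this.le, ← neg_sub 1 h, Real.rpow_neg this.le, div_eq_mul_inv]

section Timelike

variable {h u u' : ℝ}

/-- With t = u tanh(s/2) the kernel is a power of cosh² alone, and the weight carries the Legendre
denominator. Hence a Legendre integrand of weight 1 - h appears. -/
theorem timelike_pullback_eq (hu : 0 < u) (huu' : u < u') (s : ℝ) :
    ((u - -u) * 1 * Real.exp s / (1 + Real.exp s) ^ 2) •
      ((u' / (u' ^ 2 - expMoebius (-u) u 1 s ^ 2)) ^ (1 - h) *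
        (u / (u ^ 2 - expMoebius (-u) u 1 s ^ 2)) ^ h) =
    1 / 2 * ((2 * u * u' / (u ^ 2 + u' ^ 2)) /
      (1 + √(1 - (2 * u * u' / (u ^ 2 + u' ^ 2)) ^ 2) * Real.cosh s)) ^ (1 - h) := by
  have hu' : 0 < u' := hu.trans huu'
  have hB : 0 < u ^ 2 + u' ^ 2 := by positivity
  have hdiff : 0 < u' ^ 2 - u ^ 2 := by nlinarith
  have hρ : √(1 - (2 * u * u' / (u ^ 2 + u' ^ 2)) ^ 2) = (u' ^ 2 - u ^ 2) / (u ^ 2 + u' ^ 2) := by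
    rw [Real.sqrt_eq_iff_mul_self_eq_of_pos (by positivity)]
    field_simp; ring
  rw [hρ]
  have he := Real.exp_pos s
  have hC : 0 < Real.cosh s := Real.cosh_pos s
  set C := (1 + Real.cosh s) / 2 with hCdef
  have hCpos : 0 < C := by positivity
  have hce : C = (1 + Real.exp s) ^ 2 / (4 * Real.exp s) := by
    rw [hCdef, Real.cosh_eq, Real.exp_neg]; field_simp; ring
  set t := expMoebius (-u) u 1 s with ht
  have ht2C : t ^ 2 = u ^ 2 * (Real.cosh s - 1) / 2 / C := by
    rw [eq_div_iff hCpos.ne', hce, ht, expMoebius, Real.cosh_eq, Real.exp_neg]; field_simp; ring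
  have hjac : (u - -u) * 1 * Real.exp s / (1 + Real.exp s) ^ 2 = u / (2 * C) := by
    rw [hce]; field_simp; ring
  have e1 : u ^ 2 - t ^ 2 = u ^ 2 / C := by rw [ht2C, hCdef]; field_simp; ring
  set W := 1 + (u' ^ 2 - u ^ 2) / (u ^ 2 + u' ^ 2) * Real.cosh s with hW
  have hWpos : 0 < W := by positivity
  have e2 : u' ^ 2 - t ^ 2 = (u ^ 2 + u' ^ 2) / 2 * W / C := by
    rw [ht2C, hW, hCdef]; field_simp; ring
  rw [hjac, e1, e2]
  have e3 : u' / ((u ^ 2 + u' ^ 2) / 2 * W / C) = C / u * (2 * u * u' / (u ^ 2 + u' ^ 2) / W) := by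
    field_simp
  have e4 : u / (u ^ 2 / C) = C / u := by field_simp
  rw [e3, e4, Real.mul_rpow (by positivity) (by positivity), Real.rpow_sub (by positivity),
    Real.rpow_one, smul_eq_mul]
  have := Real.rpow_pos_of_pos (div_pos hCpos hu) h
  field_simp

theorem xi_parameter_mem (hu : 0 < u) (huu' : u < u') :
    2 * u * u' / (u ^ 2 + u' ^ 2) ∈ Ioo (0 : ℝ) 1 := by
  have hu' : 0 < u' := hu.trans huu'
  refine ⟨by positivity, ?_⟩
  rw [div_lt_one (by positivity)]
  nlinarith [sq_pos_of_pos (sub_pos.2 huu')]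

theorem integrableOn_timelike (hh1 : h < 1) (hu : 0 < u) (huu' : u < u') :
    IntegrableOn (fun t => (u' / (u' ^ 2 - t ^ 2)) ^ (1 - h) * (u / (u ^ 2 - t ^ 2)) ^ h)
      (Ioo (-u) u) := by
  rw [integrableOn_Ioo_iff_expMoebius one_pos (neg_lt_self hu)]
  simp_rw [timelike_pullback_eq hu huu']
  obtain ⟨h1, h2⟩ := xi_parameter_mem hu huu'
  exact (integrable_legendreQ_base (by linarith) h1 h2).const_mul _

theorem integral_timelike (hu : 0 < u) (huu' : u < u') :
    ((∫ t in Ioo (-u) u, (u' / (u' ^ 2 - t ^ 2)) ^ (1 - h) * (u / (u ^ 2 - t ^ 2)) ^ h : ℝ) : ℂ) =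
      1 / 2 * legendreQ ((1 - h : ℝ) : ℂ) (2 * u * u' / (u ^ 2 + u' ^ 2)) := by
  rw [setIntegral_Ioo_eq_expMoebius one_pos (neg_lt_self hu)]
  simp_rw [timelike_pullback_eq hu huu']
  rw [integral_const_mul, legendreQ_ofReal (xi_parameter_mem hu huu').1]
  push_cast
  rfl

theorem Ioo_neg_eq_union (hu : 0 < u) (huu' : u < u') :
    Ioo (-u') u' = (Ioc (-u') (-u) ∪ Ioc (-u) u) ∪ Ioo u u' := by
  rw [Ioc_union_Ioc_eq_Ioc (by linarith) (by linarith), Ioc_union_Ioo_eq_Ioo (by linarith) huu']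

/-- The dominating function for D → 0. For u < u' the singularities at |t| = u are integrable
because h < 1; for u > u' the kernel factor is bounded. -/
theorem integrableOn_smearWeight_mul_bound (hh0 : 0 < h) (hh1 : h < 1) (hu : 0 < u) (hu' : 0 < u')
    (hne : u ≠ u') :
    IntegrableOn (fun t => (u' / (u' ^ 2 - t ^ 2)) ^ (1 - h) * (u / |u ^ 2 - t ^ 2|) ^ h)
      (Ioo (-u') u') := by
  rcases lt_or_gt_of_ne hne with hlt | hlt
  · have h3 : IntegrableOn (fun t => (u' / (u' ^ 2 - t ^ 2)) ^ (1 - h) * (u / |u ^ 2 - t ^ 2|) ^ h)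
        (Ioo u u') := by
      have := integrableOn_spacelike (v := 0) hh0 hh1 hu (u' := u') (by simpa)
      simp only [zero_add, sub_zero] at this
      refine this.congr_fun (fun t ht => ?_) measurableSet_Ioo
      have : 0 < t ^ 2 - u ^ 2 := by nlinarith [ht.1]
      dsimp only
      rw [abs_sub_comm, abs_of_pos this]
    have h1 : IntegrableOn (fun t => (u' / (u' ^ 2 - t ^ 2)) ^ (1 - h) * (u / |u ^ 2 - t ^ 2|) ^ h)
        (Ioo (-u') (-u)) := by
      have := h3.comp_neg
      simpa using this
    have h2 : IntegrableOn (fun t => (u' / (u' ^ 2 - t ^ 2)) ^ (1 - h) * (u / |u ^ 2 - t ^ 2|) ^ h)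
        (Ioo (-u) u) := by
      refine (integrableOn_timelike hh1 hu hlt).congr_fun (fun t ht => ?_) measurableSet_Ioo
      have : 0 < u ^ 2 - t ^ 2 := by nlinarith [ht.1, ht.2]
      dsimp only
      rw [abs_of_pos this]
    rw [Ioo_neg_eq_union hu hlt]
    exact (((integrableOn_Ioc_iff_integrableOn_Ioo).2 h1).union
      ((integrableOn_Ioc_iff_integrableOn_Ioo).2 h2)).union h3
  · refine (Integrable.mul_bdd (c := (u / (u ^ 2 - u' ^ 2)) ^ h) (integrableOn_smearWeight hh0 hu')
      (Measurable.aestronglyMeasurable (Measurable.pow_const (by fun_prop) _)) ?_)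
    filter_upwards [ae_restrict_mem measurableSet_Ioo] with t ht
    have h1 : 0 < u ^ 2 - u' ^ 2 := by nlinarith
    have h2 : u ^ 2 - u' ^ 2 ≤ u ^ 2 - t ^ 2 := by nlinarith [ht.1, ht.2]
    rw [abs_of_pos (h1.trans_le h2), Real.norm_of_nonneg (Real.rpow_nonneg
      (div_nonneg hu.le (by linarith)) _)]
    exact Real.rpow_le_rpow (div_nonneg hu.le (by linarith))
      (div_le_div_of_nonneg_left hu.le h1 h2) hh0.le

end Timelike

theorem smearWeight_ofReal {h u' t : ℝ} (ht : t ∈ Ioo (-u') u') :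
    smearWeight h u' t = (((u' / (u' ^ 2 - t ^ 2)) ^ (1 - h) : ℝ) : ℂ) := by
  have h0 : 0 < u' := by linarith [ht.1, ht.2]
  have h1 : 0 < u' ^ 2 - t ^ 2 := by nlinarith [ht.1, ht.2]
  rw [smearWeight, Complex.ofReal_cpow (by positivity)]
  push_cast
  rfl

section Connection

variable {h u u' : ℝ}

theorem integrableOn_smearWeight_mul_kernelBdry (hh0 : 0 < h) (hh1 : h < 1) (hu : 0 < u)
    (hu' : 0 < u') (hne : u ≠ u') :
    IntegrableOn (fun t => smearWeight h u' t * kernelBdry h u (-t)) (Ioo (-u') u') := by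
  refine (integrableOn_smearWeight_mul_bound hh0 hh1 hu hu' hne).mono' ?_ ?_
  · refine Measurable.aestronglyMeasurable (Measurable.mul ?_ ?_)
    · exact (Complex.measurable_ofReal.comp (by fun_prop)).pow_const _
    · refine Measurable.ite (measurableSet_lt (by fun_prop) (by fun_prop)) ?_ ?_
      · exact Complex.measurable_ofReal.comp (Measurable.pow_const (by fun_prop) _)
      · refine (Complex.measurable_ofReal.comp (Measurable.pow_const (by fun_prop) _)).mul ?_
        exact Complex.measurable_exp.comp (Measurable.ite (measurableSet_lt (by fun_prop)
          (by fun_prop)) (by fun_prop) (by fun_prop))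
  · filter_upwards [ae_restrict_mem measurableSet_Ioo,
      (compl_mem_ae_iff.2 ((Set.toFinite {u, -u}).measure_zero (volume.restrict (Ioo (-u') u'))))]
      with t ht ht2
    have hy : |(-t)| ≠ u := by
      rw [abs_neg]
      rintro rfl
      rcases abs_choice t with h | h <;> simp [h] at ht2
    rw [norm_mul, smearWeight_ofReal ht, norm_kernelBdry hu hy, neg_sq, Complex.norm_of_nonneg]
    have h0 : 0 < u' ^ 2 - t ^ 2 := by nlinarith [ht.1, ht.2]
    positivity

/-- Let D → 0+ in `integral_smearWeight_mul_kernel`: dominated convergence on one side, continuity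
of `legendreQ` on the other. -/
theorem integral_smearWeight_mul_kernelBdry (hh0 : 0 < h) (hh1 : h < 1) (hu : 0 < u)
    (hu' : 0 < u') (hne : u ≠ u') :
    ∫ t in Ioo (-u') u', smearWeight h u' t * kernelBdry h u (-t) =
      1 / 2 * legendreQ h (2 * u * u' / (u ^ 2 + u' ^ 2)) := by
  have hsq : 0 < (u - u') ^ 2 := by
    have := sub_ne_zero.2 hne
    positivity
  have hξ : ∀ D : ℝ, 2 * u * u' / (u ^ 2 + u' ^ 2 + D ^ 2) ∈ Ioo (0 : ℝ) 1 := fun D =>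
    ⟨by positivity, by rw [div_lt_one (by positivity)]; nlinarith [sq_nonneg D]⟩
  have hQ : Tendsto (fun D : ℝ => 1 / 2 * legendreQ h (2 * u * u' / (u ^ 2 + u' ^ 2 + D ^ 2)))
      (𝓝[>] 0) (𝓝 (1 / 2 * legendreQ h (2 * u * u' / (u ^ 2 + u' ^ 2)))) := by
    have h1 : ContinuousAt (fun D : ℝ => 2 * u * u' / (u ^ 2 + u' ^ 2 + D ^ 2)) 0 :=
      ContinuousAt.div (by fun_prop) (by fun_prop) (by positivity)
    have h2 : ContinuousAt (legendreQ h) (2 * u * u' / (u ^ 2 + u' ^ 2 + 0 ^ 2)) :=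
      (continuousOn_legendreQ hh0).continuousAt (isOpen_Ioo.mem_nhds (hξ 0))
    have h3 := (h2.comp (f := fun D : ℝ => 2 * u * u' / (u ^ 2 + u' ^ 2 + D ^ 2)) h1).tendsto
    simp only [Function.comp, ne_eq, OfNat.ofNat_ne_zero, not_false_eq_true, zero_pow, add_zero]
      at h3
    exact (h3.mono_left nhdsWithin_le_nhds).const_mul _
  refine tendsto_nhds_unique (Tendsto.congr' (f₁ := fun D : ℝ => ∫ t in Ioo (-u') u',
    smearWeight h u' t * kernel h u (D + (-t : ℝ) * Complex.I)) ?_ ?_) hQ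
  · filter_upwards [self_mem_nhdsWithin] with D hD
    rw [← integral_smearWeight_mul_kernel hh0 hu hu' (ne_of_gt hD)]
    simp only [Complex.ofReal_neg, neg_mul, sub_eq_add_neg]
  · refine tendsto_integral_filter_of_dominated_convergence _ ?_ ?_
      (integrableOn_smearWeight_mul_bound hh0 hh1 hu hu' hne) ?_
    · refine Eventually.of_forall fun D => Measurable.aestronglyMeasurable ?_
      refine Measurable.mul ((Complex.measurable_ofReal.comp (by fun_prop)).pow_const _) ?_
      exact Measurable.pow_const (by fun_prop) _
    · filter_upwards [self_mem_nhdsWithin] with D hD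
      filter_upwards [ae_restrict_mem measurableSet_Ioo,
        (compl_mem_ae_iff.2 ((Set.toFinite {u, -u}).measure_zero (volume.restrict (Ioo (-u') u'))))]
        with t ht ht2
      have hy : |(-t)| ≠ u := by
        rw [abs_neg]
        rintro rfl
        rcases abs_choice t with h | h <;> simp [h] at ht2
      have h0 : 0 < u' ^ 2 - t ^ 2 := by nlinarith [ht.1, ht.2]
      rw [norm_mul, smearWeight_ofReal ht, Complex.norm_of_nonneg (by positivity)]
      refine mul_le_mul_of_nonneg_left ?_ (by positivity)
      have := norm_kernel_le (x := D) hh0.le hu hy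
      rwa [neg_sq] at this
    · filter_upwards [(compl_mem_ae_iff.2 ((Set.toFinite {u, -u}).measure_zero
        (volume.restrict (Ioo (-u') u'))))] with t ht2
      have hy : |(-t)| ≠ u := by
        rw [abs_neg]
        rintro rfl
        rcases abs_choice t with h | h <;> simp [h] at ht2
      exact (tendsto_kernel_kernelBdry hu hy).const_mul _

/-- Split the integral of the boundary values at t = ±u. The middle piece is the Legendre integral
of weight 1 - h. The outer pieces are one and the same Euler integral with phases e^(±iπh), which
add up to 2 cos(πh). -/
theorem legendreQ_connection_aux (hh0 : 0 < h) (hh1 : h < 1) (hu : 0 < u) (huu' : u < u') :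
    legendreQ h (2 * u * u' / (u ^ 2 + u' ^ 2)) =
      legendreQ ((1 - h : ℝ) : ℂ) (2 * u * u' / (u ^ 2 + u' ^ 2)) +
        2 * Real.pi * (Complex.cos (Real.pi * h) / Complex.sin (Real.pi * h)) *
          legendreP h (4 * u * u' / ((u + u') ^ 2)) := by
  have hu' := hu.trans huu'
  have hint := integrableOn_smearWeight_mul_kernelBdry hh0 hh1 hu hu' huu'.ne
  have key := integral_smearWeight_mul_kernelBdry hh0 hh1 hu hu' huu'.ne
  have hsp := integral_spacelike (v := 0) hh0 hh1 hu (u' := u') (by simpa)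
  simp only [zero_add, sub_zero, ne_eq, OfNat.ofNat_ne_zero, not_false_eq_true, zero_pow] at hsp
  rw [Complex.ofReal_sin, Complex.ofReal_mul] at hsp
  rw [Ioo_neg_eq_union hu huu'] at hint key
  have i1 : IntegrableOn (fun t => smearWeight h u' t * kernelBdry h u (-t)) (Ioc (-u') (-u)) :=
    hint.mono_set (subset_union_left.trans subset_union_left)
  have i2 : IntegrableOn (fun t => smearWeight h u' t * kernelBdry h u (-t)) (Ioc (-u) u) :=
    hint.mono_set (subset_union_right.trans subset_union_left)
  have i3 : IntegrableOn (fun t => smearWeight h u' t * kernelBdry h u (-t)) (Ioo u u') :=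
    hint.mono_set subset_union_right
  have e3 : ∫ t in Ioo u u', smearWeight h u' t * kernelBdry h u (-t) =
      Complex.exp (Real.pi * h * Complex.I) *
        (Real.pi / (2 * Complex.sin (Real.pi * h)) * legendreP h (4 * u * u' / ((u + u') ^ 2))) := by
    rw [← hsp, ← integral_complex_ofReal, ← integral_const_mul]
    refine setIntegral_congr_fun measurableSet_Ioo fun t ht => ?_
    have ht0 : 0 < t := hu.trans ht.1
    rw [smearWeight_ofReal ⟨by linarith [ht.1], ht.2⟩, kernelBdry, abs_neg, abs_of_pos ht0,
      if_neg (not_lt.2 ht.1.le), if_neg (by linarith), neg_sq]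
    push_cast
    ring
  have e1 : ∫ t in Ioc (-u') (-u), smearWeight h u' t * kernelBdry h u (-t) =
      Complex.exp (-(Real.pi * h * Complex.I)) *
        (Real.pi / (2 * Complex.sin (Real.pi * h)) * legendreP h (4 * u * u' / ((u + u') ^ 2))) := by
    rw [← hsp, ← integral_complex_ofReal, ← integral_const_mul,
      ← intervalIntegral.integral_of_le (by linarith), ← integral_Ioc_eq_integral_Ioo,
      ← intervalIntegral.integral_of_le huu'.le,
      ← intervalIntegral.integral_comp_neg, intervalIntegral.integral_of_le huu'.le,
      intervalIntegral.integral_of_le huu'.le, integral_Ioc_eq_integral_Ioo,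
      integral_Ioc_eq_integral_Ioo]
    refine setIntegral_congr_fun measurableSet_Ioo fun t ht => ?_
    have ht0 : 0 < t := hu.trans ht.1
    rw [smearWeight_ofReal ⟨by linarith [ht.2], by linarith [ht.1]⟩, kernelBdry, neg_neg,
      abs_of_pos ht0, if_neg (not_lt.2 ht.1.le), if_pos ht0, neg_sq]
    push_cast
    ring
  have e2 : ∫ t in Ioc (-u) u, smearWeight h u' t * kernelBdry h u (-t) =
      1 / 2 * legendreQ ((1 - h : ℝ) : ℂ) (2 * u * u' / (u ^ 2 + u' ^ 2)) := by
    rw [← integral_timelike hu huu', ← integral_complex_ofReal, integral_Ioc_eq_integral_Ioo]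
    refine setIntegral_congr_fun measurableSet_Ioo fun t ht => ?_
    rw [smearWeight_ofReal ⟨by linarith [ht.1], by linarith [ht.2]⟩, kernelBdry,
      if_pos (by rw [abs_neg, abs_lt]; exact ⟨ht.1, ht.2⟩), neg_sq]
    push_cast
    ring
  rw [setIntegral_union ?_ measurableSet_Ioo (i1.union i2) i3, setIntegral_union ?_ measurableSet_Ioc
    i1 i2, e1, e2, e3] at key
  · have hc : Complex.exp (Real.pi * h * Complex.I) + Complex.exp (-(Real.pi * h * Complex.I)) =
        2 * Complex.cos (Real.pi * h) := by
      rw [Complex.cos, neg_mul]; ring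
    linear_combination (-2) * key + Real.pi / Complex.sin (Real.pi * h) *
      legendreP h (4 * u * u' / ((u + u') ^ 2)) * hc
  · rw [Set.disjoint_left]; rintro t ⟨_, ht⟩ ⟨ht', _⟩; linarith
  · rw [Set.disjoint_left]; rintro t (⟨_, ht⟩ | ⟨_, ht⟩) ⟨ht', _⟩ <;> linarith

theorem legendreQ_connection {ξ : ℝ} (hh0 : 0 < h) (hh1 : h < 1) (hξ0 : 0 < ξ) (hξ1 : ξ < 1) :
    legendreQ h ξ = legendreQ ((1 - h : ℝ) : ℂ) ξ +
        2 * Real.pi * (Complex.cos (Real.pi * h) / Complex.sin (Real.pi * h)) *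
          legendreP h (2 * ξ / (1 + ξ)) := by
  have hρ : 0 < √(1 - ξ ^ 2) := Real.sqrt_pos.2 (by nlinarith)
  have hρ2 : √(1 - ξ ^ 2) ^ 2 = 1 - ξ ^ 2 := Real.sq_sqrt (by nlinarith)
  set ρ := √(1 - ξ ^ 2)
  -- The choice u' = 1 and u = ξ/(1+ρ), a root of 2u/(1+u²) = ξ in (0, 1), realises a given ξ.
  have h0 : 0 < ξ / (1 + ρ) := by positivity
  have h1 : ξ / (1 + ρ) < 1 := by rw [div_lt_one (by positivity)]; linarith
  have key := legendreQ_connection_aux hh0 hh1 h0 h1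
  have e1 : 2 * (ξ / (1 + ρ)) * 1 / ((ξ / (1 + ρ)) ^ 2 + 1 ^ 2) = ξ := by
    have : ξ ^ 2 + (1 + ρ) ^ 2 = 2 * (1 + ρ) := by linear_combination hρ2
    have h2 : (ξ / (1 + ρ)) ^ 2 + 1 ^ 2 = 2 / (1 + ρ) := by
      rw [div_pow, one_pow, div_add_one (by positivity), this]; field_simp
    rw [h2]; field_simp
  have e2 : 4 * (ξ / (1 + ρ)) * 1 / ((ξ / (1 + ρ) + 1) ^ 2) = 2 * ξ / (1 + ξ) := by
    have h3 : (ξ / (1 + ρ) + 1) ^ 2 = 2 * (1 + ξ) / (1 + ρ) := by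
      rw [div_add_one (by positivity), div_pow, div_eq_div_iff (by positivity) (by positivity)]
      linear_combination (1 + ρ) * hρ2
    rw [h3]; field_simp; ring
  rwa [e1, e2] at key

/-- By the reflection formula the two propagators enter with opposite coefficients of `legendreQ` at
weight 1 - h, which cancel. The coefficient of `legendreP` left by the connection formula is 1
inside the bracket. At h = 1/2 the Gamma factors have poles. -/
theorem GtildeGeneric_eq_of_lt_one {ξ : ℝ} {z z' : ℂ} (hh0 : 0 < h) (hh1 : h < 1) (hh : h ≠ 1 / 2)
    (hξ0 : 0 < ξ) (hξ1 : ξ < 1) (hξ : xi u z u' z' = ξ) :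
    GtildeGeneric h u z u' z' = smearConst h * legendreP h (2 * ξ / (1 + ξ)) := by
  have hsin : Complex.sin (Real.pi * h) ≠ 0 := by
    have : 0 < Real.sin (Real.pi * h) := Real.sin_pos_of_pos_of_lt_pi (by positivity)
      (by nlinarith [Real.pi_pos])
    rw [← Complex.ofReal_mul, ← Complex.ofReal_sin]
    exact Complex.ofReal_ne_zero.2 this.ne'
  have hcos : Complex.cos (Real.pi * h) ≠ 0 := by
    rw [← Complex.ofReal_mul, ← Complex.ofReal_cos]
    refine Complex.ofReal_ne_zero.2 fun h0 => ?_
    rcases lt_or_gt_of_ne hh with hlt | hlt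
    · exact absurd h0 (Real.cos_pos_of_mem_Ioo ⟨by nlinarith [Real.pi_pos],
        by nlinarith [Real.pi_pos]⟩).ne'
    · exact absurd h0 (Real.cos_neg_of_pi_div_two_lt_of_lt (by nlinarith [Real.pi_pos])
        (by nlinarith [Real.pi_pos])).ne
  have hpi : (Real.pi : ℂ) ≠ 0 := Complex.ofReal_ne_zero.2 Real.pi_ne_zero
  have hg1 : Complex.Gamma h ≠ 0 := Complex.Gamma_ne_zero_of_re_pos (by simpa)
  have hg2 : Complex.Gamma (1 - h) ≠ 0 := Complex.Gamma_ne_zero_of_re_pos (by simpa)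
  have h4 : (4 : ℂ) ^ (h : ℂ) ≠ 0 := by simp [Complex.cpow_eq_zero_iff]
  have h4' : (4 : ℂ) ^ (1 - h : ℂ) ≠ 0 := by simp [Complex.cpow_eq_zero_iff]
  have r0 := Complex.Gamma_mul_Gamma_one_sub (h : ℂ)
  have r1 := Complex.Gamma_mul_Gamma_one_sub (2 * h : ℂ)
  have r2 := Complex.Gamma_mul_Gamma_one_sub (2 * h - 1 : ℂ)
  have hs2 : Complex.sin (Real.pi * (2 * h)) =
      2 * Complex.sin (Real.pi * h) * Complex.cos (Real.pi * h) := by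
    rw [← Complex.sin_two_mul]; ring_nf
  have hs3 : Complex.sin (Real.pi * (2 * h - 1)) =
      -(2 * Complex.sin (Real.pi * h) * Complex.cos (Real.pi * h)) := by
    rw [← hs2, mul_sub, mul_one, Complex.sin_sub_pi]
  rw [hs2] at r1
  rw [hs3] at r2
  rw [GtildeGeneric, G_eq_legendreQ hh0 hξ0 hξ1 hξ, G_eq_legendreQ (sub_pos.2 hh1) hξ0 hξ1 hξ,
    legendreQ_connection hh0 hh1 hξ0 hξ1]
  congr 1
  simp only [smearConst]
  push_cast
  rw [show (1 - (2 * h - 1) : ℂ) = 2 * (1 - h) by ring] at r2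
  set a := Complex.Gamma (2 * h)
  set b := Complex.Gamma (1 - 2 * h)
  set c := Complex.Gamma (2 * h - 1)
  set d := Complex.Gamma (2 * (1 - h))
  set A := Complex.Gamma h
  set B := Complex.Gamma (1 - h)
  set S := Complex.sin (Real.pi * h)
  set C := Complex.cos (Real.pi * h)
  set q := legendreQ (1 - h) ξ
  set P := legendreP h (2 * ξ / (1 + ξ))
  have hb : a * b = Real.pi / (2 * S * C) := r1
  have hd : c * d = -(Real.pi / (2 * S * C)) := by rw [r2, div_neg]
  have hAB : (A * B) ^ 2 = (Real.pi / S) ^ 2 := by rw [r0]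
  have hI := Complex.I_sq
  have e1 : (4 : ℂ) ^ (h : ℂ) * (b / B ^ 2) * (Complex.I * (-2 * Complex.I / (4 : ℂ) ^ (h : ℂ) *
      (a / A ^ 2)) / 2 * (q + 2 * Real.pi * (C / S) * P)) =
      (a * b) / (A * B) ^ 2 * (q + 2 * Real.pi * (C / S) * P) := by
    field_simp
    rw [hI]; ring
  have e2 : (4 : ℂ) ^ (1 - h : ℂ) * (c / A ^ 2) * (Complex.I * (-2 * Complex.I / (4 : ℂ) ^ (1 - h : ℂ) *
      (d / B ^ 2)) / 2 * q) = (c * d) / (A * B) ^ 2 * q := by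
    field_simp
    rw [hI]; ring
  rw [e1, e2, hAB, hb, hd]
  field_simp
  ring

end Connection

/-! ### Continuation of the G̃ formula in the weight. -/

/-- A ratio bound uniform on W gives a geometric majorant for the tail, so the tail is a uniform
limit of holomorphic functions; finitely many terms are added back. -/
theorem differentiableOn_tsum_of_ratio {t : ℕ → ℂ → ℂ} {W : Set ℂ} (hW : IsOpen W)
    (ht : ∀ n, DifferentiableOn ℂ (t n) W) {r M : ℝ} (hr0 : 0 ≤ r) (hr1 : r < 1) {N : ℕ}
    (hstep : ∀ s ∈ W, ∀ n, N ≤ n → ‖t (n + 1) s‖ ≤ r * ‖t n s‖) (hM : ∀ s ∈ W, ‖t N s‖ ≤ M) :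
    DifferentiableOn ℂ (fun s => ∑' n, t n s) W := by
  have hbound : ∀ m, ∀ s ∈ W, ‖t (m + N) s‖ ≤ M * r ^ m := by
    intro m s hs
    induction m with
    | zero => simpa using hM s hs
    | succ m ih =>
      rw [add_right_comm]
      refine (hstep s hs _ (Nat.le_add_left _ _)).trans ?_
      calc r * ‖t (m + N) s‖ ≤ r * (M * r ^ m) := by gcongr
        _ = _ := by ring
  have hgeo : Summable fun m : ℕ => M * r ^ m :=
    (summable_geometric_of_lt_one hr0 hr1).mul_left _
  have htail : DifferentiableOn ℂ (fun s => ∑' m, t (m + N) s) W :=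
    Complex.differentiableOn_tsum_of_summable_norm hgeo (fun m => ht _) hW hbound
  have hfin : DifferentiableOn ℂ (fun s => ∑ i ∈ Finset.range N, t i s) W :=
    DifferentiableOn.fun_sum fun i _ => ht i
  refine (hfin.add htail).congr fun s hs => ?_
  have hsum : Summable fun m => t (m + N) s :=
    Summable.of_norm_bounded hgeo fun m => hbound m s hs
  exact (((summable_nat_add_iff N).1 hsum).sum_add_tsum_nat_add N).symm

theorem ratio_numerator_le {A B C x r n : ℝ} (hA : 0 < A) (hB : 0 < B) (hC : 0 < C) (hx0 : 0 ≤ x)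
    (hxr : x < r) (hr1 : r < 1) (hn : 1 ≤ n) (h : A + B + C + A * B + C ≤ n * (r - x)) :
    (A + n) * (B + n) * x ≤ r * ((n - C) * (n + 1)) := by
  have k2 : (A + B + C + A * B + C) * n ≤ n * (r - x) * n :=
    mul_le_mul_of_nonneg_right h (by linarith)
  have k3 : (A * B + C) ≤ (A * B + C) * n := le_mul_of_one_le_right (by positivity) hn
  have k4 : ((A + B) * n + A * B) * x ≤ (A + B) * n + A * B :=
    mul_le_of_le_one_right (by positivity) (by linarith)
  have k5 : r * (C * n + C) ≤ C * n + C := mul_le_of_le_one_left (by positivity) hr1.le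
  have k6 : 0 ≤ r * n := mul_nonneg (by linarith) (by linarith)
  linarith

/-- Near s₀ the parameters are bounded, so the term ratio (a+n)(b+n)x / ((c+n)(n+1)) has modulus at
most some r < 1 for all n ≥ N, uniformly in s. -/
theorem differentiableOn_ordinaryHypergeometric {a b c : ℂ → ℂ} {U : Set ℂ} (hU : IsOpen U)
    (ha : DifferentiableOn ℂ a U) (hb : DifferentiableOn ℂ b U) (hc : DifferentiableOn ℂ c U)
    (hne : ∀ s ∈ U, ∀ k : ℕ, c s ≠ -k) {x : ℂ} (hx : ‖x‖ < 1) :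
    DifferentiableOn ℂ (fun s => ordinaryHypergeometric (a s) (b s) (c s) x) U := by
  intro s₀ hs₀
  refine DifferentiableAt.differentiableWithinAt ?_
  have hUs := hU.mem_nhds hs₀
  obtain ⟨t, ht⟩ : ∃ t : ℕ → ℂ → ℂ, t = fun n s => ((n.factorial : ℂ)⁻¹ *
    (ascPochhammer ℂ n).eval (a s) * (ascPochhammer ℂ n).eval (b s) *
    ((ascPochhammer ℂ n).eval (c s))⁻¹) • x ^ n := ⟨_, rfl⟩
  have hpne : ∀ n, ∀ s ∈ U, (ascPochhammer ℂ n).eval (c s) ≠ 0 := by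
    intro n s hs h0
    obtain ⟨k, -, hk⟩ := (ascPochhammer_eval_eq_zero_iff n _).1 h0
    exact hne s hs k (by rw [hk, neg_neg])
  have htd : ∀ n, DifferentiableOn ℂ (t n) U := by
    intro n
    have hp : ∀ {g : ℂ → ℂ}, DifferentiableOn ℂ g U →
        DifferentiableOn ℂ (fun s => (ascPochhammer ℂ n).eval (g s)) U := fun hg =>
      (ascPochhammer ℂ n).differentiable.comp_differentiableOn hg
    rw [ht]
    exact ((((hp ha).const_mul _).mul (hp hb)).mul ((hp hc).inv (hpne n))).smul_const _
  have hrec : ∀ n, ∀ s ∈ U, t (n + 1) s * ((c s + n) * (n + 1)) =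
      t n s * ((a s + n) * (b s + n) * x) := by
    intro n s hs
    have h1 := hpne n s hs
    have h2 := hpne (n + 1) s hs
    rw [ascPochhammer_succ_eval] at h2
    have h3 : (c s + n) ≠ 0 := right_ne_zero_of_mul h2
    simp only [ht, ascPochhammer_succ_eval, Nat.factorial_succ, smul_eq_mul]
    push_cast
    have h4 : (n.factorial : ℂ) ≠ 0 := Nat.cast_ne_zero.2 n.factorial_ne_zero
    have h5 : (n + 1 : ℂ) ≠ 0 := Nat.cast_add_one_ne_zero n
    field_simp
    ring
  set A := ‖a s₀‖ + 1
  set B := ‖b s₀‖ + 1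
  set C := ‖c s₀‖ + 1
  have hA : 0 < A := by positivity
  have hB : 0 < B := by positivity
  have hC : 0 < C := by positivity
  have hnear : ∀ {g : ℂ → ℂ}, DifferentiableOn ℂ g U → ∀ᶠ s in 𝓝 s₀, ‖g s‖ ≤ ‖g s₀‖ + 1 := by
    intro g hg
    have := ((hg.continuousOn.continuousAt hUs).norm).tendsto.eventually_lt_const
      (lt_add_one ‖g s₀‖)
    exact this.mono fun s hs => hs.le
  obtain ⟨r, hxr, hr1⟩ := exists_between hx
  have hr0 : 0 < r := (norm_nonneg x).trans_lt hxr
  obtain ⟨N, hN⟩ := exists_nat_gt (max (C + 1) ((A + B + C + A * B + C) / (r - ‖x‖)))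
  have hNC : C + 1 < N := (le_max_left _ _).trans_lt hN
  have hND : A + B + C + A * B + C < N * (r - ‖x‖) := by
    rw [← div_lt_iff₀ (by linarith)]; exact (le_max_right _ _).trans_lt hN
  obtain ⟨W, hW, hWo, hsW⟩ := eventually_nhds_iff.1 ((hnear ha).and ((hnear hb).and
    ((hnear hc).and ((hnear (htd N)).and hUs))))
  have hstep : ∀ s ∈ W, ∀ n, N ≤ n → ‖t (n + 1) s‖ ≤ r * ‖t n s‖ := by
    intro s hs n hn
    obtain ⟨h1, h2, h3, -, h5⟩ := hW s hs
    have hn' : (N : ℝ) ≤ n := Nat.cast_le.2 hn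
    have hcn : n - C ≤ ‖c s + n‖ := by
      have := norm_sub_le (c s + n) (c s)
      rw [add_sub_cancel_left, Complex.norm_natCast] at this
      linarith
    have h6 := congrArg norm (hrec n s h5)
    rw [norm_mul, norm_mul, norm_mul, norm_mul, norm_mul] at h6
    have e1 : ‖(n : ℂ) + 1‖ = n + 1 := by
      rw [← Nat.cast_add_one, Complex.norm_natCast]; push_cast; rfl
    rw [e1] at h6
    have h7 : ‖a s + n‖ ≤ A + n := (norm_add_le _ _).trans (by rw [Complex.norm_natCast]; linarith)
    have h8 : ‖b s + n‖ ≤ B + n := (norm_add_le _ _).trans (by rw [Complex.norm_natCast]; linarith)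
    have hden : 0 < (n - C) * (n + 1) := mul_pos (by linarith) (by linarith)
    have h9 : (A + n) * (B + n) * ‖x‖ ≤ r * ((n - C) * (n + 1)) :=
      ratio_numerator_le hA hB hC (norm_nonneg x) hxr hr1 (by linarith)
        (hND.le.trans (mul_le_mul_of_nonneg_right hn' (by linarith)))
    have h10 : ‖t (n + 1) s‖ * ((n - C) * (n + 1)) ≤ (r * ‖t n s‖) * ((n - C) * (n + 1)) := by
      calc ‖t (n + 1) s‖ * ((n - C) * (n + 1)) ≤ ‖t (n + 1) s‖ * (‖c s + n‖ * (n + 1)) := by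
            gcongr
        _ = ‖t n s‖ * (‖a s + n‖ * ‖b s + n‖ * ‖x‖) := h6
        _ ≤ ‖t n s‖ * ((A + n) * (B + n) * ‖x‖) := by gcongr
        _ ≤ ‖t n s‖ * (r * ((n - C) * (n + 1))) := by gcongr
        _ = _ := by ring
    exact le_of_mul_le_mul_right h10 hden
  have htsum : (fun s => ordinaryHypergeometric (a s) (b s) (c s) x) = fun s => ∑' n, t n s := by
    rw [ht]
    funext s
    rw [ordinaryHypergeometric_eq_tsum]
  rw [htsum]
  exact (differentiableOn_tsum_of_ratio hWo (fun n => (htd n).mono fun s hs => (hW s hs).2.2.2.2)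
    hr0.le hr1 hstep fun s hs => (hW s hs).2.2.2.1).differentiableAt (hWo.mem_nhds hsW)

theorem differentiable_legendreP {κ : ℝ} (hκ0 : 0 < κ) (hκ1 : κ ≤ 1) :
    Differentiable ℂ fun h => legendreP h κ := by
  rw [← differentiableOn_univ]
  refine DifferentiableOn.mul ?_ (differentiableOn_ordinaryHypergeometric isOpen_univ (by fun_prop)
    (by fun_prop) (by fun_prop) (fun s _ k h0 => ?_) ?_)
  · exact (Differentiable.const_cpow (by fun_prop)
      (Or.inl (Complex.ofReal_ne_zero.2 hκ0.ne'))).differentiableOn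
  · have := congrArg Complex.re h0
    simp at this
    linarith [(Nat.cast_nonneg k : (0 : ℝ) ≤ k)]
  · rw [Complex.norm_real, Real.norm_of_nonneg (by linarith)]; linarith

/-- The bracket in `GtildeGeneric` as a function of a complex weight. -/
noncomputable def connectionSum (s : ℂ) (ξ : ℝ) : ℂ :=
  (4 : ℂ) ^ s * (Complex.Gamma (1 - 2 * s) / Complex.Gamma (1 - s) ^ 2) *
      (((ξ : ℂ) / 2) ^ s * ordinaryHypergeometric (s / 2) (s / 2 + 1 / 2) (s + 1 / 2) ((ξ : ℂ) ^ 2)) +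
    (4 : ℂ) ^ (1 - s) * (Complex.Gamma (2 * s - 1) / Complex.Gamma s ^ 2) *
      (((ξ : ℂ) / 2) ^ (1 - s) * ordinaryHypergeometric ((1 - s) / 2) ((1 - s) / 2 + 1 / 2)
        (1 - s + 1 / 2) ((ξ : ℂ) ^ 2))

theorem GtildeGeneric_eq_connectionSum {h u u' ξ : ℝ} {z z' : ℂ} (hξ : xi u z u' z' = ξ) :
    GtildeGeneric h u z u' z' = smearConst h * connectionSum h ξ := by
  rw [GtildeGeneric, connectionSum, G, G, hξ]
  push_cast
  rfl

theorem sin_two_pi_mul_ne_zero_iff (s : ℂ) :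
    Complex.sin (2 * Real.pi * s) ≠ 0 ↔ ∀ m : ℤ, 2 * s ≠ m := by
  rw [Ne, Complex.sin_eq_zero_iff, not_exists]
  refine forall_congr' fun m => not_congr ?_
  have : (Real.pi : ℂ) ≠ 0 := Complex.ofReal_ne_zero.2 Real.pi_ne_zero
  constructor
  · intro h
    apply mul_right_cancel₀ this
    rw [← h]; ring
  · intro h
    rw [← h]; ring

/-- All poles of the Gamma factors and all forbidden lower hypergeometric parameters occur where 2s
is an integer. -/
theorem differentiableOn_connectionSum {ξ : ℝ} (hξ0 : 0 < ξ) (hξ1 : ξ < 1) :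
    DifferentiableOn ℂ (fun s => connectionSum s ξ) {s | Complex.sin (2 * Real.pi * s) ≠ 0} := by
  have hop : IsOpen {s : ℂ | Complex.sin (2 * Real.pi * s) ≠ 0} :=
    isOpen_ne_fun (by fun_prop) continuous_const
  have hpow : ∀ {b : ℂ} {g : ℂ → ℂ}, b ≠ 0 → Differentiable ℂ g →
      DifferentiableOn ℂ (fun s => b ^ g s) {s | Complex.sin (2 * Real.pi * s) ≠ 0} :=
    fun hb hg => (hg.const_cpow (Or.inl hb)).differentiableOn
  have hgam : ∀ {g : ℂ → ℂ}, Differentiable ℂ g → (∀ s : ℂ, (∀ m : ℤ, 2 * s ≠ m) →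
      ∀ k : ℕ, g s ≠ -k) → DifferentiableOn ℂ (fun s => Complex.Gamma (g s))
        {s | Complex.sin (2 * Real.pi * s) ≠ 0} := fun hg h s hs =>
    ((Complex.differentiableAt_Gamma _ (h s ((sin_two_pi_mul_ne_zero_iff s).1 hs))).comp s
      (hg s)).differentiableWithinAt
  have n1 : ∀ s : ℂ, (∀ m : ℤ, 2 * s ≠ m) → ∀ k : ℕ, 1 - 2 * s ≠ -k := fun s hs k h0 =>
    hs (1 + k) (by push_cast; linear_combination -h0)
  have n2 : ∀ s : ℂ, (∀ m : ℤ, 2 * s ≠ m) → ∀ k : ℕ, 1 - s ≠ -k := fun s hs k h0 =>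
    hs (2 + 2 * k) (by push_cast; linear_combination -2 * h0)
  have n3 : ∀ s : ℂ, (∀ m : ℤ, 2 * s ≠ m) → ∀ k : ℕ, 2 * s - 1 ≠ -k := fun s hs k h0 =>
    hs (1 - k) (by push_cast; linear_combination h0)
  have n4 : ∀ s : ℂ, (∀ m : ℤ, 2 * s ≠ m) → ∀ k : ℕ, s ≠ -k := fun s hs k h0 =>
    hs (-2 * k) (by push_cast; linear_combination 2 * h0)
  have n5 : ∀ s : ℂ, (∀ m : ℤ, 2 * s ≠ m) → ∀ k : ℕ, s + 1 / 2 ≠ -k := fun s hs k h0 =>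
    hs (-1 - 2 * k) (by push_cast; linear_combination 2 * h0)
  have n6 : ∀ s : ℂ, (∀ m : ℤ, 2 * s ≠ m) → ∀ k : ℕ, 1 - s + 1 / 2 ≠ -k := fun s hs k h0 =>
    hs (3 + 2 * k) (by push_cast; linear_combination -2 * h0)
  have hx : ‖(ξ : ℂ) ^ 2‖ < 1 := by
    rw [norm_pow, Complex.norm_of_nonneg hξ0.le]; exact pow_lt_one₀ hξ0.le hξ1 two_ne_zero
  have h4 : (4 : ℂ) ≠ 0 := by norm_num
  have hξ2 : (ξ : ℂ) / 2 ≠ 0 := div_ne_zero (Complex.ofReal_ne_zero.2 hξ0.ne') two_ne_zero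
  refine DifferentiableOn.add (DifferentiableOn.mul (DifferentiableOn.mul (hpow h4
    differentiable_id) ?_) (DifferentiableOn.mul (hpow hξ2 differentiable_id) ?_))
    (DifferentiableOn.mul (DifferentiableOn.mul (hpow h4 (by fun_prop)) ?_)
    (DifferentiableOn.mul (hpow hξ2 (by fun_prop)) ?_))
  · exact (hgam (by fun_prop) n1).div ((hgam (by fun_prop) n2).pow 2) fun s hs =>
      pow_ne_zero _ (Complex.Gamma_ne_zero (n2 s ((sin_two_pi_mul_ne_zero_iff s).1 hs)))
  · exact differentiableOn_ordinaryHypergeometric hop (by fun_prop) (by fun_prop) (by fun_prop)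
      (fun s hs => n5 s ((sin_two_pi_mul_ne_zero_iff s).1 hs)) hx
  · exact (hgam (by fun_prop) n3).div ((hgam (by fun_prop) n4).pow 2) fun s hs =>
      pow_ne_zero _ (Complex.Gamma_ne_zero (n4 s ((sin_two_pi_mul_ne_zero_iff s).1 hs)))
  · exact differentiableOn_ordinaryHypergeometric hop (by fun_prop) (by fun_prop) (by fun_prop)
      (fun s hs => n6 s ((sin_two_pi_mul_ne_zero_iff s).1 hs)) hx

theorem smearConst_ne_zero {h : ℝ} (hh : 0 < h) : smearConst h ≠ 0 := fun h0 => by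
  have := smearConst_mul_ballMoment hh
  simp [h0] at this

/-- Real weights accumulate at x in the complex plane; this is how identities proved for real
weights enter the identity theorem. -/
theorem frequently_ofReal_nhdsNE (x : ℝ) {p : ℂ → Prop} (hp : ∀ᶠ s : ℝ in 𝓝 x, p s) :
    ∃ᶠ s in 𝓝[≠] (x : ℂ), p s := by
  have h1 : Tendsto (fun s : ℝ => (s : ℂ)) (𝓝[≠] x) (𝓝[≠] (x : ℂ)) := by
    refine tendsto_nhdsWithin_iff.2 ⟨Complex.continuous_ofReal.continuousAt.tendsto.mono_left
      nhdsWithin_le_nhds, ?_⟩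
    filter_upwards [self_mem_nhdsWithin] with s hs
    simpa using hs
  exact h1.frequently (hp.filter_mono nhdsWithin_le_nhds).frequently

/-- Both sides are holomorphic off the half-integers, the complement of a countable set and so
connected, and they agree for real weights near 1/4. -/
theorem connectionSum_eq_legendreP {s : ℂ} {ξ : ℝ} (hs : Complex.sin (2 * Real.pi * s) ≠ 0)
    (hξ0 : 0 < ξ) (hξ1 : ξ < 1) : connectionSum s ξ = legendreP s (2 * ξ / (1 + ξ)) := by
  have hop : IsOpen {s : ℂ | Complex.sin (2 * Real.pi * s) ≠ 0} :=
    isOpen_ne_fun (by fun_prop) continuous_const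
  have hcount : {s : ℂ | Complex.sin (2 * Real.pi * s) = 0}.Countable := by
    refine (countable_range fun m : ℤ => (m : ℂ) / 2).mono fun s hs => ?_
    by_contra hcon
    refine (sin_two_pi_mul_ne_zero_iff s).2 (fun m hm => hcon ⟨m, ?_⟩) hs
    dsimp only
    rw [← hm]; ring
  have hconn : IsPreconnected {s : ℂ | Complex.sin (2 * Real.pi * s) ≠ 0} := by
    have := hcount.isPathConnected_compl_of_one_lt_rank
      (by rw [Complex.rank_real_complex]; exact Cardinal.one_lt_two)
    exact this.isConnected.isPreconnected
  have hquart : ((1 / 4 : ℝ) : ℂ) ∈ {s : ℂ | Complex.sin (2 * Real.pi * s) ≠ 0} := by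
    refine (sin_two_pi_mul_ne_zero_iff _).2 fun m hm => ?_
    have h1 : ((2 * m : ℤ) : ℂ) = (1 : ℤ) := by
      push_cast; rw [← hm]; push_cast; ring
    have := Int.cast_injective h1
    omega
  refine AnalyticOnNhd.eqOn_of_preconnected_of_frequently_eq
    (f := fun s => connectionSum s ξ) (g := fun s => legendreP s (2 * ξ / (1 + ξ)))
    ((differentiableOn_connectionSum hξ0 hξ1).analyticOnNhd hop)
    ((differentiable_legendreP (by positivity) (by rw [div_le_one (by positivity)]; linarith)).differentiableOn.analyticOnNhd hop)
    hconn hquart (frequently_ofReal_nhdsNE _ ?_) hs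
  -- `GtildeGeneric` takes points rather than ξ; these two points at equal height realise ξ.
  have hξ' : xi 1 0 1 ((√(2 / ξ - 2) : ℝ) : ℂ) = ξ := by
    have h1 : 0 ≤ 2 / ξ - 2 := by
      rw [sub_nonneg, le_div_iff₀ hξ0]; linarith
    have h2 : (((√(2 / ξ - 2) : ℝ) : ℂ)) ^ 2 = 2 / ξ - 2 := by
      rw [← Complex.ofReal_pow, Real.sq_sqrt h1]; push_cast; rfl
    have h3 : (ξ : ℂ) ≠ 0 := Complex.ofReal_ne_zero.2 hξ0.ne'
    rw [xi, zero_sub, neg_sq, h2]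
    field_simp
    push_cast
    ring
  filter_upwards [Ioo_mem_nhds (show (0 : ℝ) < 1 / 4 by norm_num)
    (show (1 / 4 : ℝ) < 1 / 2 by norm_num)] with s hs
  have h1 := GtildeGeneric_eq_of_lt_one hs.1 (by linarith [hs.2]) hs.2.ne hξ0 hξ1 hξ'
  rw [GtildeGeneric_eq_connectionSum hξ'] at h1
  exact mul_left_cancel₀ (smearConst_ne_zero hs.1) h1

theorem continuousAt_smearConst {h : ℝ} (hh : 0 < h) : ContinuousAt smearConst h := by
  have h1 : ∀ {c : ℂ} (a : ℝ), 0 < a → c = a → ContinuousAt Complex.Gamma c := fun a ha hc => by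
    refine (Complex.differentiableAt_Gamma _ fun k h0 => ?_).continuousAt
    have := congrArg Complex.re h0
    rw [hc] at this
    simp at this
    linarith [(Nat.cast_nonneg k : (0 : ℝ) ≤ k)]
  unfold smearConst
  refine ContinuousAt.mul (ContinuousAt.div continuousAt_const ?_ ?_) (ContinuousAt.div ?_ ?_ ?_)
  · exact (continuousAt_const_cpow (by norm_num : (4 : ℂ) ≠ 0)).comp (f := fun h : ℝ => (h : ℂ))
      Complex.continuous_ofReal.continuousAt
  · simp [Complex.cpow_eq_zero_iff]
  · exact (h1 (2 * h) (by linarith) (by push_cast; rfl)).comp (f := fun h : ℝ => (2 * h : ℂ)) (by fun_prop)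
  · exact ((h1 h hh rfl).comp (f := fun h : ℝ => (h : ℂ)) (by fun_prop)).pow 2
  · exact pow_ne_zero _ (Complex.Gamma_ne_zero_of_re_pos (by simpa))

/-- The Legendre expression is continuous in the weight also where 2h is an integer, and agrees with
the generic formula at all nearby weights other than h, so it is the limit. -/
theorem Gtilde_eq_legendreP {h u u' ξ : ℝ} {z z' : ℂ} (hh : 0 < h) (hξ0 : 0 < ξ) (hξ1 : ξ < 1)
    (hξ : xi u z u' z' = ξ) :
    Gtilde h u z u' z' = smearConst h * legendreP h (2 * ξ / (1 + ξ)) := by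
  refine Tendsto.limUnder_eq ?_
  have hP : ContinuousAt (fun s : ℝ => smearConst s * legendreP s (2 * ξ / (1 + ξ))) h :=
    (continuousAt_smearConst hh).mul (((differentiable_legendreP (κ := 2 * ξ / (1 + ξ)) (by positivity)
      (by rw [div_le_one (by positivity)]; linarith)).continuous.comp
      Complex.continuous_ofReal).continuousAt)
  refine (hP.tendsto.mono_left nhdsWithin_le_nhds).congr' ?_
  -- The zeros of the sine are simple, hence isolated.
  have hev : ∀ᶠ s : ℝ in 𝓝[≠] h, Real.sin (2 * Real.pi * s) ≠ 0 := by
    by_cases hcos : Real.cos (2 * Real.pi * h) = 0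
    · have : Real.sin (2 * Real.pi * h) ≠ 0 := fun h0 => by
        have := Real.sin_sq_add_cos_sq (2 * Real.pi * h)
        simp [h0, hcos] at this
      have hc : ContinuousAt (fun s : ℝ => Real.sin (2 * Real.pi * s)) h := by fun_prop
      exact (hc.eventually_ne this).filter_mono nhdsWithin_le_nhds
    · have hd : HasDerivAt (fun s : ℝ => Real.sin (2 * Real.pi * s))
          (Real.cos (2 * Real.pi * h) * (2 * Real.pi)) h :=
        (Real.hasDerivAt_sin _).comp h (by simpa using (hasDerivAt_id h).const_mul (2 * Real.pi))
      exact hd.eventually_ne (mul_ne_zero hcos (by positivity))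
  filter_upwards [hev] with s hs
  rw [GtildeGeneric_eq_connectionSum hξ, connectionSum_eq_legendreP _ hξ0 hξ1]
  have : Complex.sin (2 * Real.pi * s) = ((Real.sin (2 * Real.pi * s) : ℝ) : ℂ) := by push_cast; rfl
  rw [this]
  exact Complex.ofReal_ne_zero.2 hs

/-! ### Collapsing the Π-contour for 0 < h < 1. -/

/-- The factor (L²/(L²-t²))^(1-h) is at least 1, so the weighted bound implies the unweighted one.
-/
theorem integrableOn_div_abs_sq_sub_sq_rpow {h u L : ℝ} (hh0 : 0 < h) (hh1 : h < 1) (hu : 0 < u)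
    (hL : 0 < L) (hne : u ≠ L) :
    IntegrableOn (fun s => (u / |u ^ 2 - s ^ 2|) ^ h) (Ioo (-L) L) := by
  refine ((integrableOn_smearWeight_mul_bound hh0 hh1 hu hL hne).const_mul (L ^ (1 - h))).mono'
    (Measurable.aestronglyMeasurable (Measurable.pow_const (by fun_prop) _)) ?_
  filter_upwards [ae_restrict_mem measurableSet_Ioo] with t ht
  have h0 : 0 < L ^ 2 - t ^ 2 := by nlinarith [ht.1, ht.2]
  rw [Real.norm_of_nonneg (by positivity), ← mul_assoc, ← Real.mul_rpow hL.le (by positivity)]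
  refine le_mul_of_one_le_left (by positivity) (Real.one_le_rpow ?_ (by linarith))
  rw [mul_div_assoc', one_le_div h0]
  nlinarith [sq_nonneg t]

theorem intervalIntegrable_div_abs_sq_sub_sq_rpow {h u : ℝ} (hh0 : 0 < h) (hh1 : h < 1) (hu : 0 < u)
    (a b : ℝ) : IntervalIntegrable (fun s => (u / |u ^ 2 - s ^ 2|) ^ h) volume a b := by
  have h1 := integrableOn_div_abs_sq_sub_sq_rpow hh0 hh1 hu (L := |a| + |b| + u + 1)
    (by positivity) (by have := abs_nonneg a; have := abs_nonneg b; linarith)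
  rw [intervalIntegrable_iff]
  refine h1.mono_set fun x hx => ?_
  have hx' := uIoc_subset_uIcc hx
  rw [mem_uIcc] at hx'
  have := neg_abs_le a
  have := le_abs_self a
  have := neg_abs_le b
  have := le_abs_self b
  have := abs_nonneg a
  have := abs_nonneg b
  constructor <;> rcases hx' with ⟨h2, h3⟩ | ⟨h2, h3⟩ <;> linarith

theorem measurable_kernel (h : ℂ) (u : ℝ) : Measurable (kernel h u) :=
  Measurable.pow_const (by fun_prop) _

theorem kernel_neg (h : ℂ) (u : ℝ) (ζ : ℂ) : kernel h u (-ζ) = kernel h u ζ := by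
  rw [kernel, kernel, neg_sq]

theorem differentiableAt_kernel (h : ℂ) {u : ℝ} (hu : 0 < u) {ζ : ℂ}
    (hζ : (u : ℂ) ^ 2 + ζ ^ 2 ∈ Complex.slitPlane) : DifferentiableAt ℂ (kernel h u) ζ := by
  refine DifferentiableAt.cpow_const ?_ (ofReal_div_mem_slitPlane hu hζ)
  exact DifferentiableAt.div (by fun_prop) (by fun_prop) (Complex.slitPlane_ne_zero hζ)

theorem sq_add_sq_mem_slitPlane_of_re_ne_zero (u : ℝ) {ζ : ℂ} (hζ : ζ.re ≠ 0) :
    (u : ℂ) ^ 2 + ζ ^ 2 ∈ Complex.slitPlane := by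
  have := add_sq_mem_slitPlane (u := u) (y := ζ.im) hζ
  rwa [Complex.re_add_im] at this

theorem intervalIntegrable_kernel_horizontal {h u y : ℝ} (hh0 : 0 ≤ h) (hu : 0 < u) (hy : |y| ≠ u)
    (a b : ℝ) :
    IntervalIntegrable (fun x : ℝ => kernel h u (x + y * Complex.I)) volume a b := by
  rw [intervalIntegrable_iff]
  refine Measure.integrableOn_of_bounded (M := (u / |u ^ 2 - y ^ 2|) ^ h)
    (by simp [uIoc]) ((measurable_kernel h u).comp (by fun_prop)).aestronglyMeasurable
    (ae_of_all _ fun x => norm_kernel_le hh0 hu hy)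

/-- Cauchy's theorem on the part Re ζ ≥ η of the right half-rectangle, where the kernel is
holomorphic; as η → 0 the inner vertical side acquires the boundary values. Their singularities are
integrable because h < 1. -/
theorem integral_kernel_right_half {h u ε t : ℝ} {g : ℂ → ℂ} (hh0 : 0 < h) (hh1 : h < 1)
    (hu : 0 < u) (hε : 0 < ε) (ht : |t| ≠ u) (hg : DifferentiableOn ℂ g (uIcc 0 ε ×ℂ (uIcc 0 t))) :
    (∫ x in (0 : ℝ)..ε, kernel h u (x + (-t : ℝ) * Complex.I) * g x) -
      (∫ x in (0 : ℝ)..ε, kernel h u (x + (0 : ℝ) * Complex.I) * g (x + t * Complex.I)) +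
      Complex.I * (∫ y in (0 : ℝ)..t, kernel h u (ε + (y - t : ℝ) * Complex.I) *
        g (ε + y * Complex.I)) =
      Complex.I * ∫ y in (0 : ℝ)..t, kernelBdry h u (y - t) * g (y * Complex.I) := by
  have hmem : ∀ {x y : ℝ}, x ∈ (uIcc 0 ε) → y ∈ (uIcc 0 t) →
      (x : ℂ) + y * Complex.I ∈ (uIcc 0 ε) ×ℂ (uIcc 0 t) := fun hx hy => by
    rw [Complex.mem_reProdIm]; simpa using ⟨hx, hy⟩
  have hu0 : |(0 : ℝ)| ≠ u := by simpa using hu.ne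
  have hc0 : ContinuousOn (fun x : ℝ => g x) (uIcc 0 ε) :=
    hg.continuousOn.comp (by fun_prop) fun x hx => by simpa using hmem hx left_mem_uIcc
  have hct : ContinuousOn (fun x : ℝ => g (x + t * Complex.I)) (uIcc 0 ε) :=
    hg.continuousOn.comp (by fun_prop) fun x hx => hmem hx right_mem_uIcc
  have hi1 : IntervalIntegrable (fun x : ℝ => kernel h u (x + (-t : ℝ) * Complex.I) * g x)
      volume 0 ε :=
    (intervalIntegrable_kernel_horizontal hh0.le hu (by rwa [abs_neg]) 0 ε).mul_continuousOn hc0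
  have hi2 : IntervalIntegrable (fun x : ℝ => kernel h u (x + (0 : ℝ) * Complex.I) *
      g (x + t * Complex.I)) volume 0 ε :=
    (intervalIntegrable_kernel_horizontal hh0.le hu hu0 0 ε).mul_continuousOn hct
  -- Limit of the horizontal sides, by continuity of a primitive at its endpoint.
  have hprim : ∀ {F : ℝ → ℂ}, IntervalIntegrable F volume 0 ε →
      Tendsto (fun η : ℝ => ∫ x in η..ε, F x) (𝓝[>] 0) (𝓝 (∫ x in (0 : ℝ)..ε, F x)) := by
    intro F hF
    have h1 := (intervalIntegral.continuousOn_primitive_interval' hF right_mem_uIcc) 0 left_mem_uIcc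
    rw [uIcc_of_le hε.le] at h1
    have h2 : Tendsto (fun η : ℝ => ∫ x in ε..η, F x) (𝓝[>] 0) (𝓝 (∫ x in ε..(0 : ℝ), F x)) :=
      h1.tendsto.mono_left (nhdsWithin_le_of_mem
        (mem_of_superset (Ioo_mem_nhdsGT hε) Ioo_subset_Icc_self))
    have h3 := h2.neg
    simp only [← intervalIntegral.integral_symm] at h3
    exact h3
  obtain ⟨M, hM⟩ := (isCompact_uIcc.reProdIm isCompact_uIcc).exists_bound_of_continuousOn
    hg.continuousOn
  have hbd : IntervalIntegrable (fun y => (u / |u ^ 2 - (y - t) ^ 2|) ^ h * M) volume 0 t := by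
    have := (intervalIntegrable_div_abs_sq_sub_sq_rpow hh0 hh1 hu (0 - t) (t - t)).comp_sub_right t
    simp only [sub_add_cancel] at this
    exact this.mul_const M
  have hcv : ∀ x ∈ (uIcc 0 ε), ContinuousOn (fun y : ℝ => g (x + y * Complex.I)) (uIcc 0 t) :=
    fun x hx => hg.continuousOn.comp (by fun_prop) fun y hy => hmem hx hy
  have hne : ∀ᵐ y : ℝ, |y - t| ≠ u := by
    filter_upwards [compl_mem_ae_iff.2 ((Set.toFinite {t + u, t - u}).measure_zero volume)]
      with y hy h0
    rcases (abs_eq hu.le).1 h0 with h1 | h1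
    · exact hy (Or.inl (by linarith))
    · exact hy (Or.inr (by simp; linarith))
  -- Limit of the inner vertical side, by dominated convergence.
  have hlim : Tendsto (fun η : ℝ => ∫ y in (0 : ℝ)..t, kernel h u (η + (y - t : ℝ) * Complex.I) *
      g (η + y * Complex.I)) (𝓝[>] 0)
      (𝓝 (∫ y in (0 : ℝ)..t, kernelBdry h u (y - t) * g (y * Complex.I))) := by
    refine intervalIntegral.tendsto_integral_filter_of_dominated_convergence _ ?_ ?_ hbd ?_
    · filter_upwards [Ioo_mem_nhdsGT hε] with η hη
      refine AEStronglyMeasurable.mul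
        ((measurable_kernel h u).comp (by fun_prop)).aestronglyMeasurable ?_
      refine ((hcv η ?_).mono uIoc_subset_uIcc).aestronglyMeasurable measurableSet_uIoc
      rw [uIcc_of_le hε.le]; exact ⟨hη.1.le, hη.2.le⟩
    · filter_upwards [Ioo_mem_nhdsGT hε] with η hη
      filter_upwards [hne] with y hy hyt
      rw [norm_mul]
      refine mul_le_mul (norm_kernel_le hh0.le hu hy) (hM _ (hmem ?_ (uIoc_subset_uIcc hyt)))
        (norm_nonneg _) (by positivity)
      rw [uIcc_of_le hε.le]; exact ⟨hη.1.le, hη.2.le⟩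
    · filter_upwards [hne] with y hy hyt
      refine (tendsto_kernel_kernelBdry hu hy).mul ?_
      have h1 : ContinuousWithinAt (fun η : ℝ => g (η + y * Complex.I)) (uIcc 0 ε) 0 :=
        (hg.continuousOn.comp (s := (uIcc 0 ε)) (f := fun η : ℝ => (η : ℂ) + y * Complex.I)
          (by fun_prop) fun x hx => hmem hx (uIoc_subset_uIcc hyt)) 0 left_mem_uIcc
      have h2 := h1.tendsto
      rw [Complex.ofReal_zero, zero_add, uIcc_of_le hε.le] at h2
      exact h2.mono_left (nhdsWithin_le_of_mem
        (mem_of_superset (Ioo_mem_nhdsGT hε) Ioo_subset_Icc_self))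
  refine tendsto_nhds_unique (Tendsto.congr' ?_ (((hprim hi1).sub (hprim hi2)).add
    (tendsto_const_nhds (x := Complex.I * (∫ y in (0 : ℝ)..t,
      kernel h u (ε + (y - t : ℝ) * Complex.I) * g (ε + y * Complex.I)))))) (hlim.const_mul _)
  filter_upwards [Ioo_mem_nhdsGT hε] with η hη
  have hsub : (uIcc η ε) ⊆ (uIcc 0 ε) := by
    rw [uIcc_of_le hε.le, uIcc_of_le hη.2.le]; exact Icc_subset_Icc_left hη.1.le
  have hC := Complex.integral_boundary_rect_eq_zero_of_differentiableOn
    (fun ζ => kernel h u (ζ - t * Complex.I) * g ζ) (η : ℂ) (ε + t * Complex.I) (by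
      simp only [Complex.add_re, Complex.add_im, Complex.ofReal_re, Complex.ofReal_im,
        Complex.mul_re, Complex.mul_im, Complex.I_re, Complex.I_im, mul_zero, mul_one, sub_zero,
        add_zero, zero_add]
      intro ζ hζ
      obtain ⟨h1, h2⟩ := Complex.mem_reProdIm.1 hζ
      refine DifferentiableWithinAt.mul (DifferentiableAt.differentiableWithinAt ?_)
        ((hg ζ (Complex.mem_reProdIm.2 ⟨hsub h1, h2⟩)).mono ?_)
      · refine DifferentiableAt.comp (f := fun ζ : ℂ => ζ - t * Complex.I) ζ
          (differentiableAt_kernel h hu (sq_add_sq_mem_slitPlane_of_re_ne_zero u ?_)) (by fun_prop)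
        rw [uIcc_of_le hη.2.le] at h1
        have h3 : 0 < ζ.re := hη.1.trans_le h1.1
        simpa using h3.ne'
      · intro ξ hξ
        obtain ⟨h3, h4⟩ := Complex.mem_reProdIm.1 hξ
        exact Complex.mem_reProdIm.2 ⟨hsub h3, h4⟩)
  simp only [Complex.add_re, Complex.add_im, Complex.ofReal_re, Complex.ofReal_im,
        Complex.mul_re, Complex.mul_im, Complex.I_re, Complex.I_im, mul_zero, mul_one, sub_zero,
        add_zero, zero_add, smul_eq_mul, Complex.ofReal_zero, zero_mul] at hC
  have c1 : ∀ x : ℝ, kernel h u (x + (-t : ℝ) * Complex.I) = kernel h u (x - t * Complex.I) :=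
    fun x => by congr 1; push_cast; ring
  have c2 : ∀ x : ℝ, kernel h u (x + (0 : ℝ) * Complex.I) =
      kernel h u (x + t * Complex.I - t * Complex.I) := fun x => by congr 1; push_cast; ring
  have c3 : ∀ x y : ℝ, kernel h u (x + (y - t : ℝ) * Complex.I) =
      kernel h u (x + y * Complex.I - t * Complex.I) := fun x y => by congr 1; push_cast; ring
  simp_rw [c1, c2, c3]
  linear_combination hC

theorem segIntegral_add_mul (p c : ℂ) (a b : ℝ) (F : ℂ → ℂ) :
    segIntegral (p + a * c) (p + b * c) F = c * ∫ y in a..b, F (p + y * c) := by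
  have h1 := intervalIntegral.smul_integral_comp_mul_add (a := 0) (b := 1)
    (fun y : ℝ => F (p + y * c)) (b - a) a
  simp only [mul_zero, zero_add, mul_one, sub_add_cancel] at h1
  rw [← h1, segIntegral, Complex.real_smul]
  have e : ∀ s : ℝ, p + a * c + s * (p + b * c - (p + a * c)) =
      p + (((b - a) * s + a : ℝ) : ℂ) * c := fun s => by push_cast; ring
  simp_rw [e]
  push_cast
  ring

theorem bumpIntegral_mul_I (ε t : ℝ) (F : ℂ → ℂ) :
    bumpIntegral 0 ε (t * Complex.I) F =
      Complex.I * (∫ y in (0 : ℝ)..t, F (-ε + y * Complex.I)) +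
        (∫ x in -ε..ε, F (x + t * Complex.I)) -
        Complex.I * ∫ y in (0 : ℝ)..t, F (ε + y * Complex.I) := by
  have h1 := segIntegral_add_mul (-ε) Complex.I 0 t F
  have h2 := segIntegral_add_mul (t * Complex.I) 1 (-ε) ε F
  have h3 := segIntegral_add_mul ε Complex.I t 0 F
  rw [intervalIntegral.integral_symm] at h3
  simp only [Complex.ofReal_zero, zero_mul, add_zero, mul_one, one_mul, Complex.ofReal_neg] at h1 h2 h3
  have e2 : ∀ x : ℝ, (t * Complex.I + x : ℂ) = x + t * Complex.I := fun x => add_comm _ _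
  simp_rw [e2] at h2
  rw [bumpIntegral, Complex.ofReal_zero, zero_sub, zero_add, sub_eq_add_neg (t * Complex.I : ℂ),
    add_comm (t * Complex.I : ℂ) (-ε : ℂ), h1, add_comm (t * Complex.I : ℂ) (ε : ℂ),  h3,
    add_comm (-ε : ℂ), add_comm (ε : ℂ), e2, h2]
  ring

/-- The jump of `kernel` across the imaginary axis, up to the factor `2 sin (π h)`. -/
noncomputable def jumpKernel (h u s : ℝ) : ℝ := if u < |s| then (u / (s ^ 2 - u ^ 2)) ^ h else 0

theorem measurable_kernelBdry (h u : ℝ) : Measurable (kernelBdry h u) := by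
  refine Measurable.ite (measurableSet_lt (by fun_prop) (by fun_prop)) ?_ ?_
  · exact Complex.measurable_ofReal.comp (Measurable.pow_const (by fun_prop) _)
  · refine (Complex.measurable_ofReal.comp (Measurable.pow_const (by fun_prop) _)).mul ?_
    exact Complex.measurable_exp.comp (Measurable.ite (measurableSet_lt (by fun_prop)
      (by fun_prop)) (by fun_prop) (by fun_prop))

theorem ae_abs_ne {u : ℝ} (hu : 0 < u) : ∀ᵐ y : ℝ, |y| ≠ u := by
  filter_upwards [compl_mem_ae_iff.2 ((Set.toFinite {u, -u}).measure_zero volume)] with y hy h0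
  rcases (abs_eq hu.le).1 h0 with h1 | h1
  · exact hy (Or.inl h1)
  · exact hy (Or.inr h1)

theorem intervalIntegrable_kernelBdry {h u : ℝ} (hh0 : 0 < h) (hh1 : h < 1) (hu : 0 < u)
    (a b : ℝ) : IntervalIntegrable (kernelBdry h u) volume a b := by
  refine (intervalIntegrable_div_abs_sq_sub_sq_rpow hh0 hh1 hu a b).mono_fun'
    (measurable_kernelBdry h u).aestronglyMeasurable (ae_restrict_of_ae ?_)
  filter_upwards [ae_abs_ne hu] with y hy
  exact (norm_kernelBdry hu hy).le

/-- The kernel is even, so its boundary value from the left at height s is the one from the right at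
height -s. Beyond |s| = u the phases e^(±iπh) differ by 2i sin(πh). -/
theorem kernelBdry_neg_sub {h u s : ℝ} (hu : 0 < u) (hs : |s| ≠ u) :
    kernelBdry h u (-s) - kernelBdry h u s =
      (if 0 < s then 1 else -1) * (2 * Complex.I * Complex.sin (Real.pi * h)) * jumpKernel h u s := by
  have hsin : Complex.exp (Real.pi * h * Complex.I) - Complex.exp (-(Real.pi * h * Complex.I)) =
      2 * Complex.I * Complex.sin (Real.pi * h) := by
    rw [Complex.sin, neg_mul]
    linear_combination (Complex.exp (Real.pi * h * Complex.I) -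
      Complex.exp (-(Real.pi * h * Complex.I))) * Complex.I_sq
  by_cases h1 : |s| < u
  · simp [kernelBdry, jumpKernel, h1, not_lt.2 h1.le]
  · have h2 : u < |s| := lt_of_le_of_ne (not_lt.1 h1) hs.symm
    simp only [kernelBdry, jumpKernel, abs_neg, h1, h2, if_true, if_false, neg_sq]
    rw [← hsin]
    rcases lt_trichotomy s 0 with h3 | h3 | h3
    · rw [if_pos (neg_pos.2 h3), if_neg (not_lt.2 h3.le), if_neg (not_lt.2 h3.le)]
      ring
    · rw [h3, abs_zero] at h2
      linarith
    · rw [if_neg (by linarith), if_pos h3, if_pos h3]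
      ring

/-- Apply `integral_kernel_right_half` to g, and to ζ ↦ g(-ζ) with -t for the left half, and add.
The outer sides assemble to the bump and the real interval; the two boundary values on the imaginary
axis leave the jump. -/
theorem bumpIntegral_kernel_eq {h u ε t : ℝ} {g : ℂ → ℂ} (hh0 : 0 < h) (hh1 : h < 1)
    (hu : 0 < u) (hε : 0 < ε) (ht : |t| ≠ u)
    (hg : DifferentiableOn ℂ g (uIcc (-ε) ε ×ℂ uIcc 0 t)) :
    bumpIntegral 0 ε (t * Complex.I) (fun ζ => kernel h u (ζ - t * Complex.I) * g ζ) =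
      (∫ x in -ε..ε, kernel h u (x - t * Complex.I) * g x) +
        2 * Complex.sin (Real.pi * h) *
          ∫ y in uIoc 0 t, jumpKernel h u (t - y) * g (y * Complex.I) := by
  have hmemIcc : uIcc 0 ε ⊆ uIcc (-ε) ε := by
    rw [uIcc_of_le hε.le, uIcc_of_le (by linarith)]
    exact Icc_subset_Icc_left (by linarith)
  have hnegIcc : ∀ x ∈ uIcc 0 ε, -x ∈ uIcc (-ε) ε := by
    rw [uIcc_of_le hε.le, uIcc_of_le (by linarith)]
    exact fun x hx => ⟨by linarith [hx.2], by linarith [hx.1]⟩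
  have hnegt : ∀ y ∈ uIcc 0 (-t), -y ∈ uIcc 0 t := fun y hy => by
    rw [mem_uIcc] at hy ⊢
    rcases hy with ⟨h1, h2⟩ | ⟨h1, h2⟩
    · right; constructor <;> linarith
    · left; constructor <;> linarith
  have hmem : ∀ {x y : ℝ}, x ∈ uIcc (-ε) ε → y ∈ uIcc 0 t →
      (x : ℂ) + y * Complex.I ∈ uIcc (-ε) ε ×ℂ uIcc 0 t := fun hx hy => by
    rw [Complex.mem_reProdIm]; simpa using ⟨hx, hy⟩
  have R := integral_kernel_right_half hh0 hh1 hu hε ht (hg.mono fun ζ hζ => by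
    rw [Complex.mem_reProdIm] at hζ ⊢; exact ⟨hmemIcc hζ.1, hζ.2⟩)
  have L := integral_kernel_right_half (t := -t) (g := fun ζ => g (-ζ)) hh0 hh1 hu hε
    (by rwa [abs_neg]) (hg.comp (by fun_prop) fun ζ hζ => by
      rw [Complex.mem_reProdIm] at hζ ⊢
      exact ⟨hnegIcc _ hζ.1, hnegt _ hζ.2⟩)
  have hu0 : |(0 : ℝ)| ≠ u := by simpa using hu.ne
  have hzero : (0 : ℝ) ∈ uIcc (-ε) ε := by rw [uIcc_of_le (by linarith)]; constructor <;> linarith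
  have hc0 : ContinuousOn (fun x : ℝ => g x) (uIcc (-ε) ε) :=
    hg.continuousOn.comp (by fun_prop) fun x hx => by simpa using hmem hx left_mem_uIcc
  have hct : ContinuousOn (fun x : ℝ => g (x + t * Complex.I)) (uIcc (-ε) ε) :=
    hg.continuousOn.comp (by fun_prop) fun x hx => hmem hx right_mem_uIcc
  have hcv : ContinuousOn (fun y : ℝ => g (y * Complex.I)) (uIcc 0 t) :=
    hg.continuousOn.comp (by fun_prop) fun y hy => by simpa using hmem hzero hy
  have hi1 : IntervalIntegrable (fun x : ℝ => kernel h u (x - t * Complex.I) * g x)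
      volume (-ε) ε := by
    have := (intervalIntegrable_kernel_horizontal (y := -t) hh0.le hu (by rwa [abs_neg]) (-ε)
      ε).mul_continuousOn hc0
    simpa [sub_eq_add_neg] using this
  have hi2 : IntervalIntegrable (fun x : ℝ => kernel h u (x + t * Complex.I - t * Complex.I) *
      g (x + t * Complex.I)) volume (-ε) ε := by
    have := (intervalIntegrable_kernel_horizontal hh0.le hu hu0 (-ε) ε).mul_continuousOn hct
    simpa using this
  have hsubl : uIcc (-ε) 0 ⊆ uIcc (-ε) ε := uIcc_subset_uIcc_left hzero
  have hsubr : uIcc 0 ε ⊆ uIcc (-ε) ε := uIcc_subset_uIcc_right hzero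
  have hk1 : IntervalIntegrable (fun y : ℝ => kernelBdry h u (y - t) * g (y * Complex.I))
      volume 0 t := by
    have := (intervalIntegrable_kernelBdry hh0 hh1 hu (0 - t) (t - t)).comp_sub_right t
    simp only [sub_add_cancel] at this
    exact this.mul_continuousOn hcv
  have hk2 : IntervalIntegrable (fun y : ℝ => kernelBdry h u (t - y) * g (y * Complex.I))
      volume 0 t := by
    have := (intervalIntegrable_kernelBdry hh0 hh1 hu (t - 0) (t - t)).comp_sub_left t
    simp only [sub_sub_cancel] at this
    exact this.mul_continuousOn hcv
  have e1 : (∫ x in -ε..ε, kernel h u (x - t * Complex.I) * g x) =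
      (∫ x in (0 : ℝ)..ε, kernel h u (x + (-(-t) : ℝ) * Complex.I) * g (-x)) +
      ∫ x in (0 : ℝ)..ε, kernel h u (x + (-t : ℝ) * Complex.I) * g x := by
    rw [← intervalIntegral.integral_add_adjacent_intervals (hi1.mono_set hsubl) (hi1.mono_set hsubr),
      ← neg_zero, ← intervalIntegral.integral_comp_neg, neg_zero]
    congr 1
    · refine intervalIntegral.integral_congr fun x _ => ?_
      rw [← kernel_neg]
      congr 2 <;> push_cast <;> ring
    · refine intervalIntegral.integral_congr fun x _ => ?_
      congr 2; push_cast; ring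
  have e2 : (∫ x in -ε..ε, kernel h u (x + t * Complex.I - t * Complex.I) *
      g (x + t * Complex.I)) =
      (∫ x in (0 : ℝ)..ε, kernel h u (x + (0 : ℝ) * Complex.I) * g (-(x + (-t : ℝ) * Complex.I))) +
      ∫ x in (0 : ℝ)..ε, kernel h u (x + (0 : ℝ) * Complex.I) * g (x + t * Complex.I) := by
    rw [← intervalIntegral.integral_add_adjacent_intervals (hi2.mono_set hsubl) (hi2.mono_set hsubr),
      ← neg_zero, ← intervalIntegral.integral_comp_neg, neg_zero]
    congr 1
    · refine intervalIntegral.integral_congr fun x _ => ?_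
      rw [← kernel_neg]
      congr 2 <;> push_cast <;> ring
    · refine intervalIntegral.integral_congr fun x _ => ?_
      congr 2; push_cast; ring
  have e3 : (∫ y in (0 : ℝ)..-t, kernel h u (ε + (y - -t : ℝ) * Complex.I) *
      g (-(ε + y * Complex.I))) =
      -∫ y in (0 : ℝ)..t, kernel h u (-ε + y * Complex.I - t * Complex.I) *
        g (-ε + y * Complex.I) := by
    rw [← neg_zero, ← intervalIntegral.integral_comp_neg, intervalIntegral.integral_symm, neg_zero]
    congr 1
    refine intervalIntegral.integral_congr fun y _ => ?_
    rw [← kernel_neg]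
    congr 2 <;> push_cast <;> ring
  have e4 : (∫ y in (0 : ℝ)..-t, kernelBdry h u (y - -t) * g (-(y * Complex.I))) =
      -∫ y in (0 : ℝ)..t, kernelBdry h u (t - y) * g (y * Complex.I) := by
    rw [← neg_zero, ← intervalIntegral.integral_comp_neg, intervalIntegral.integral_symm, neg_zero]
    congr 1
    refine intervalIntegral.integral_congr fun y _ => ?_
    congr 2
    · ring
    · push_cast; ring
  have e5 : (∫ y in (0 : ℝ)..t, kernel h u (ε + (y - t : ℝ) * Complex.I) *
      g (ε + y * Complex.I)) = ∫ y in (0 : ℝ)..t, kernel h u (ε + y * Complex.I - t * Complex.I) *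
      g (ε + y * Complex.I) := by
    refine intervalIntegral.integral_congr fun y _ => ?_
    congr 2; push_cast; ring
  -- The sign in `kernelBdry_neg_sub` and the orientation of the integral from 0 to t both change
  -- with the sign of t, so the unoriented `uIoc` serves both cases.
  have e6 : -Complex.I * ((∫ y in (0 : ℝ)..t, kernelBdry h u (y - t) * g (y * Complex.I)) -
      ∫ y in (0 : ℝ)..t, kernelBdry h u (t - y) * g (y * Complex.I)) =
      2 * Complex.sin (Real.pi * h) *
          ∫ y in uIoc 0 t, jumpKernel h u (t - y) * g (y * Complex.I) := by
    have hne : ∀ᵐ y : ℝ, |t - y| ≠ u := by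
      filter_upwards [compl_mem_ae_iff.2 ((Set.toFinite {t + u, t - u}).measure_zero volume)]
        with y hy h0
      rcases (abs_eq hu.le).1 h0 with h1 | h1
      · exact hy (Or.inr (by simp; linarith))
      · exact hy (Or.inl (by linarith))
    have hs : ∀ y : ℝ, kernelBdry h u (y - t) = kernelBdry h u (-(t - y)) := fun y => by rw [neg_sub]
    rw [← intervalIntegral.integral_sub hk1 hk2]
    simp_rw [← sub_mul, hs]
    rcases le_total 0 t with h0 | h0
    · rw [intervalIntegral.integral_of_le h0, uIoc_of_le h0, ← integral_const_mul,
        ← integral_const_mul, integral_Ioc_eq_integral_Ioo, integral_Ioc_eq_integral_Ioo]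
      refine setIntegral_congr_ae measurableSet_Ioo ?_
      filter_upwards [hne] with y hy hyt
      rw [kernelBdry_neg_sub hu hy, if_pos (by linarith [hyt.2])]
      linear_combination (-2 * Complex.sin (Real.pi * h) * jumpKernel h u (t - y) *
        g (y * Complex.I)) * Complex.I_sq
    · rw [intervalIntegral.integral_of_ge h0, uIoc_of_ge h0, ← integral_neg, ← integral_const_mul,
        ← integral_const_mul, integral_Ioc_eq_integral_Ioo, integral_Ioc_eq_integral_Ioo]
      refine setIntegral_congr_ae measurableSet_Ioo ?_
      filter_upwards [hne] with y hy hyt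
      rw [kernelBdry_neg_sub hu hy, if_neg (by linarith [hyt.1])]
      linear_combination (-2 * Complex.sin (Real.pi * h) * jumpKernel h u (t - y) *
        g (y * Complex.I)) * Complex.I_sq
  rw [e3, e4] at L
  rw [e5] at R
  rw [bumpIntegral_mul_I, e1, e2, ← e6]
  linear_combination -R - L

/-! ### Smearing the collapsed contour. -/

theorem norm_ascPochhammer_eval_le {R : ℝ} {a : ℂ} (ha : ‖a‖ ≤ R) (n : ℕ) :
    ‖(ascPochhammer ℂ n).eval a‖ ≤ (ascPochhammer ℝ n).eval R := by
  have hR : 0 ≤ R := (norm_nonneg a).trans ha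
  induction n with
  | zero => simp
  | succ n ih =>
    rw [ascPochhammer_succ_eval, ascPochhammer_succ_eval, norm_mul]
    have : ‖a + n‖ ≤ R + n := (norm_add_le _ _).trans (by rw [Complex.norm_natCast]; linarith)
    exact mul_le_mul ih this (norm_nonneg _) ((norm_nonneg _).trans ih)

/-- The terms are squares of the nonnegative summable sequence b_n √q^n, and each of its terms is at
most its sum. -/
theorem summable_binomCoeff_sq_mul_pow {R q : ℝ} (hR : 0 ≤ R) (hq0 : 0 ≤ q) (hq1 : q < 1) :
    Summable fun n : ℕ => binomCoeff R n ^ 2 * q ^ n := by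
  have hs : √q < 1 := by rw [← Real.sqrt_one]; exact Real.sqrt_lt_sqrt hq0 hq1
  have h1 : Summable fun n : ℕ => binomCoeff R n * √q ^ n :=
    (hasSum_binomCoeff R (by rwa [abs_of_nonneg (Real.sqrt_nonneg q)])).summable
  have h0 : ∀ n, 0 ≤ binomCoeff R n * √q ^ n := fun n =>
    mul_nonneg (binomCoeff_nonneg hR n) (by positivity)
  refine (h1.mul_left (∑' n, binomCoeff R n * √q ^ n)).of_nonneg_of_le
    (fun n => by positivity) fun n => ?_
  have h2 : binomCoeff R n ^ 2 * q ^ n = (binomCoeff R n * √q ^ n) * (binomCoeff R n * √q ^ n) := by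
    rw [mul_mul_mul_comm, ← mul_pow, Real.mul_self_sqrt hq0, sq]
  rw [h2]
  exact mul_le_mul_of_nonneg_right (h1.le_tsum n fun m _ => h0 m) (h0 n)

theorem norm_legendreP_term (h : ℂ) (y : ℝ) (n : ℕ) :
    ‖((n.factorial : ℂ)⁻¹ * (ascPochhammer ℂ n).eval (1 - h) * (ascPochhammer ℂ n).eval (1 - h) *
      ((ascPochhammer ℂ n).eval 1)⁻¹) • (y : ℂ) ^ n‖ =
      (‖(ascPochhammer ℂ n).eval (1 - h)‖ / n.factorial) ^ 2 * |y| ^ n := by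
  rw [ascPochhammer_eval_one, smul_eq_mul, norm_mul, norm_mul, norm_mul, norm_mul, norm_inv, norm_pow,
    Complex.norm_natCast, Complex.norm_real, Real.norm_eq_abs]
  ring

/-- The squared binomial series of parameter R at 1 - κ₀ < 1 dominates termwise. Uniformity in κ
serves the exchange of integrations, uniformity in h the holomorphy in the weight. -/
theorem exists_norm_legendreP_le (R : ℝ) {κ₀ : ℝ} (hκ₀ : 0 < κ₀) :
    ∃ C, ∀ h : ℂ, ‖1 - h‖ ≤ R → ∀ κ ∈ Icc κ₀ 1, ‖legendreP h κ‖ ≤ C := by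
  by_cases hκ₁ : κ₀ ≤ 1
  swap
  · exact ⟨0, fun h _ κ hκ => absurd (hκ.1.trans hκ.2) hκ₁⟩
  by_cases hR : 0 ≤ R
  swap
  · exact ⟨0, fun h hh => absurd ((norm_nonneg _).trans hh) hR⟩
  refine ⟨κ₀ ^ (-R) * ∑' n : ℕ, binomCoeff R n ^ 2 * (1 - κ₀) ^ n, fun h hh κ hκ => ?_⟩
  have hκ0 : 0 < κ := hκ₀.trans_le hκ.1
  rw [legendreP, norm_mul]
  refine mul_le_mul ?_ ?_ (norm_nonneg _) (by positivity)
  · rw [Complex.norm_cpow_eq_rpow_re_of_pos hκ0]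
    have hre : -R ≤ (1 - h).re := by
      have := Complex.abs_re_le_norm (1 - h)
      linarith [neg_abs_le (1 - h).re]
    exact (Real.rpow_le_rpow_of_exponent_ge hκ0 hκ.2 hre).trans
      (Real.rpow_le_rpow_of_nonpos hκ₀ hκ.1 (by linarith))
  · rw [ordinaryHypergeometric_eq_tsum]
    refine tsum_of_norm_bounded (summable_binomCoeff_sq_mul_pow hR (by linarith)
      (by linarith)).hasSum fun n => ?_
    rw [norm_legendreP_term, abs_of_nonneg (by linarith [hκ.2])]
    have h1 := norm_ascPochhammer_eval_le hh n
    refine mul_le_mul (pow_le_pow_left₀ (by positivity) ?_ 2)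
      (pow_le_pow_left₀ (by linarith [hκ.2]) (by linarith [hκ.1]) n)
      (pow_nonneg (by linarith [hκ.2]) n) (by positivity)
    rw [binomCoeff]
    gcongr

theorem spacelike_parameter_mem {u u' v : ℝ} (hu : 0 < u) (hv : |v| < u' - u) :
    4 * u * u' / ((u + u') ^ 2 - v ^ 2) ∈ Icc (4 * u * u' / (u + u') ^ 2) 1 := by
  obtain ⟨hv1, hv2⟩ := abs_lt.1 hv
  have hu' : 0 < u' := by linarith [abs_nonneg v]
  have hden : 0 < (u + u') ^ 2 - v ^ 2 := by nlinarith
  refine ⟨div_le_div_of_nonneg_left (by positivity) hden (by nlinarith [sq_nonneg v]), ?_⟩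
  rw [div_le_one hden]
  nlinarith

theorem jumpKernel_eq_zero {h u s : ℝ} (hs : |s| ≤ u) : jumpKernel h u s = 0 := by
  rw [jumpKernel, if_neg (not_lt.2 hs)]

theorem integral_jumpKernel_mul {h u t : ℝ} (hu : 0 ≤ u) (g : ℝ → ℂ) :
    ∫ y in Ioo 0 t, jumpKernel h u (t - y) * g y =
      ∫ y in Ioo 0 (t - u), (((u / ((t - y) ^ 2 - u ^ 2)) ^ h : ℝ) : ℂ) * g y := by
  have e : ∀ y ∈ Ioo 0 t, jumpKernel h u (t - y) * g y = (Ioo 0 (t - u)).indicator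
      (fun y => (((u / ((t - y) ^ 2 - u ^ 2)) ^ h : ℝ) : ℂ) * g y) y := by
    intro y hy
    by_cases hyt : y < t - u
    · rw [indicator_of_mem (show y ∈ Ioo 0 (t - u) from ⟨hy.1, hyt⟩), jumpKernel, abs_of_pos (by linarith [hy.2]),
        if_pos (by linarith)]
    · rw [indicator_of_notMem fun h => hyt h.2, jumpKernel_eq_zero, Complex.ofReal_zero, zero_mul]
      rw [abs_of_pos (by linarith [hy.2])]; linarith
  rw [setIntegral_congr_fun measurableSet_Ioo e, setIntegral_indicator measurableSet_Ioo]
  congr 2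
  ext y
  constructor
  · exact fun h => h.2
  · exact fun h => ⟨⟨h.1, by linarith [h.2]⟩, h⟩

/-- Exchange the integrations over the region v + u < t < u'. At fixed v the t-integral is
`integral_spacelike`; its integrand is nonnegative and its value bounded in v, which also yields
absolute integrability. -/
theorem smearWeight_jump_fubini {h u u' : ℝ} (hh0 : 0 < h) (hh1 : h < 1) (hu : 0 < u)
    (huu' : u < u') {g : ℝ → ℂ} (hg : ContinuousOn g (Icc 0 u')) :
    IntegrableOn (fun t => smearWeight h u' t * ∫ y in Ioo 0 t, jumpKernel h u (t - y) * g y)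
      (Ioo 0 u') ∧
    ∫ t in Ioo 0 u', smearWeight h u' t * ∫ y in Ioo 0 t, jumpKernel h u (t - y) * g y =
      Real.pi / (2 * Complex.sin (Real.pi * h)) *
        ∫ v in Ioo 0 (u' - u), legendreP h (4 * u * u' / ((u + u') ^ 2 - v ^ 2)) * g v := by
  have hu' : 0 < u' := hu.trans huu'
  set A : ℝ → ℝ → ℝ := fun t v =>
    (u' / (u' ^ 2 - t ^ 2)) ^ (1 - h) * (u / ((t - v) ^ 2 - u ^ 2)) ^ h with hA
  set S : Set (ℝ × ℝ) := {p | p.2 + u < p.1 ∧ p.1 < u'} with hS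
  have hSm : MeasurableSet S := by
    have h1 : MeasurableSet {p : ℝ × ℝ | p.2 + u < p.1} := measurableSet_lt (by fun_prop) (by fun_prop)
    have h2 : MeasurableSet {p : ℝ × ℝ | p.1 < u'} := measurableSet_lt (by fun_prop) (by fun_prop)
    exact h1.inter h2
  set Φ : ℝ × ℝ → ℂ := S.indicator fun p => (A p.1 p.2 : ℂ) * g p.2 with hΦ
  have hAm : Measurable fun p : ℝ × ℝ => A p.1 p.2 :=
    (Measurable.pow_const (by fun_prop) _).mul (Measurable.pow_const (by fun_prop) _)
  have hgm : AEStronglyMeasurable g (volume.restrict (Ioo 0 (u' - u))) :=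
    (hg.mono fun v hv => ⟨hv.1.le, by linarith [hv.2]⟩).aestronglyMeasurable measurableSet_Ioo
  have hΦm : AEStronglyMeasurable Φ ((volume.restrict (Ioo 0 u')).prod
      (volume.restrict (Ioo 0 (u' - u)))) :=
    ((Complex.measurable_ofReal.comp hAm).aestronglyMeasurable.mul hgm.comp_snd).indicator hSm
  have hslice : ∀ v ∈ Ioo 0 (u' - u), (fun t => Φ (t, v)) = (Ioo (v + u) u').indicator
      fun t => (A t v : ℂ) * g v := fun v hv => by
    funext t
    simp only [hΦ, indicator, hS, mem_ofPred_eq, mem_Ioo]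
  have hsub : ∀ v ∈ Ioo 0 (u' - u), Ioo 0 u' ∩ Ioo (v + u) u' = Ioo (v + u) u' := fun v hv =>
    inter_eq_right.2 fun t ht => ⟨by linarith [ht.1, hv.1], ht.2⟩
  have habs : ∀ v ∈ Ioo 0 (u' - u), |v| < u' - u := fun v hv => by rw [abs_of_pos hv.1]; exact hv.2
  have hAi : ∀ v ∈ Ioo 0 (u' - u), IntegrableOn (fun t => A t v) (Ioo (v + u) u') := fun v hv =>
    integrableOn_spacelike hh0 hh1 hu (habs v hv)
  have hA0 : ∀ v ∈ Ioo 0 (u' - u), ∀ t ∈ Ioo (v + u) u', 0 ≤ A t v := fun v hv t ht => by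
    have h1 : 0 < u' ^ 2 - t ^ 2 := by nlinarith [ht.1, ht.2, hv.1]
    have h2 : 0 < (t - v) ^ 2 - u ^ 2 := by nlinarith [ht.1]
    positivity
  have hT : ∀ v ∈ Ioo 0 (u' - u), ((∫ t in Ioo (v + u) u', A t v : ℝ) : ℂ) =
      Real.pi / (2 * Complex.sin (Real.pi * h)) *
        legendreP h (4 * u * u' / ((u + u') ^ 2 - v ^ 2)) := fun v hv => by
    have := integral_spacelike hh0 hh1 hu (habs v hv)
    rw [Complex.ofReal_sin, Complex.ofReal_mul] at this
    exact this
  obtain ⟨C, hC⟩ := exists_norm_legendreP_le ‖(1 - h : ℂ)‖ (κ₀ := 4 * u * u' / (u + u') ^ 2)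
    (by positivity)
  obtain ⟨M, hM⟩ := isCompact_Icc.exists_bound_of_continuousOn hg
  have hΦi : Integrable Φ ((volume.restrict (Ioo 0 u')).prod
      (volume.restrict (Ioo 0 (u' - u)))) := by
    rw [integrable_prod_iff' hΦm]
    constructor
    · filter_upwards [ae_restrict_mem measurableSet_Ioo] with v hv
      rw [hslice v hv, integrable_indicator_iff measurableSet_Ioo, IntegrableOn,
        Measure.restrict_restrict measurableSet_Ioo, inter_comm, hsub v hv]
      exact (hAi v hv).ofReal.mul_const _
    · refine Integrable.mono' (g := fun _ => ‖(Real.pi / (2 * Complex.sin (Real.pi * h)) : ℂ)‖ *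
        C * M) (integrable_const _) hΦm.norm.prod_swap.integral_prod_right' ?_
      filter_upwards [ae_restrict_mem measurableSet_Ioo] with v hv
      have e1 : ∫ t in Ioo 0 u', ‖Φ (t, v)‖ = (∫ t in Ioo (v + u) u', A t v) * ‖g v‖ := by
        have h1 : ∀ t, ‖Φ (t, v)‖ = (Ioo (v + u) u').indicator (fun t => A t v * ‖g v‖) t := by
          intro t
          rw [congrFun (hslice v hv) t]
          by_cases ht : t ∈ Ioo (v + u) u'
          · rw [indicator_of_mem ht, indicator_of_mem ht, norm_mul,
              Complex.norm_of_nonneg (hA0 v hv t ht)]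
          · rw [indicator_of_notMem ht, indicator_of_notMem ht, norm_zero]
        simp_rw [h1]
        rw [setIntegral_indicator measurableSet_Ioo, hsub v hv, integral_mul_const]
      have hT0 : 0 ≤ ∫ t in Ioo (v + u) u', A t v :=
        setIntegral_nonneg measurableSet_Ioo (hA0 v hv)
      have hTC : (∫ t in Ioo (v + u) u', A t v) ≤
          ‖(Real.pi / (2 * Complex.sin (Real.pi * h)) : ℂ)‖ * C := by
        rw [← Complex.norm_of_nonneg hT0, hT v hv, norm_mul]
        exact mul_le_mul_of_nonneg_left (hC _ le_rfl _ (spacelike_parameter_mem hu (habs v hv)))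
          (norm_nonneg _)
      rw [e1, norm_mul, norm_norm, Real.norm_of_nonneg hT0]
      exact mul_le_mul hTC (hM v ⟨hv.1.le, by linarith [hv.2]⟩) (norm_nonneg _) (hT0.trans hTC)
  have hinner : ∀ t ∈ Ioo 0 u', smearWeight h u' t * ∫ y in Ioo 0 t, jumpKernel h u (t - y) * g y =
      ∫ v in Ioo 0 (u' - u), Φ (t, v) := by
    intro t ht
    rw [integral_jumpKernel_mul hu.le, ← integral_const_mul]
    have h1 : (fun v => Φ (t, v)) = (Iio (t - u)).indicator fun v => (A t v : ℂ) * g v := by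
      funext v
      simp only [hΦ, indicator, hS, mem_ofPred_eq, mem_Iio, lt_sub_iff_add_lt, ht.2, and_true]
    rw [h1, setIntegral_indicator measurableSet_Iio]
    have h2 : Ioo 0 (u' - u) ∩ Iio (t - u) = Ioo 0 (t - u) := by
      ext v
      constructor
      · exact fun h => ⟨h.1.1, h.2⟩
      · exact fun h => ⟨⟨h.1, by linarith [h.2, ht.2]⟩, h.2⟩
    rw [h2]
    refine setIntegral_congr_fun measurableSet_Ioo fun v _ => ?_
    dsimp only [A]
    rw [smearWeight_ofReal ⟨by linarith [ht.1], ht.2⟩]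
    push_cast
    ring
  refine ⟨(hΦi.integral_prod_left).congr ?_, ?_⟩
  · filter_upwards [ae_restrict_mem measurableSet_Ioo] with t ht
    exact (hinner t ht).symm
  · rw [setIntegral_congr_fun measurableSet_Ioo hinner,
      integral_integral_swap (f := fun t v => Φ (t, v)) hΦi, ← integral_const_mul]
    refine setIntegral_congr_fun measurableSet_Ioo fun v hv => ?_
    rw [hslice v hv, setIntegral_indicator measurableSet_Ioo, hsub v hv, integral_mul_const,
      integral_complex_ofReal, hT v hv]
    ring

theorem integrableOn_Ioo_neg_self {E : Type*} [NormedAddCommGroup E] {F : ℝ → E} {a : ℝ}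
    (h1 : IntegrableOn F (Ioo 0 a))
    (h2 : IntegrableOn (fun t => F (-t)) (Ioo 0 a)) (ha : 0 < a) : IntegrableOn F (Ioo (-a) a) := by
  rw [← Ioc_union_Ioo_eq_Ioo (show -a ≤ 0 by linarith) ha]
  refine IntegrableOn.union ((integrableOn_Ioc_iff_integrableOn_Ioo).2 ?_) h1
  have := h2.comp_neg
  simpa using this

section Symmetric

variable {E : Type*} [NormedAddCommGroup E] [NormedSpace ℝ E] {F : ℝ → E} {a : ℝ}

theorem setIntegral_Ioo_neg_left (ha : 0 ≤ a) : ∫ t in Ioo (-a) 0, F t = ∫ t in Ioo 0 a, F (-t) := by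
  rw [← integral_Ioc_eq_integral_Ioo, ← integral_Ioc_eq_integral_Ioo,
    ← intervalIntegral.integral_of_le (by linarith), ← intervalIntegral.integral_of_le ha,
    intervalIntegral.integral_comp_neg, neg_zero]

theorem setIntegral_Ioo_neg_self (h : IntegrableOn F (Ioo (-a) a)) (ha : 0 < a) :
    ∫ t in Ioo (-a) a, F t = (∫ t in Ioo 0 a, F t) + ∫ t in Ioo 0 a, F (-t) := by
  have hun := Ioc_union_Ioo_eq_Ioo (show -a ≤ 0 by linarith) ha
  rw [← setIntegral_Ioo_neg_left ha.le, ← hun, setIntegral_union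
    (Set.disjoint_left.2 fun t h1 h2 => absurd h1.2 (not_le.2 h2.1)) measurableSet_Ioo
    (h.mono_set (hun ▸ subset_union_left)) (h.mono_set (hun ▸ subset_union_right)),
    integral_Ioc_eq_integral_Ioo, add_comm]

end Symmetric

theorem smearWeight_neg (h : ℂ) (u' t : ℝ) : smearWeight h u' (-t) = smearWeight h u' t := by
  rw [smearWeight, smearWeight, neg_sq]

theorem jumpKernel_neg (h u s : ℝ) : jumpKernel h u (-s) = jumpKernel h u s := by
  rw [jumpKernel, jumpKernel, neg_sq, abs_neg]

theorem measurable_legendreP (h : ℂ) : Measurable (legendreP h) := by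
  refine Measurable.mul ?_ ?_
  · exact Complex.measurable_ofReal.pow_const _
  · rw [ordinaryHypergeometric_eq_tsum]
    exact Measurable.tsum fun n => by fun_prop

theorem integrableOn_legendreP_mul {h : ℂ} {u u' : ℝ} (hu : 0 < u) (hu' : 0 < u') {g : ℝ → ℂ}
    (hg : ContinuousOn g (Icc (-u') u')) :
    IntegrableOn (fun v => legendreP h (4 * u * u' / ((u + u') ^ 2 - v ^ 2)) * g v)
      (Ioo (-(u' - u)) (u' - u)) := by
  obtain ⟨C, hC⟩ := exists_norm_legendreP_le ‖1 - h‖ (κ₀ := 4 * u * u' / (u + u') ^ 2)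
    (by positivity)
  obtain ⟨M, hM⟩ := isCompact_Icc.exists_bound_of_continuousOn hg
  have hsub : Ioo (-(u' - u)) (u' - u) ⊆ Icc (-u') u' := fun v hv =>
    ⟨by linarith [hv.1], by linarith [hv.2]⟩
  refine Integrable.mono' (g := fun _ => C * M) (integrable_const _)
    (((measurable_legendreP h).comp (by fun_prop)).aestronglyMeasurable.mul
      ((hg.mono hsub).aestronglyMeasurable measurableSet_Ioo)) ?_
  filter_upwards [ae_restrict_mem measurableSet_Ioo] with v hv
  have h1 := hC h le_rfl _ (spacelike_parameter_mem hu (abs_lt.2 hv))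
  rw [norm_mul]
  exact mul_le_mul h1 (hM v (hsub hv)) (norm_nonneg _) ((norm_nonneg _).trans h1)

/-- The half t < 0 is the mirror image of t > 0, with g reflected. If u > u' the jump is never
reached, since |t - y| ≤ |t| < u', and the interval on the right is empty. -/
theorem smearWeight_jump_fubini_symm {h u u' : ℝ} (hh0 : 0 < h) (hh1 : h < 1) (hu : 0 < u)
    (hu' : 0 < u') (hne : u ≠ u') {g : ℝ → ℂ} (hg : ContinuousOn g (Icc (-u') u')) :
    IntegrableOn (fun t => smearWeight h u' t * ∫ y in uIoc 0 t, jumpKernel h u (t - y) * g y)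
      (Ioo (-u') u') ∧
    ∫ t in Ioo (-u') u', smearWeight h u' t * ∫ y in uIoc 0 t, jumpKernel h u (t - y) * g y =
      Real.pi / (2 * Complex.sin (Real.pi * h)) * ∫ v in Ioo (-(u' - u)) (u' - u),
        legendreP h (4 * u * u' / ((u + u') ^ 2 - v ^ 2)) * g v := by
  rcases lt_or_gt_of_ne hne with huu' | huu'
  · have hgn : ContinuousOn (fun y => g (-y)) (Icc 0 u') :=
      hg.comp (by fun_prop) fun y hy => ⟨by linarith [hy.2], by linarith [hy.1]⟩
    obtain ⟨p1, p2⟩ := smearWeight_jump_fubini hh0 hh1 hu huu'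
      (hg.mono (Icc_subset_Icc_left (by linarith)))
    obtain ⟨n1, n2⟩ := smearWeight_jump_fubini hh0 hh1 hu huu' hgn
    set B : ℝ → ℂ := fun t => smearWeight h u' t * ∫ y in uIoc 0 t, jumpKernel h u (t - y) * g y
    have hBp : ∀ t ∈ Ioo 0 u', B t = smearWeight h u' t *
        ∫ y in Ioo 0 t, jumpKernel h u (t - y) * g y := fun t ht => by
      dsimp only [B]
      rw [uIoc_of_le ht.1.le, integral_Ioc_eq_integral_Ioo]
    have hBn : ∀ t ∈ Ioo 0 u', B (-t) = smearWeight h u' t *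
        ∫ y in Ioo 0 t, jumpKernel h u (t - y) * g (-y) := fun t ht => by
      dsimp only [B]
      rw [uIoc_of_ge (by linarith [ht.1]), integral_Ioc_eq_integral_Ioo,
        setIntegral_Ioo_neg_left ht.1.le, smearWeight_neg]
      congr 2
      funext y
      rw [← jumpKernel_neg]
      congr 3; ring
    have hB : IntegrableOn B (Ioo (-u') u') := integrableOn_Ioo_neg_self
      (p1.congr_fun (fun t ht => (hBp t ht).symm) measurableSet_Ioo)
      (n1.congr_fun (fun t ht => (hBn t ht).symm) measurableSet_Ioo) hu'
    refine ⟨hB, ?_⟩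
    rw [setIntegral_Ioo_neg_self hB hu', setIntegral_congr_fun measurableSet_Ioo hBp,
      setIntegral_congr_fun measurableSet_Ioo hBn, p2, n2,
      setIntegral_Ioo_neg_self (integrableOn_legendreP_mul hu hu' hg) (by linarith)]
    simp only [neg_sq]
    ring
  · have hz : ∀ t ∈ Ioo (-u') u', smearWeight h u' t *
        ∫ y in uIoc 0 t, jumpKernel h u (t - y) * g y = 0 := by
      intro t ht
      have : ∀ y ∈ uIoc 0 t, jumpKernel h u (t - y) * g y = 0 := fun y hy => by
        rw [jumpKernel_eq_zero, Complex.ofReal_zero, zero_mul]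
        have hy' := uIoc_subset_uIcc hy
        rw [mem_uIcc] at hy'
        rw [abs_le]
        rcases hy' with h1 | h1 <;> constructor <;> linarith [h1.1, h1.2, ht.1, ht.2]
      rw [setIntegral_congr_fun measurableSet_uIoc this, integral_zero, mul_zero]
    constructor
    · exact (integrableOn_zero).congr_fun (fun t ht => (hz t ht).symm) measurableSet_Ioo
    · rw [setIntegral_congr_fun measurableSet_Ioo hz, Ioo_eq_empty (a := -(u' - u)) (by linarith)]
      simp

/-- The bound on the kernel does not depend on x, so the integrations can be exchanged; for x ≠ 0
the t-integral is `integral_smearWeight_mul_kernel`. -/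
theorem smearWeight_kernel_fubini {h u u' ε : ℝ} (hh0 : 0 < h) (hh1 : h < 1) (hu : 0 < u)
    (hu' : 0 < u') (hne : u ≠ u') (hε : 0 < ε) {g : ℝ → ℂ} (hg : ContinuousOn g (Icc (-ε) ε)) :
    IntegrableOn (fun t => smearWeight h u' t * ∫ x in -ε..ε, kernel h u (x - t * Complex.I) * g x)
      (Ioo (-u') u') ∧
    ∫ t in Ioo (-u') u', smearWeight h u' t * ∫ x in -ε..ε, kernel h u (x - t * Complex.I) * g x =
      1 / 2 * ∫ x in -ε..ε, legendreQ h (2 * u * u' / (u ^ 2 + u' ^ 2 + x ^ 2)) * g x := by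
  obtain ⟨M, hM⟩ := isCompact_Icc.exists_bound_of_continuousOn hg
  set Φ : ℝ × ℝ → ℂ := fun p => smearWeight h u' p.1 * (kernel h u (p.2 - p.1 * Complex.I) * g p.2)
  have hΦi : Integrable Φ ((volume.restrict (Ioo (-u') u')).prod (volume.restrict (Ioc (-ε) ε))) := by
    refine Integrable.mono' ((integrableOn_smearWeight_mul_bound hh0 hh1 hu hu' hne).mul_prod
      (integrable_const M)) ?_ ?_
    · refine AEStronglyMeasurable.mul (Measurable.aestronglyMeasurable
        ((Complex.measurable_ofReal.comp (by fun_prop)).pow_const _)) (AEStronglyMeasurable.mul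
        ((measurable_kernel h u).comp (by fun_prop)).aestronglyMeasurable
        (AEStronglyMeasurable.comp_snd ?_))
      exact (hg.mono Ioc_subset_Icc_self).aestronglyMeasurable measurableSet_Ioc
    · rw [Measure.prod_restrict]
      have h1 : ∀ᵐ p : ℝ × ℝ ∂((volume.prod volume).restrict (Ioo (-u') u' ×ˢ Ioc (-ε) ε)),
          |p.1| ≠ u := ae_restrict_of_ae (Measure.quasiMeasurePreserving_fst.ae (ae_abs_ne hu))
      filter_upwards [ae_restrict_mem (measurableSet_Ioo.prod measurableSet_Ioc), h1] with p hp hpu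
      have h0 : 0 < u' ^ 2 - p.1 ^ 2 := by nlinarith [hp.1.1, hp.1.2]
      have h2 := norm_kernel_le (y := -p.1) (x := p.2) hh0.le hu (by rwa [abs_neg])
      rw [neg_sq] at h2
      dsimp only [Φ]
      rw [norm_mul, norm_mul, smearWeight_ofReal hp.1, Complex.norm_of_nonneg (by positivity), mul_assoc]
      refine mul_le_mul_of_nonneg_left (mul_le_mul ?_ (hM _ (Ioc_subset_Icc_self hp.2))
        (norm_nonneg _) (by positivity)) (by positivity)
      have e : (p.2 - p.1 * Complex.I : ℂ) = p.2 + (-p.1 : ℝ) * Complex.I := by push_cast; ring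
      rwa [e]
  have hinner : ∀ t, smearWeight h u' t * (∫ x in -ε..ε, kernel h u (x - t * Complex.I) * g x) =
      ∫ x in Ioc (-ε) ε, Φ (t, x) := fun t => by
    rw [intervalIntegral.integral_of_le (by linarith), ← integral_const_mul]
  simp_rw [hinner]
  refine ⟨hΦi.integral_prod_left, ?_⟩
  rw [integral_integral_swap (f := fun t x => Φ (t, x)) hΦi,
    intervalIntegral.integral_of_le (by linarith), ← integral_const_mul]
  refine setIntegral_congr_ae measurableSet_Ioc ?_
  filter_upwards [compl_mem_ae_iff.2 (measure_singleton (0 : ℝ))] with x hx _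
  have := integral_smearWeight_mul_kernel hh0 hu hu' (D := x) hx
  simp only [Φ, ← mul_assoc]
  rw [integral_mul_const, this]

/-- The factor 2 sin(πh) of the jump cancels against π / (2 sin(πh)) from the Euler integral and
leaves π. -/
theorem integral_smearWeight_bump_of_lt_one {h u u' ε : ℝ} (hh0 : 0 < h) (hh1 : h < 1) (hu : 0 < u)
    (hu' : 0 < u') (hne : u ≠ u') (hε : 0 < ε) {g : ℂ → ℂ}
    (hg : DifferentiableOn ℂ g (uIcc (-ε) ε ×ℂ uIcc (-u') u')) :
    ∫ t in Ioo (-u') u', smearWeight h u' t * bumpIntegral 0 ε (t * Complex.I)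
        (fun ζ => kernel h u (ζ - t * Complex.I) * g ζ) =
      1 / 2 * (∫ x in -ε..ε, legendreQ h (2 * u * u' / (u ^ 2 + u' ^ 2 + x ^ 2)) * g x) +
        Real.pi * ∫ v in Ioo (-(u' - u)) (u' - u),
          legendreP h (4 * u * u' / ((u + u') ^ 2 - v ^ 2)) * g (v * Complex.I) := by
  have hmem : ∀ {x y : ℝ}, x ∈ Icc (-ε) ε → y ∈ Icc (-u') u' →
      (x : ℂ) + y * Complex.I ∈ uIcc (-ε) ε ×ℂ uIcc (-u') u' := fun hx hy => by
    rw [Complex.mem_reProdIm, uIcc_of_le (by linarith), uIcc_of_le (by linarith)]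
    simpa using ⟨hx, hy⟩
  obtain ⟨a1, a2⟩ := smearWeight_kernel_fubini hh0 hh1 hu hu' hne hε (g := fun x => g x)
    (hg.continuousOn.comp (by fun_prop) fun x hx => by
      simpa using hmem hx (show (0 : ℝ) ∈ Icc (-u') u' from ⟨by linarith, hu'.le⟩))
  obtain ⟨b1, b2⟩ := smearWeight_jump_fubini_symm hh0 hh1 hu hu' hne (g := fun y => g (y * Complex.I))
    (hg.continuousOn.comp (by fun_prop) fun y hy => by
      simpa using hmem (show (0 : ℝ) ∈ Icc (-ε) ε from ⟨by linarith, hε.le⟩) hy)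
  have key : ∀ᵐ t : ℝ, t ∈ Ioo (-u') u' → smearWeight h u' t * bumpIntegral 0 ε (t * Complex.I)
        (fun ζ => kernel h u (ζ - t * Complex.I) * g ζ) =
      smearWeight h u' t * (∫ x in -ε..ε, kernel h u (x - t * Complex.I) * g x) +
      2 * Complex.sin (Real.pi * h) * (smearWeight h u' t *
        ∫ y in uIoc 0 t, jumpKernel h u (t - y) * g (y * Complex.I)) := by
    filter_upwards [ae_abs_ne hu] with t ht htu
    rw [bumpIntegral_kernel_eq hh0 hh1 hu hε ht (hg.mono fun ζ hζ => ?_)]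
    · ring
    · rw [Complex.mem_reProdIm] at hζ ⊢
      refine ⟨hζ.1, uIcc_subset_uIcc ?_ ?_ hζ.2⟩
      · rw [uIcc_of_le (by linarith)]; exact ⟨by linarith, hu'.le⟩
      · rw [uIcc_of_le (by linarith)]; exact ⟨htu.1.le, htu.2.le⟩
  have hsin : Complex.sin (Real.pi * h) ≠ 0 := by
    have : 0 < Real.sin (Real.pi * h) := Real.sin_pos_of_pos_of_lt_pi (by positivity)
      (by nlinarith [Real.pi_pos])
    rw [← Complex.ofReal_mul, ← Complex.ofReal_sin]
    exact Complex.ofReal_ne_zero.2 this.ne'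
  rw [setIntegral_congr_ae measurableSet_Ioo key, integral_add a1 (b1.const_mul _),
    integral_const_mul, a2, b2, ← mul_assoc]
  congr 2
  field_simp

/-! ### Removing the restriction h < 1 by continuation in the weight. -/

theorem measurable_legendreQ (h : ℂ) : Measurable (legendreQ h) := by
  have : StronglyMeasurable (fun p : ℝ × ℝ =>
      ((p.1 / (1 + √(1 - p.1 ^ 2) * Real.cosh p.2) : ℝ) : ℂ) ^ h) := by
    refine Measurable.stronglyMeasurable (Measurable.pow_const (Complex.measurable_ofReal.comp ?_) _)
    exact measurable_fst.div ((((by fun_prop : Measurable fun p : ℝ × ℝ => 1 - p.1 ^ 2).sqrt).mul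
      (Real.continuous_cosh.measurable.comp measurable_snd)).const_add _)
  exact this.integral_prod_right'.measurable

theorem legendreQ_base_le_one {ξ θ : ℝ} (hξ1 : ξ < 1) :
    ξ / (1 + √(1 - ξ ^ 2) * Real.cosh θ) ≤ 1 := by
  have := Real.cosh_pos θ
  rw [div_le_one (by positivity)]
  nlinarith [mul_nonneg (Real.sqrt_nonneg (1 - ξ ^ 2)) this.le]

theorem norm_legendreQ_integrand_le {a ξ ξ₁ : ℝ} {h : ℂ} (ha : 0 < a) (hah : a ≤ h.re) (hξ0 : 0 < ξ)
    (hξ : ξ ≤ ξ₁) (hξ1 : ξ₁ < 1) (θ : ℝ) :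
    ‖((ξ / (1 + √(1 - ξ ^ 2) * Real.cosh θ) : ℝ) : ℂ) ^ h‖ ≤
      (2 / √(1 - ξ₁ ^ 2)) ^ a * Real.exp (-a * |θ|) := by
  have hb := legendreQ_base_pos (θ := θ) hξ0
  have hρ1 : 0 < √(1 - ξ₁ ^ 2) := Real.sqrt_pos.2 (by nlinarith)
  rw [Complex.norm_cpow_eq_rpow_re_of_pos hb, ← exp_neg_abs_rpow,
    ← Real.mul_rpow (by positivity) (by positivity)]
  refine (Real.rpow_le_rpow_of_exponent_ge hb (legendreQ_base_le_one (hξ.trans_lt hξ1)) hah).trans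
    (Real.rpow_le_rpow hb.le ((legendreQ_base_le hξ0 (hξ.trans_lt hξ1)).trans ?_) ha.le)
  gcongr

theorem norm_legendreQ_le {a ξ ξ₁ : ℝ} {h : ℂ} (ha : 0 < a) (hah : a ≤ h.re) (hξ0 : 0 < ξ)
    (hξ : ξ ≤ ξ₁) (hξ1 : ξ₁ < 1) :
    ‖legendreQ h ξ‖ ≤ ∫ θ : ℝ, (2 / √(1 - ξ₁ ^ 2)) ^ a * Real.exp (-a * |θ|) :=
  norm_integral_le_of_norm_le ((integrable_exp_neg_mul_abs ha).const_mul _)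
    (ae_of_all _ (norm_legendreQ_integrand_le ha hah hξ0 hξ hξ1))

theorem isOpen_re_pos : IsOpen {h : ℂ | 0 < h.re} := isOpen_lt continuous_const Complex.continuous_re

theorem re_mem_of_mem_ball {h h₀ : ℂ} (hh : h ∈ Metric.ball h₀ (h₀.re / 2)) :
    h₀.re / 2 ≤ h.re ∧ h.re ≤ 3 * h₀.re / 2 := by
  have h1 : |(h - h₀).re| < h₀.re / 2 :=
    (Complex.abs_re_le_norm _).trans_lt (by simpa [dist_eq_norm] using hh)
  rw [Complex.sub_re, abs_lt] at h1
  constructor <;> linarith [h1.1, h1.2]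

theorem differentiableOn_legendreQ {ξ : ℝ} (hξ0 : 0 < ξ) (hξ1 : ξ < 1) :
    DifferentiableOn ℂ (fun h => legendreQ h ξ) {h | 0 < h.re} := by
  refine differentiableOn_integral isOpen_re_pos (fun h _ => ?_) (ae_of_all _ fun θ => ?_)
    fun h₀ hh₀ => ?_
  · exact ((Complex.measurable_ofReal.comp (measurable_legendreQ_base ξ)).pow_const _).aestronglyMeasurable
  · exact (differentiable_id.const_cpow (Or.inl (Complex.ofReal_ne_zero.2
      (legendreQ_base_pos hξ0).ne'))).differentiableOn
  · have h0 : 0 < h₀.re / 2 := half_pos hh₀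
    exact ⟨_, Metric.ball_mem_nhds _ h0, _, (integrable_exp_neg_mul_abs h0).const_mul _,
      ae_of_all _ fun θ h hh => norm_legendreQ_integrand_le h0 (re_mem_of_mem_ball hh).1 hξ0 le_rfl
        hξ1 θ⟩

theorem xi_le_of_ne {u u' : ℝ} (hu : 0 < u) (hu' : 0 < u') (x : ℝ) :
    0 < 2 * u * u' / (u ^ 2 + u' ^ 2 + x ^ 2) ∧
      2 * u * u' / (u ^ 2 + u' ^ 2 + x ^ 2) ≤ 2 * u * u' / (u ^ 2 + u' ^ 2) := by
  refine ⟨by positivity, div_le_div_of_nonneg_left (by positivity) (by positivity) ?_⟩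
  linarith [sq_nonneg x]

theorem xi_lt_one_of_ne {u u' : ℝ} (hu : 0 < u) (hu' : 0 < u') (hne : u ≠ u') :
    2 * u * u' / (u ^ 2 + u' ^ 2) < 1 := by
  rw [div_lt_one (by positivity)]
  nlinarith [sq_pos_of_ne_zero (sub_ne_zero.2 hne)]

theorem differentiableOn_integral_legendreQ {u u' ε : ℝ} (hu : 0 < u) (hu' : 0 < u') (hne : u ≠ u')
    (hε : 0 < ε) {g : ℝ → ℂ} (hg : ContinuousOn g (Icc (-ε) ε)) :
    DifferentiableOn ℂ (fun h => ∫ x in -ε..ε,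
      legendreQ h (2 * u * u' / (u ^ 2 + u' ^ 2 + x ^ 2)) * g x) {h | 0 < h.re} := by
  simp_rw [intervalIntegral.integral_of_le (show -ε ≤ ε by linarith)]
  have hgm := (hg.mono Ioc_subset_Icc_self).aestronglyMeasurable measurableSet_Ioc (μ := volume)
  obtain ⟨M, hM⟩ := isCompact_Icc.exists_bound_of_continuousOn hg
  have h1 := xi_lt_one_of_ne hu hu' hne
  refine differentiableOn_integral isOpen_re_pos (fun h _ => ?_) (ae_of_all _ fun x => ?_)
    fun h₀ hh₀ => ?_
  · exact ((measurable_legendreQ h).comp (by fun_prop)).aestronglyMeasurable.mul hgm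
  · obtain ⟨h2, h3⟩ := xi_le_of_ne hu hu' x
    exact (differentiableOn_legendreQ h2 (h3.trans_lt h1)).mul_const _
  · have h0 : 0 < h₀.re / 2 := half_pos hh₀
    obtain ⟨C, hC⟩ : ∃ C, ∀ h ∈ Metric.ball h₀ (h₀.re / 2), ∀ x : ℝ,
        ‖legendreQ h (2 * u * u' / (u ^ 2 + u' ^ 2 + x ^ 2))‖ ≤ C := ⟨_, fun h hh x =>
      norm_legendreQ_le h0 (re_mem_of_mem_ball hh).1 (xi_le_of_ne hu hu' x).1
        (xi_le_of_ne hu hu' x).2 h1⟩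
    refine ⟨_, Metric.ball_mem_nhds _ h0, fun _ => C * M, integrable_const _, ?_⟩
    filter_upwards [ae_restrict_mem measurableSet_Ioc] with x hx h hh
    have h4 := hC h hh x
    rw [norm_mul]
    exact mul_le_mul h4 (hM x (Ioc_subset_Icc_self hx)) (norm_nonneg _) ((norm_nonneg _).trans h4)

theorem differentiable_integral_legendreP {u u' : ℝ} (hu : 0 < u) (hu' : 0 < u')
    {g : ℝ → ℂ} (hg : ContinuousOn g (Icc (-u') u')) :
    DifferentiableOn ℂ (fun h => ∫ v in Ioo (-(u' - u)) (u' - u),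
          legendreP h (4 * u * u' / ((u + u') ^ 2 - v ^ 2)) * g v) univ := by
  obtain ⟨M, hM⟩ := isCompact_Icc.exists_bound_of_continuousOn hg
  have hsub : Ioo (-(u' - u)) (u' - u) ⊆ Icc (-u') u' := fun v hv =>
    ⟨by linarith [hv.1], by linarith [hv.2]⟩
  have hκ : 0 < 4 * u * u' / (u + u') ^ 2 := by positivity
  refine differentiableOn_integral isOpen_univ (fun h _ => ?_) ?_ fun h₀ _ => ?_
  · exact (integrableOn_legendreP_mul hu hu' hg).aestronglyMeasurable
  · filter_upwards [ae_restrict_mem measurableSet_Ioo] with v hv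
    obtain ⟨h1, h2⟩ := spacelike_parameter_mem hu (abs_lt.2 hv)
    exact ((differentiable_legendreP (hκ.trans_le h1) h2).mul_const _).differentiableOn
  · obtain ⟨C, hC⟩ := exists_norm_legendreP_le (‖1 - h₀‖ + 1) hκ
    refine ⟨_, Metric.ball_mem_nhds h₀ one_pos, fun _ => C * M, integrable_const _, ?_⟩
    filter_upwards [ae_restrict_mem measurableSet_Ioo] with v hv h hh
    have h1 := hC h (by
      rw [Metric.mem_ball, dist_eq_norm] at hh
      have := norm_sub_le (1 - h₀) (h - h₀)
      rw [sub_sub_sub_cancel_right] at this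
      have e : (1 - h) = (1 - h₀) - (h - h₀) := by ring
      rw [e]
      exact (norm_sub_le _ _).trans (by linarith)) _ (spacelike_parameter_mem hu (abs_lt.2 hv))
    rw [norm_mul]
    exact mul_le_mul h1 (hM v (hsub hv)) (norm_nonneg _) ((norm_nonneg _).trans h1)

theorem norm_smearWeight {h : ℂ} {u' t : ℝ} (ht : t ∈ Ioo (-u') u') :
    ‖smearWeight h u' t‖ = (u' / (u' ^ 2 - t ^ 2)) ^ (1 - h.re) := by
  have h0 : 0 < u' := by linarith [ht.1, ht.2]
  have h1 : 0 < u' ^ 2 - t ^ 2 := by nlinarith [ht.1, ht.2]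
  rw [smearWeight, Complex.norm_cpow_eq_rpow_re_of_pos (by positivity)]
  simp

theorem measurable_smearWeight (h : ℂ) (u' : ℝ) : Measurable (smearWeight h u') :=
  (Complex.measurable_ofReal.comp (by fun_prop)).pow_const _

/-- According to whether the base is below or above 1, one of the extreme exponents dominates. -/
theorem norm_smearWeight_le {h : ℂ} {u' t a b : ℝ} (ht : t ∈ Ioo (-u') u') (ha : a ≤ h.re)
    (hb : h.re ≤ b) :
    ‖smearWeight h u' t‖ ≤ (u' / (u' ^ 2 - t ^ 2)) ^ (1 - a) + (u' / (u' ^ 2 - t ^ 2)) ^ (1 - b) := by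
  have h0 : 0 < u' := by linarith [ht.1, ht.2]
  have h1 : 0 < u' ^ 2 - t ^ 2 := by nlinarith [ht.1, ht.2]
  rw [norm_smearWeight ht]
  have h2 : 0 < u' / (u' ^ 2 - t ^ 2) := by positivity
  rcases le_total (u' / (u' ^ 2 - t ^ 2)) 1 with h3 | h3
  · have := Real.rpow_le_rpow_of_exponent_ge h2 h3 (show 1 - b ≤ 1 - h.re by linarith)
    linarith [Real.rpow_nonneg h2.le (1 - a)]
  · have := Real.rpow_le_rpow_of_exponent_le h3 (show 1 - h.re ≤ 1 - a by linarith)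
    linarith [Real.rpow_nonneg h2.le (1 - b)]

/-- All singular behaviour in t sits in the weight, which is integrable locally uniformly on Re h >
0, while Θ is bounded for h in compact sets. Holomorphy is proved for the double integral, and
Fubini returns to the iterated one. -/
theorem smearWeight_mul_holomorphic {u' : ℝ} (hu' : 0 < u') {Θ : ℂ → ℝ × ℝ → ℂ}
    (hc : ContinuousOn (fun q : ℂ × (ℝ × ℝ) => Θ q.1 q.2) (univ ×ˢ (Icc (-u') u' ×ˢ Icc 0 1)))
    (hd : ∀ p ∈ Icc (-u') u' ×ˢ Icc (0 : ℝ) 1, Differentiable ℂ fun h => Θ h p) :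
    DifferentiableOn ℂ (fun h => ∫ t in Ioo (-u') u', smearWeight h u' t *
        ∫ s in (0 : ℝ)..1, Θ h (t, s)) {h | 0 < h.re} ∧
      ∀ h : ℂ, 0 < h.re → IntegrableOn (fun t => smearWeight h u' t * ∫ s in (0 : ℝ)..1, Θ h (t, s))
        (Ioo (-u') u') := by
  set μ : Measure (ℝ × ℝ) := (volume.restrict (Ioo (-u') u')).prod (volume.restrict (Ioc 0 1))
  have hμ : μ = (volume.prod volume).restrict (Ioo (-u') u' ×ˢ Ioc 0 1) := Measure.prod_restrict _ _
  have hsub : Ioo (-u') u' ×ˢ Ioc (0 : ℝ) 1 ⊆ Icc (-u') u' ×ˢ Icc (0 : ℝ) 1 :=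
    prod_mono Ioo_subset_Icc_self Ioc_subset_Icc_self
  have hm : ∀ h : ℂ, AEStronglyMeasurable (fun p : ℝ × ℝ => smearWeight h u' p.1 * Θ h p) μ := by
    intro h
    refine AEStronglyMeasurable.mul
      ((measurable_smearWeight h u').comp measurable_fst).aestronglyMeasurable ?_
    rw [hμ]
    have : ContinuousOn (Θ h) (Ioo (-u') u' ×ˢ Ioc (0 : ℝ) 1) :=
      hc.comp (f := fun p => (h, p)) (by fun_prop) fun p hp => ⟨mem_univ _, hsub hp⟩
    exact this.aestronglyMeasurable (measurableSet_Ioo.prod measurableSet_Ioc)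
  have hb : ∀ h₀ ∈ {h : ℂ | 0 < h.re}, ∃ s ∈ 𝓝 h₀, ∃ b : ℝ × ℝ → ℝ, Integrable b μ ∧
      ∀ᵐ p ∂μ, ∀ h ∈ s, ‖smearWeight h u' p.1 * Θ h p‖ ≤ b p := by
    intro h₀ hh₀
    have h0 : 0 < h₀.re / 2 := half_pos hh₀
    have h0' : 0 < 3 * h₀.re / 2 := by linarith
    obtain ⟨M, hM⟩ := ((isCompact_closedBall h₀ (h₀.re / 2)).prod
      (isCompact_Icc.prod isCompact_Icc)).exists_bound_of_continuousOn
      (hc.mono (prod_mono (subset_univ _) Subset.rfl))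
    refine ⟨_, Metric.ball_mem_nhds _ h0, _, ((integrableOn_smearWeight h0 hu').add
      (integrableOn_smearWeight h0' hu')).mul_prod (integrable_const M), ?_⟩
    rw [hμ]
    filter_upwards [ae_restrict_mem (measurableSet_Ioo.prod measurableSet_Ioc)] with p hp h hh
    obtain ⟨h1, h2⟩ := re_mem_of_mem_ball hh
    rw [norm_mul]
    refine mul_le_mul (norm_smearWeight_le hp.1 h1 h2)
      (hM (h, p) ⟨Metric.ball_subset_closedBall hh, hsub hp⟩) (norm_nonneg _) ?_
    exact (norm_nonneg _).trans (norm_smearWeight_le hp.1 h1 h2)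
  have hi : ∀ h : ℂ, 0 < h.re → Integrable (fun p : ℝ × ℝ => smearWeight h u' p.1 * Θ h p) μ := by
    intro h hh
    obtain ⟨s, hs, b, hbi, hbs⟩ := hb h hh
    exact hbi.mono' (hm h) (hbs.mono fun p hp => hp h (mem_of_mem_nhds hs))
  have hinner : ∀ (h : ℂ) (t : ℝ), smearWeight h u' t * (∫ s in (0 : ℝ)..1, Θ h (t, s)) =
      ∫ s in Ioc 0 1, smearWeight h u' t * Θ h (t, s) := fun h t => by
    rw [intervalIntegral.integral_of_le zero_le_one, ← integral_const_mul]
  have hdiff := differentiableOn_integral isOpen_re_pos (fun h _ => hm h)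
    (by
      rw [hμ]
      filter_upwards [ae_restrict_mem (measurableSet_Ioo.prod measurableSet_Ioc)] with p hp
      refine DifferentiableOn.mul ?_ (hd p (hsub hp)).differentiableOn
      have h1 : 0 < u' ^ 2 - p.1 ^ 2 := by nlinarith [hp.1.1, hp.1.2]
      exact (Differentiable.const_cpow (by fun_prop) (Or.inl (Complex.ofReal_ne_zero.2
        (div_pos hu' h1).ne'))).differentiableOn) hb
  constructor
  · refine hdiff.congr fun h hh => ?_
    simp_rw [hinner]
    exact (integral_prod _ (hi h hh)).symm
  · intro h hh
    simp_rw [hinner]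
    exact (hi h hh).integral_prod_left

theorem sq_add_sq_mem_slitPlane {u : ℝ} (hu : 0 < u) {ζ : ℂ} (hζ : ζ.re ≠ 0 ∨ ζ.im = 0) :
    (u : ℂ) ^ 2 + ζ ^ 2 ∈ Complex.slitPlane := by
  by_cases h : ζ.re = 0
  · have h1 : ζ = 0 := Complex.ext h (hζ.resolve_left (not_not.2 h))
    rw [h1, zero_pow two_ne_zero, add_zero, ← Complex.ofReal_pow]
    exact Complex.ofReal_mem_slitPlane.2 (by positivity)
  · exact sq_add_sq_mem_slitPlane_of_re_ne_zero u h

/-- The integrand of `kernel h u (ζ - t i) * g ζ` along the segment from `a t` to `a t + d t`. -/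
noncomputable def legDensity (u : ℝ) (g : ℂ → ℂ) (a d : ℝ → ℂ) (h : ℂ) (p : ℝ × ℝ) : ℂ :=
  d p.1 * (kernel h u (a p.1 + p.2 * d p.1 - p.1 * Complex.I) * g (a p.1 + p.2 * d p.1))

theorem legDensity_regular {u : ℝ} (hu : 0 < u) {g : ℂ → ℂ} {a d : ℝ → ℂ} (ha : Continuous a)
    (hd : Continuous d) {K : Set (ℝ × ℝ)} {R : Set ℂ} (hg : ContinuousOn g R)
    (hR : ∀ p ∈ K, a p.1 + p.2 * d p.1 ∈ R)
    (hs : ∀ p ∈ K, (a p.1 + p.2 * d p.1 - p.1 * Complex.I).re ≠ 0 ∨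
      (a p.1 + p.2 * d p.1 - p.1 * Complex.I).im = 0) :
    ContinuousOn (fun q : ℂ × (ℝ × ℝ) => legDensity u g a d q.1 q.2) (univ ×ˢ K) ∧
      ∀ p ∈ K, Differentiable ℂ fun h => legDensity u g a d h p := by
  constructor
  · refine ContinuousOn.mul (by fun_prop) (ContinuousOn.mul (ContinuousOn.cpow
      (ContinuousOn.div (by fun_prop) (by fun_prop) ?_) continuousOn_fst ?_) ?_)
    · exact fun q hq => Complex.slitPlane_ne_zero (sq_add_sq_mem_slitPlane hu (hs _ hq.2))
    · exact fun q hq => ofReal_div_mem_slitPlane hu (sq_add_sq_mem_slitPlane hu (hs _ hq.2))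
    · exact hg.comp (f := fun q : ℂ × (ℝ × ℝ) => a q.2.1 + q.2.2 * d q.2.1) (by fun_prop)
        fun q hq => hR _ hq.2
  · intro p hp
    refine (Differentiable.mul_const ?_ _).const_mul _
    exact differentiable_id.const_cpow (Or.inl (Complex.slitPlane_ne_zero
      (ofReal_div_mem_slitPlane hu (sq_add_sq_mem_slitPlane hu (hs _ hp)))))

/-- The integrand of `bumpIntegral`, with all three segments parametrised by the unit interval. -/
noncomputable def bumpDensity (u ε : ℝ) (g : ℂ → ℂ) (h : ℂ) (p : ℝ × ℝ) : ℂ :=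
  legDensity u g (fun _ => -ε) (fun t => t * Complex.I) h p +
    legDensity u g (fun t => t * Complex.I - ε) (fun _ => 2 * ε) h p +
    legDensity u g (fun t => t * Complex.I + ε) (fun t => -(t * Complex.I)) h p

section Bump

variable {u u' ε : ℝ} {g : ℂ → ℂ}

/-- On the vertical sides ζ - w has real part ±ε and on the horizontal side it is real, so the
contour avoids the cut of the kernel. Unlike its collapsed form, the bump therefore makes sense for
every h. -/
theorem bumpDensity_regular (hu : 0 < u) (hu' : 0 < u') (hε : 0 < ε)
    (hg : ContinuousOn g (uIcc (-ε) ε ×ℂ uIcc (-u') u')) :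
    ContinuousOn (fun q : ℂ × (ℝ × ℝ) => bumpDensity u ε g q.1 q.2)
      (univ ×ˢ (Icc (-u') u' ×ˢ Icc 0 1)) ∧
    (∀ p ∈ Icc (-u') u' ×ˢ Icc (0 : ℝ) 1, Differentiable ℂ fun h => bumpDensity u ε g h p) ∧
    ∀ h : ℂ, ∀ t ∈ Icc (-u') u', bumpIntegral 0 ε (t * Complex.I)
        (fun ζ => kernel h u (ζ - t * Complex.I) * g ζ) =
      ∫ s in (0 : ℝ)..1, bumpDensity u ε g h (t, s) := by
  have hbd : ∀ {t s : ℝ}, t ∈ Icc (-u') u' → s ∈ Icc (0 : ℝ) 1 → s * t ∈ Icc (-u') u' := by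
    intro t s ht hs
    rw [mem_Icc, ← abs_le] at ht ⊢
    rw [abs_mul, abs_of_nonneg hs.1]
    exact (mul_le_of_le_one_left (abs_nonneg t) hs.2).trans ht
  obtain ⟨c1, d1⟩ := legDensity_regular (K := Icc (-u') u' ×ˢ Icc (0 : ℝ) 1) hu
    (a := fun _ => -ε) (d := fun t => t * Complex.I) (by fun_prop) (by fun_prop) hg
    (by
      rintro ⟨t, s⟩ ⟨ht, hs⟩
      rw [Complex.mem_reProdIm, uIcc_of_le (by linarith), uIcc_of_le (by linarith)]
      have := hbd ht hs
      simp at this ht hs ⊢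
      exact ⟨by linarith, this⟩)
    (by
      rintro ⟨t, s⟩ ⟨ht, hs⟩
      left; simpa using hε.ne')
  obtain ⟨c2, d2⟩ := legDensity_regular (K := Icc (-u') u' ×ˢ Icc (0 : ℝ) 1) hu
    (a := fun t => t * Complex.I - ε) (d := fun _ => 2 * ε) (by fun_prop) (by fun_prop) hg
    (by
      rintro ⟨t, s⟩ ⟨ht, hs⟩
      rw [Complex.mem_reProdIm, uIcc_of_le (by linarith), uIcc_of_le (by linarith)]
      simp at ht hs ⊢
      exact ⟨⟨by nlinarith, by nlinarith⟩, ht⟩)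
    (by
      rintro ⟨t, s⟩ ⟨ht, hs⟩
      right; simp)
  obtain ⟨c3, d3⟩ := legDensity_regular (K := Icc (-u') u' ×ˢ Icc (0 : ℝ) 1) hu
    (a := fun t => t * Complex.I + ε) (d := fun t => -(t * Complex.I)) (by fun_prop) (by fun_prop) hg
    (by
      rintro ⟨t, s⟩ ⟨ht, hs⟩
      rw [Complex.mem_reProdIm, uIcc_of_le (by linarith), uIcc_of_le (by linarith)]
      have := hbd (s := 1 - s) ht ⟨by linarith [hs.2], by linarith [hs.1]⟩
      simp at this ht hs ⊢
      exact ⟨by linarith, by linarith, by linarith⟩)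
    (by
      rintro ⟨t, s⟩ ⟨ht, hs⟩
      left; simpa using hε.ne')
  refine ⟨(c1.add c2).add c3, fun p hp => ((d1 p hp).add (d2 p hp)).add (d3 p hp), fun h t ht => ?_⟩
  have hi : ∀ {Θ : ℂ → ℝ × ℝ → ℂ}, ContinuousOn (fun q : ℂ × (ℝ × ℝ) => Θ q.1 q.2)
      (univ ×ˢ (Icc (-u') u' ×ˢ Icc 0 1)) →
      IntervalIntegrable (fun s => Θ h (t, s)) volume 0 1 := fun hΘ => by
    refine ContinuousOn.intervalIntegrable ?_
    rw [uIcc_of_le zero_le_one]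
    exact hΘ.comp (f := fun s : ℝ => (h, (t, s))) (by fun_prop) fun s hs => ⟨mem_univ _, ht, hs⟩
  unfold bumpDensity
  rw [intervalIntegral.integral_add ((hi c1).add (hi c2)) (hi c3),
    intervalIntegral.integral_add (hi c1) (hi c2)]
  simp only [bumpIntegral, segIntegral, legDensity, intervalIntegral.integral_const_mul]
  have e1 : (t * Complex.I - ε - ((0 : ℝ) - ε) : ℂ) = t * Complex.I := by push_cast; ring
  have e2 : (t * Complex.I + ε - (t * Complex.I - ε) : ℂ) = 2 * ε := by ring
  have e3 : ((0 : ℝ) + ε - (t * Complex.I + ε) : ℂ) = -(t * Complex.I) := by push_cast; ring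
  rw [e1, e2, e3]
  simp

/-- Both sides are holomorphic on the connected half-plane Re h > 0 and agree for real h in (0, 1).
-/
theorem integral_smearWeight_bump {h : ℂ} (hh : 0 < h.re) (hu : 0 < u)
    (hu' : 0 < u') (hne : u ≠ u') (hε : 0 < ε)
    (hg : DifferentiableOn ℂ g (uIcc (-ε) ε ×ℂ uIcc (-u') u')) :
    ∫ t in Ioo (-u') u', smearWeight h u' t * bumpIntegral 0 ε (t * Complex.I)
        (fun ζ => kernel h u (ζ - t * Complex.I) * g ζ) =
      1 / 2 * (∫ x in -ε..ε, legendreQ h (2 * u * u' / (u ^ 2 + u' ^ 2 + x ^ 2)) * g x) +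
        Real.pi * ∫ v in Ioo (-(u' - u)) (u' - u),
          legendreP h (4 * u * u' / ((u + u') ^ 2 - v ^ 2)) * g (v * Complex.I) := by
  obtain ⟨hc, hd, hb⟩ := bumpDensity_regular hu hu' hε hg.continuousOn
  have hmem : ∀ {x y : ℝ}, x ∈ Icc (-ε) ε → y ∈ Icc (-u') u' →
      (x : ℂ) + y * Complex.I ∈ uIcc (-ε) ε ×ℂ uIcc (-u') u' := fun hx hy => by
    rw [Complex.mem_reProdIm, uIcc_of_le (by linarith), uIcc_of_le (by linarith)]
    simpa using ⟨hx, hy⟩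
  have hgx : ContinuousOn (fun x : ℝ => g x) (Icc (-ε) ε) :=
    hg.continuousOn.comp (by fun_prop) fun x hx => by
      simpa using hmem hx (show (0 : ℝ) ∈ Icc (-u') u' from ⟨by linarith, hu'.le⟩)
  have hgy : ContinuousOn (fun y : ℝ => g (y * Complex.I)) (Icc (-u') u') :=
    hg.continuousOn.comp (by fun_prop) fun y hy => by
      simpa using hmem (show (0 : ℝ) ∈ Icc (-ε) ε from ⟨by linarith, hε.le⟩) hy
  have hL : DifferentiableOn ℂ (fun h => ∫ t in Ioo (-u') u', smearWeight h u' t *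
      bumpIntegral 0 ε (t * Complex.I) (fun ζ => kernel h u (ζ - t * Complex.I) * g ζ))
      {h | 0 < h.re} := by
    refine (smearWeight_mul_holomorphic hu' hc hd).1.congr fun h _ => ?_
    refine setIntegral_congr_fun measurableSet_Ioo fun t ht => ?_
    rw [hb h t (Ioo_subset_Icc_self ht)]
  have hRd := ((differentiableOn_integral_legendreQ hu hu' hne hε hgx).const_mul (1 / 2)).add
    (((differentiable_integral_legendreP hu hu' hgy).mono
      (subset_univ {h : ℂ | 0 < h.re})).const_mul (Real.pi : ℂ))
  have hconn : IsPreconnected {h : ℂ | 0 < h.re} :=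
    (convex_halfSpace_re_gt 0).isPreconnected
  exact AnalyticOnNhd.eqOn_of_preconnected_of_frequently_eq (hL.analyticOnNhd isOpen_re_pos)
    (hRd.analyticOnNhd isOpen_re_pos) hconn (z₀ := ((1 / 2 : ℝ) : ℂ)) (by simp)
    (frequently_ofReal_nhdsNE _ (by
      filter_upwards [Ioo_mem_nhds (show (0 : ℝ) < 1 / 2 by norm_num)
        (show (1 / 2 : ℝ) < 1 by norm_num)] with s hs
      exact integral_smearWeight_bump_of_lt_one hs.1 hs.2 hu hu' hne hε hg)) hh

end Bump

/-! ### The local identity for one propagator. -/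

theorem segIntegral_add_left (c a b : ℂ) (F : ℂ → ℂ) :
    segIntegral (c + a) (c + b) F = segIntegral a b fun ζ => F (c + ζ) := by
  simp only [segIntegral, add_sub_add_left_eq_sub, add_assoc]

theorem bumpIntegral_add_left (p ε : ℝ) (w : ℂ) (F : ℂ → ℂ) :
    bumpIntegral p ε (p + w) F = bumpIntegral 0 ε w fun ζ => F (p + ζ) := by
  simp only [bumpIntegral, ← segIntegral_add_left, Complex.ofReal_zero, zero_sub, zero_add]
  simp only [sub_eq_add_neg, add_assoc]

theorem segIntegral_const_mul (c a b : ℂ) (F : ℂ → ℂ) :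
    (segIntegral a b fun ζ => c * F ζ) = c * segIntegral a b F := by
  simp only [segIntegral, intervalIntegral.integral_const_mul]
  ring

theorem bumpIntegral_const_mul (p ε : ℝ) (w c : ℂ) (F : ℂ → ℂ) :
    (bumpIntegral p ε w fun ζ => c * F ζ) = c * bumpIntegral p ε w F := by
  simp only [bumpIntegral, segIntegral_const_mul]
  ring

theorem Ghat_eq (h u : ℝ) (ζ : ℂ) (u' : ℝ) (z' : ℂ) (t : ℝ) :
    Ghat h u ζ u' z' (z' + t * Complex.I) =
      smearConst h * (smearWeight h u' t * kernel h u (ζ - (z' + t * Complex.I))) := by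
  have : K (1 - h) u' z' (z' + t * Complex.I) = smearWeight h u' t := by
    rw [K, smearWeight, sub_add_cancel_left, neg_sq, mul_pow, Complex.I_sq]
    push_cast
    ring_nf
  rw [Ghat, smear, this]
  simp only [K, kernel]
  ring

theorem xi_ofReal_add (u u' z' x : ℝ) :
    xi u (z' + x) u' z' = ((2 * u * u' / (u ^ 2 + u' ^ 2 + x ^ 2) : ℝ) : ℂ) := by
  rw [xi, add_sub_cancel_left]
  push_cast
  rfl

theorem xi_add_mul_I (u u' z' v : ℝ) :
    xi u (z' + v * Complex.I) u' z' = ((2 * u * u' / (u ^ 2 + u' ^ 2 - v ^ 2) : ℝ) : ℂ) := by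
  rw [xi, add_sub_cancel_left, mul_pow, Complex.I_sq]
  push_cast
  ring_nf

/-- For ξ = 2uu'/(u²+u'²-v²) one has 2ξ/(1+ξ) = 4uu'/((u+u')²-v²), and |v| < u' - u gives 0 < ξ < 1.
-/
theorem Gtilde_eq {h u u' z' v : ℝ} (hh : 0 < h) (hu : 0 < u) (hv : |v| < u' - u) :
    Gtilde h u (z' + v * Complex.I) u' z' =
      smearConst h * legendreP h (4 * u * u' / ((u + u') ^ 2 - v ^ 2)) := by
  obtain ⟨hv1, hv2⟩ := abs_lt.1 hv
  have hu' : 0 < u' := by linarith [abs_nonneg v]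
  have hd : 0 < u ^ 2 + u' ^ 2 - v ^ 2 := by nlinarith
  have hd2 : 0 < (u + u') ^ 2 - v ^ 2 := by nlinarith
  rw [Gtilde_eq_legendreP hh (ξ := 2 * u * u' / (u ^ 2 + u' ^ 2 - v ^ 2)) (by positivity)
    (by rw [div_lt_one hd]; nlinarith) (xi_add_mul_I u u' z' v)]
  congr 2
  have e : 1 + 2 * u * u' / (u ^ 2 + u' ^ 2 - v ^ 2) =
      ((u + u') ^ 2 - v ^ 2) / (u ^ 2 + u' ^ 2 - v ^ 2) := by field_simp; ring
  rw [e]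
  field_simp
  ring

theorem G_ofReal_add {h u u' z' x : ℝ} (hh : 0 < h) (hu : 0 < u) (hu' : 0 < u')
    (hne : u ≠ u' ∨ x ≠ 0) :
    G h u (z' + x) u' z' =
      Complex.I * smearConst h / 2 * legendreQ h (2 * u * u' / (u ^ 2 + u' ^ 2 + x ^ 2)) := by
  refine G_eq_legendreQ hh (by positivity) ?_ (xi_ofReal_add u u' z' x)
  rw [div_lt_one (by positivity)]
  rcases hne with h | h
  · nlinarith [sq_pos_of_ne_zero (sub_ne_zero.2 h), sq_nonneg x]
  · nlinarith [sq_nonneg (u - u'), sq_pos_of_ne_zero h]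

theorem segIntegral_vertical (z' Y : ℝ) (F : ℂ → ℂ) :
    segIntegral (z' - Complex.I * Y) (z' + Complex.I * Y) F =
      Complex.I * ∫ t in -Y..Y, F (z' + t * Complex.I) := by
  rw [← segIntegral_add_mul]
  congr 1 <;> push_cast <;> ring

/-- `integral_smearWeight_bump` in terms of the propagators: the `legendreQ` term is G on the real
interval, the `legendreP` term is G̃ on the vertical segment. -/
theorem segIntegral_bumpIntegral {h u u' z' ε : ℝ} {g : ℂ → ℂ} (hh : 0 < h) (hu : 0 < u)
    (hu' : 0 < u') (hne : u ≠ u') (hε : 0 < ε)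
    (hg : DifferentiableOn ℂ (fun ζ => g (z' + ζ)) (uIcc (-ε) ε ×ℂ uIcc (-u') u')) :
    segIntegral (z' - Complex.I * u') (z' + Complex.I * u')
        (fun w => bumpIntegral z' ε w fun ζ => Ghat h u ζ u' z' w * g ζ) =
      (∫ x in Metric.ball z' ε, G h u x u' z' * g x) -
        Real.pi * (if u < u' then
          segIntegral (z' - Complex.I * (u - u')) (z' + Complex.I * (u - u'))
            (fun ζ => Gtilde h u ζ u' z' * g ζ) else 0) := by
  have key := integral_smearWeight_bump (h := h) (by simpa using hh) hu hu' hne hε hg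
  have e1 : segIntegral (z' - Complex.I * u') (z' + Complex.I * u')
        (fun w => bumpIntegral z' ε w fun ζ => Ghat h u ζ u' z' w * g ζ) =
      Complex.I * smearConst h * ∫ t in Ioo (-u') u', smearWeight h u' t *
        bumpIntegral 0 ε (t * Complex.I) (fun ζ => kernel h u (ζ - t * Complex.I) * g (z' + ζ)) := by
    rw [segIntegral_vertical, mul_assoc, intervalIntegral.integral_of_le (by linarith),
      integral_Ioc_eq_integral_Ioo, ← integral_const_mul (smearConst h)]
    congr 2
    funext t
    rw [bumpIntegral_add_left, ← bumpIntegral_const_mul, ← bumpIntegral_const_mul]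
    congr 1
    funext ζ
    rw [Ghat_eq, add_sub_add_left_eq_sub]
    ring
  have e2 : (∫ x in Metric.ball z' ε, G h u x u' z' * g x) =
      Complex.I * smearConst h * (1 / 2 * ∫ x in -ε..ε,
        legendreQ h (2 * u * u' / (u ^ 2 + u' ^ 2 + x ^ 2)) * g (z' + x)) := by
    rw [Real.ball_eq_Ioo, ← integral_Ioc_eq_integral_Ioo, ← intervalIntegral.integral_of_le
      (by linarith), ← mul_assoc, ← intervalIntegral.integral_const_mul, sub_eq_add_neg z' ε,
      ← intervalIntegral.integral_comp_add_left]
    refine intervalIntegral.integral_congr fun x _ => ?_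
    rw [Complex.ofReal_add, G_ofReal_add hh hu hu' (Or.inl hne)]
    ring
  -- For u < u' the segment from z' - i(u-u') to z' + i(u-u') runs downwards, hence the minus sign.
  have e3 : (if u < u' then segIntegral (z' - Complex.I * (u - u')) (z' + Complex.I * (u - u'))
            (fun ζ => Gtilde h u ζ u' z' * g ζ) else 0) =
      -(Complex.I * smearConst h) * ∫ v in Ioo (-(u' - u)) (u' - u),
          legendreP h (4 * u * u' / ((u + u') ^ 2 - v ^ 2)) * g (z' + v * Complex.I) := by
    split_ifs with huu'
    · rw [← Complex.ofReal_sub, segIntegral_vertical, intervalIntegral.integral_of_ge (by linarith),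
        integral_Ioc_eq_integral_Ioo, neg_sub, neg_mul, mul_assoc, ← integral_const_mul, neg_sub,
        mul_neg]
      congr 2
      refine setIntegral_congr_fun measurableSet_Ioo fun v hv => ?_
      rw [Gtilde_eq hh hu (abs_lt.2 ⟨by linarith [hv.1], hv.2⟩), mul_assoc]
    · rw [Ioo_eq_empty (by linarith)]
      simp
  rw [e1, e2, e3, key]
  ring

/-! ### Upper and lower bounds on the propagators. -/

/-- The modulus is at least the real part u² + D² - y², and at least D₀² because both factors D +
i(y ± u) have real part D. Multiples of the two bounds combine. -/
theorem one_add_sq_le_mul_norm {u D y D₀ Y : ℝ} (hD₀ : 0 < D₀) (hD : D₀ ≤ |D|) (hy : |y| ≤ Y) :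
    1 + u ^ 2 + D ^ 2 ≤ (1 + (Y ^ 2 + 1) / D₀ ^ 2) * ‖(u : ℂ) ^ 2 + (D + y * Complex.I) ^ 2‖ := by
  have hre : ((u : ℂ) ^ 2 + (D + y * Complex.I) ^ 2).re = u ^ 2 + D ^ 2 - y ^ 2 := by
    simp [sq, Complex.add_re, Complex.mul_re, Complex.mul_im, add_sub_assoc]
  have e : (u : ℂ) ^ 2 + (D + y * Complex.I) ^ 2 =
      ((D : ℂ) + (y - u : ℝ) * Complex.I) * ((D : ℂ) + (y + u : ℝ) * Complex.I) := by
    push_cast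
    linear_combination (u : ℂ) ^ 2 * Complex.I_sq
  have hfac : ∀ b : ℝ, D₀ ≤ ‖(D : ℂ) + b * Complex.I‖ := fun b =>
    hD.trans (by simpa using Complex.abs_re_le_norm ((D : ℂ) + b * Complex.I))
  have h1 : u ^ 2 + D ^ 2 - y ^ 2 ≤ ‖(u : ℂ) ^ 2 + (D + y * Complex.I) ^ 2‖ :=
    hre ▸ Complex.re_le_norm _
  have h2 : D₀ ^ 2 ≤ ‖(u : ℂ) ^ 2 + (D + y * Complex.I) ^ 2‖ := by
    rw [e, norm_mul, sq]
    exact mul_le_mul (hfac _) (hfac _) hD₀.le (norm_nonneg _)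
  have h3 : y ^ 2 ≤ Y ^ 2 := sq_le_sq.2 (hy.trans (le_abs_self Y))
  have h4 : Y ^ 2 + 1 ≤ (Y ^ 2 + 1) / D₀ ^ 2 * ‖(u : ℂ) ^ 2 + (D + y * Complex.I) ^ 2‖ := by
    rw [div_mul_eq_mul_div, le_div_iff₀ (by positivity)]
    exact mul_le_mul_of_nonneg_left h2 (by positivity)
  linarith

theorem exists_norm_kernel_off_axis_le {h D₀ Y : ℝ} (hh : 0 ≤ h) (hD₀ : 0 < D₀) :
    ∃ C, 0 < C ∧ ∀ u D y : ℝ, 0 < u → D₀ ≤ |D| → |y| ≤ Y →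
      ‖kernel h u (D + y * Complex.I)‖ ≤ C * (u / (1 + u ^ 2 + D ^ 2)) ^ h := by
  refine ⟨(1 + (Y ^ 2 + 1) / D₀ ^ 2) ^ h, by positivity, fun u D y hu hD hy => ?_⟩
  have hD0 : D ≠ 0 := abs_pos.1 (hD₀.trans_le hD)
  have hN : 0 < ‖(u : ℂ) ^ 2 + (D + y * Complex.I) ^ 2‖ :=
    norm_pos_iff.2 (Complex.slitPlane_ne_zero (add_sq_mem_slitPlane hD0))
  rw [kernel, Complex.norm_cpow_real, norm_div, Complex.norm_of_nonneg hu.le,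
    ← Real.mul_rpow (by positivity) (by positivity)]
  refine Real.rpow_le_rpow (by positivity) ?_ hh
  rw [mul_div_assoc', div_le_div_iff₀ hN (by positivity), mul_comm _ u, mul_assoc]
  exact mul_le_mul_of_nonneg_left (one_add_sq_le_mul_norm hD₀ hD hy) hu.le

/-- Weighted arithmetic-geometric mean bound for `kernel` on the real axis. -/
theorem norm_kernel_ofReal_le {h η u x : ℝ} (hh : 1 / 2 ≤ h) (hη0 : 0 ≤ η) (hη1 : η ≤ 1)
    (hu : 0 < u) (hx : x ≠ 0) :
    ‖kernel h u x‖ ≤ u ^ (1 - h - η) * |x| ^ (-1 + η) := by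
  have hx0 : 0 < |x| := abs_pos.2 hx
  have hpos : 0 < u ^ 2 + x ^ 2 := by positivity
  have e : (u : ℂ) / ((u : ℂ) ^ 2 + (x : ℂ) ^ 2) = ((u / (u ^ 2 + x ^ 2) : ℝ) : ℂ) := by push_cast; rfl
  rw [kernel, e, Complex.norm_cpow_real, Complex.norm_of_nonneg (by positivity),
    Real.div_rpow hu.le hpos.le, div_le_iff₀ (Real.rpow_pos_of_pos hpos _)]
  -- The power (u²+x²)^h is distributed over u and |x| with exponents 2h-1+η and 1-η, of sum 2h. The
  -- first is nonnegative because h ≥ 1/2.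
  have h1 : u ^ (2 * h - 1 + η) ≤ (u ^ 2 + x ^ 2) ^ ((2 * h - 1 + η) / 2) := by
    rw [show 2 * h - 1 + η = 2 * ((2 * h - 1 + η) / 2) by ring, Real.rpow_mul hu.le,
      show 2 * ((2 * h - 1 + η) / 2) / 2 = (2 * h - 1 + η) / 2 by ring, Real.rpow_two]
    exact Real.rpow_le_rpow (by positivity) (by nlinarith [sq_nonneg x]) (by linarith)
  have h2 : |x| ^ (1 - η) ≤ (u ^ 2 + x ^ 2) ^ ((1 - η) / 2) := by
    rw [show 1 - η = 2 * ((1 - η) / 2) by ring, Real.rpow_mul hx0.le,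
      show 2 * ((1 - η) / 2) / 2 = (1 - η) / 2 by ring, Real.rpow_two, sq_abs]
    exact Real.rpow_le_rpow (by positivity) (by nlinarith [sq_nonneg u]) (by linarith)
  have h3 : (u ^ 2 + x ^ 2) ^ h = (u ^ 2 + x ^ 2) ^ ((2 * h - 1 + η) / 2) *
      (u ^ 2 + x ^ 2) ^ ((1 - η) / 2) := by
    rw [← Real.rpow_add hpos]; congr 1; ring
  calc u ^ h = u ^ (1 - h - η) * |x| ^ (-1 + η) * (u ^ (2 * h - 1 + η) * |x| ^ (1 - η)) := by
        rw [mul_mul_mul_comm, ← Real.rpow_add hu, ← Real.rpow_add hx0]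
        ring_nf
        simp
    _ ≤ _ := by
        rw [h3]
        exact mul_le_mul_of_nonneg_left (mul_le_mul h1 h2 (by positivity) (by positivity))
          (by positivity)

/-- Since √(1-ξ²) ≤ 1, the positive integrand is at least ξ^h (1 + cosh θ)^(-h). -/
theorem exists_le_norm_legendreQ {h : ℝ} (hh : 0 < h) :
    ∃ c, 0 < c ∧ ∀ ξ ∈ Ioo (0 : ℝ) 1, c * ξ ^ h ≤ ‖legendreQ h ξ‖ := by
  have hint : ∀ ξ : ℝ, Integrable fun θ : ℝ => (1 / (1 + Real.cosh θ)) ^ h := by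
    intro ξ
    refine ((integrable_exp_neg_mul_abs hh).const_mul (2 ^ h)).mono'
      (Measurable.aestronglyMeasurable (Measurable.pow_const (measurable_const.div
        (Real.continuous_cosh.measurable.const_add _)) _)) (ae_of_all _ fun θ => ?_)
    have hc := Real.cosh_pos θ
    rw [Real.norm_of_nonneg (by positivity), ← exp_neg_abs_rpow, ← Real.mul_rpow two_pos.le
      (Real.exp_pos _).le]
    refine Real.rpow_le_rpow (by positivity) ?_ hh.le
    rw [Real.exp_neg, ← div_eq_mul_inv, div_le_div_iff₀ (by positivity) (Real.exp_pos _), one_mul]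
    linarith [exp_abs_le_two_mul_cosh θ]
  refine ⟨∫ θ : ℝ, (1 / (1 + Real.cosh θ)) ^ h, ?_, fun ξ hξ => ?_⟩
  · refine (integral_pos_iff_support_of_nonneg (fun θ => ?_) (hint 0)).2 ?_
    · have hc := Real.cosh_pos θ
      positivity
    · have : Function.support (fun θ : ℝ => (1 / (1 + Real.cosh θ)) ^ h) = univ := by
        ext θ
        have hc := Real.cosh_pos θ
        simp only [Function.mem_support, mem_univ, iff_true]
        positivity
      rw [this]; simp
  · have h0 : 0 ≤ ∫ θ : ℝ, (ξ / (1 + √(1 - ξ ^ 2) * Real.cosh θ)) ^ h :=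
      integral_nonneg fun θ => Real.rpow_nonneg (legendreQ_base_pos hξ.1).le _
    rw [legendreQ_ofReal hξ.1, Complex.norm_of_nonneg h0, mul_comm, ← integral_const_mul]
    refine integral_mono ((hint 0).const_mul _) (integrable_legendreQ_base hh hξ.1 hξ.2) fun θ => ?_
    have hc := Real.cosh_pos θ
    dsimp only
    rw [← Real.mul_rpow hξ.1.le (by positivity), mul_one_div]
    refine Real.rpow_le_rpow (div_nonneg hξ.1.le (by positivity))
      (div_le_div_of_nonneg_left hξ.1.le (by positivity) ?_) hh.le
    have : √(1 - ξ ^ 2) ≤ 1 := Real.sqrt_le_one.2 (by nlinarith [sq_nonneg ξ])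
    nlinarith

/-- A lower bound of the same shape as the upper bound on Ĝ off the axis. Absolute convergence is
assumed only for the product of the G with f; this bound transfers it to the Ĝ. -/
theorem exists_le_norm_G {h u' : ℝ} (hh : 0 < h) (hu' : 0 < u') :
    ∃ c, 0 < c ∧ ∀ u z' D : ℝ, 0 < u → D ≠ 0 →
      c * (u / (1 + u ^ 2 + D ^ 2)) ^ h ≤ ‖G h u (z' + D) u' z'‖ := by
  obtain ⟨c, hc, hQ⟩ := exists_le_norm_legendreQ hh
  have hs := norm_pos_iff.2 (smearConst_ne_zero hh)
  refine ⟨‖smearConst h‖ / 2 * c * (2 * u' / (1 + u' ^ 2)) ^ h, by positivity,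
    fun u z' D hu hD => ?_⟩
  have hD2 : 0 < D ^ 2 := by positivity
  have hξ1 : 2 * u * u' / (u ^ 2 + u' ^ 2 + D ^ 2) < 1 := by
    rw [div_lt_one (by positivity)]
    nlinarith [sq_nonneg (u - u')]
  rw [G_ofReal_add hh hu hu' (Or.inr hD), norm_mul, norm_div, norm_mul, Complex.norm_I, one_mul,
    Complex.norm_ofNat, mul_assoc, mul_assoc]
  refine mul_le_mul_of_nonneg_left ?_ (by positivity)
  refine le_trans ?_ (hQ _ ⟨by positivity, hξ1⟩)
  refine mul_le_mul_of_nonneg_left ?_ hc.le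
  rw [← Real.mul_rpow (by positivity) (by positivity)]
  refine Real.rpow_le_rpow (by positivity) ?_ hh.le
  rw [div_mul_div_comm, div_le_div_iff₀ (by positivity) (by positivity)]
  have h1 : u ^ 2 + u' ^ 2 + D ^ 2 ≤ (1 + u' ^ 2) * (1 + u ^ 2 + D ^ 2) := by
    nlinarith [mul_nonneg (sq_nonneg u') (sq_nonneg u), mul_nonneg (sq_nonneg u') (sq_nonneg D)]
  calc 2 * u' * u * (u ^ 2 + u' ^ 2 + D ^ 2) ≤ 2 * u' * u * ((1 + u' ^ 2) * (1 + u ^ 2 + D ^ 2)) :=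
        mul_le_mul_of_nonneg_left h1 (by positivity)
    _ = _ := by ring

/-- The density that bounds `smear` in the parameter of its segment. -/
noncomputable def smearDensity (h σ : ℝ) : ℝ := (σ - 0) ^ (h - 1) * (1 - σ) ^ (h - 1)

theorem integrableOn_smearDensity {h : ℝ} (hh : 0 < h) : IntegrableOn (smearDensity h) (Icc 0 1) := by
  rw [integrableOn_Icc_iff_integrableOn_Ioo]
  exact integrableOn_rpow_mul_rpow (by linarith) (by linarith) one_pos

theorem smearDensity_nonneg {h σ : ℝ} (hσ : σ ∈ Icc (0 : ℝ) 1) : 0 ≤ smearDensity h σ := by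
  have h1 := hσ.1
  have h2 := sub_nonneg.2 hσ.2
  unfold smearDensity
  rw [sub_zero]
  positivity

theorem segment_point (z' u' σ : ℝ) :
    (z' - Complex.I * u' + σ * (z' + Complex.I * u' - (z' - Complex.I * u')) : ℂ) =
      z' + (u' * (2 * σ - 1) : ℝ) * Complex.I := by
  push_cast; ring

theorem norm_Ghat_eq {h u' σ : ℝ} (hu' : 0 < u') (hσ : σ ∈ Ioo (0 : ℝ) 1) (u z' : ℝ) (ζ : ℂ) :
    ‖Ghat h u ζ u' z' (z' + (u' * (2 * σ - 1) : ℝ) * Complex.I)‖ =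
      ‖smearConst h‖ * (4 * u') ^ (h - 1) * smearDensity h σ *
        ‖kernel h u (ζ - (z' + (u' * (2 * σ - 1) : ℝ) * Complex.I))‖ := by
  have h1 : 0 < 1 - σ := sub_pos.2 hσ.2
  have h0 := hσ.1
  rw [Ghat_eq, norm_mul, norm_mul, norm_smearWeight ⟨by nlinarith, by nlinarith⟩, smearDensity,
    sub_zero, ← Real.mul_rpow h0.le h1.le, mul_assoc ‖smearConst h‖,
    ← Real.mul_rpow (by positivity) (by positivity)]
  have e : u' / (u' ^ 2 - (u' * (2 * σ - 1)) ^ 2) = (4 * u' * (σ * (1 - σ)))⁻¹ := by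
    rw [show u' ^ 2 - (u' * (2 * σ - 1)) ^ 2 = u' * (4 * u' * (σ * (1 - σ))) by ring]
    field_simp
  rw [e, Complex.ofReal_re, Real.inv_rpow (by positivity), ← Real.rpow_neg (by positivity), neg_sub]
  ring_nf

/-- Smearing the kernel and expanding the propagator lead to the same Legendre integral, with the
same constant. -/
theorem segIntegral_Ghat_eq_G {h u u' z' x : ℝ} (hh : 0 < h) (hu : 0 < u) (hu' : 0 < u')
    (hx : x ≠ z') :
    segIntegral (z' - Complex.I * u') (z' + Complex.I * u') (Ghat h u x u' z') =
      G h u x u' z' := by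
  have hD : x - z' ≠ 0 := sub_ne_zero.2 hx
  have e : (x : ℂ) = z' + (x - z' : ℝ) := by push_cast; ring
  rw [segIntegral_vertical, intervalIntegral.integral_of_le (by linarith),
    integral_Ioc_eq_integral_Ioo, e, G_ofReal_add hh hu hu' (Or.inr hD)]
  simp_rw [Ghat_eq, integral_const_mul]
  have := integral_smearWeight_mul_kernel hh hu hu' hD
  simp_rw [add_sub_add_left_eq_sub]
  rw [this]
  ring

theorem measurable_Ghat (h u' z' : ℝ) :
    Measurable fun p : (ℝ × ℂ) × ℂ => Ghat h p.1.1 p.1.2 u' z' p.2 := by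
  unfold Ghat smear K
  exact (Measurable.pow_const (by fun_prop) _).mul
    ((Measurable.pow_const (by fun_prop) _).const_mul _)

theorem exists_norm_Ghat_off_axis_le {h u' D₀ Y : ℝ} (hh : 0 ≤ h) (hu' : 0 < u') (hD₀ : 0 < D₀) :
    ∃ C, 0 < C ∧ ∀ u z' : ℝ, ∀ ζ : ℂ, ∀ σ ∈ Ioo (0 : ℝ) 1, 0 < u → D₀ ≤ |ζ.re - z'| → |ζ.im| ≤ Y →
      ‖Ghat h u ζ u' z' (z' + (u' * (2 * σ - 1) : ℝ) * Complex.I)‖ ≤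
        C * smearDensity h σ * (u / (1 + u ^ 2 + (ζ.re - z') ^ 2)) ^ h := by
  obtain ⟨C, hC, hk⟩ := exists_norm_kernel_off_axis_le (Y := Y + u') hh hD₀
  refine ⟨(‖smearConst h‖ * (4 * u') ^ (h - 1) + 1) * C, by positivity,
    fun u z' ζ σ hσ hu hD hY => ?_⟩
  have hS := smearDensity_nonneg (h := h) (Ioo_subset_Icc_self hσ)
  have e : ζ - (z' + (u' * (2 * σ - 1) : ℝ) * Complex.I) =
      ((ζ.re - z' : ℝ) : ℂ) + (ζ.im - u' * (2 * σ - 1) : ℝ) * Complex.I := by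
    apply Complex.ext <;> simp
  have h1 := hk u (ζ.re - z') (ζ.im - u' * (2 * σ - 1)) hu hD (by
    refine (abs_sub _ _).trans (add_le_add hY ?_)
    rw [abs_le]; constructor <;> nlinarith [hσ.1, hσ.2])
  rw [norm_Ghat_eq hu' hσ, e]
  calc _ ≤ ‖smearConst h‖ * (4 * u') ^ (h - 1) * smearDensity h σ *
        (C * (u / (1 + u ^ 2 + (ζ.re - z') ^ 2)) ^ h) :=
        mul_le_mul_of_nonneg_left h1 (by positivity)
    _ ≤ (‖smearConst h‖ * (4 * u') ^ (h - 1) + 1) * smearDensity h σ *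
        (C * (u / (1 + u ^ 2 + (ζ.re - z') ^ 2)) ^ h) := by
        gcongr; linarith
    _ = _ := by ring

/-! ### Integration over the parameter cube of the w variables. -/

/-- Lebesgue measure on the unit cube. -/
noncomputable def unitCube (n : ℕ) : Measure (Fin n → ℝ) :=
  Measure.pi fun _ => volume.restrict (Icc 0 1)

instance (n : ℕ) : IsFiniteMeasure (unitCube n) := by unfold unitCube; infer_instance

theorem volume_restrict_Icc_eq_unitCube (n : ℕ) :
    volume.restrict (Icc (0 : Fin n → ℝ) 1) = unitCube n := by
  rw [unitCube, ← Measure.restrict_pi_pi, ← volume_pi, ← Set.pi_univ_Icc]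
  rfl

theorem ae_unitCube (n : ℕ) : ∀ᵐ s ∂unitCube n, ∀ i, s i ∈ Ioo (0 : ℝ) 1 := by
  rw [ae_all_iff]
  intro i
  have h1 : ∀ᵐ σ : ℝ ∂(volume.restrict (Icc 0 1)), σ ∈ Ioo (0 : ℝ) 1 := by
    rw [← restrict_Ioo_eq_restrict_Icc]
    exact ae_restrict_mem measurableSet_Ioo
  exact (Measure.quasiMeasurePreserving_eval (μ := fun _ : Fin n => volume.restrict (Icc (0 : ℝ) 1))
    i).ae h1

theorem integrable_prod_smearDensity {n : ℕ} {h : Fin n → ℝ} (hh : ∀ i, 0 < h i) :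
    Integrable (fun s => ∏ i, smearDensity (h i) (s i)) (unitCube n) :=
  Integrable.fintype_prod fun i => integrableOn_smearDensity (hh i)

theorem integral_unitCube_prod {n : ℕ} (φ : Fin n → ℝ → ℂ) :
    ∫ s, ∏ i, φ i (s i) ∂unitCube n = ∏ i, ∫ ρ in Icc (0 : ℝ) 1, φ i ρ :=
  integral_fintype_prod_eq_prod φ

theorem prod_erase_eq_prod_succAbove {m : ℕ} (k : Fin (m + 1)) (F : Fin (m + 1) → ℂ) :
    ∏ i ∈ Finset.univ.erase k, F i = ∏ j, F (k.succAbove j) := by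
  rw [← Finset.sdiff_singleton_eq_erase, ← Finset.compl_eq_univ_sdiff, ← Fin.image_succAbove_univ,
    Finset.prod_image fun _ _ _ _ h => Fin.succAbove_right_injective h]

/-- Separate the k-th coordinate by `Fin.succAbove`. At fixed σ and τ the integrand is a product
over the remaining coordinates, so their integral factorises; this needs no integrability of the
single factors. -/
theorem integral_unitCube_split {n : ℕ} {k : Fin n} {T : Measure ℝ} [SFinite T]
    {φ : Fin n → ℝ → ℝ → ℝ → ℂ} {ψ : ℝ → ℝ → ℂ}
    (hL : Integrable (fun p : (Fin n → ℝ) × ℝ =>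
      (∏ i ∈ Finset.univ.erase k, φ i (p.1 k) p.2 (p.1 i)) * ψ (p.1 k) p.2) ((unitCube n).prod T)) :
    IntegrableOn (fun σ => ∫ τ, (∏ i ∈ Finset.univ.erase k, ∫ ρ in Icc (0 : ℝ) 1, φ i σ τ ρ) *
      ψ σ τ ∂T) (Icc 0 1) ∧
    ∫ s, ∫ τ, (∏ i ∈ Finset.univ.erase k, φ i (s k) τ (s i)) * ψ (s k) τ ∂T ∂unitCube n =
      ∫ σ in Icc (0 : ℝ) 1, ∫ τ, (∏ i ∈ Finset.univ.erase k, ∫ ρ in Icc (0 : ℝ) 1, φ i σ τ ρ) *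
        ψ σ τ ∂T := by
  obtain _ | m := n
  · exact k.elim0
  simp only [prod_erase_eq_prod_succAbove] at hL ⊢
  set ν : Measure ℝ := volume.restrict (Icc 0 1)
  have hmp : MeasurePreserving (MeasurableEquiv.piFinSuccAbove (fun _ => ℝ) k) (unitCube (m + 1))
      (ν.prod (unitCube m)) := measurePreserving_piFinSuccAbove (fun _ => ν) k
  have hmp2 := hmp.prod (MeasurePreserving.id T)
  have hmp3 := measurePreserving_prodAssoc ν (unitCube m) T
  set M : ℝ × ((Fin m → ℝ) × ℝ) → ℂ := fun q =>
    (∏ j, φ (k.succAbove j) q.1 q.2.2 (q.2.1 j)) * ψ q.1 q.2.2 with hM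
  have hemb : MeasurableEmbedding (Prod.map (MeasurableEquiv.piFinSuccAbove (fun _ => ℝ) k)
      (id : ℝ → ℝ)) :=
    ((MeasurableEquiv.piFinSuccAbove (fun _ => ℝ) k).prodCongr
      (MeasurableEquiv.refl ℝ)).measurableEmbedding
  have hL2 : Integrable (M ∘ MeasurableEquiv.prodAssoc) ((ν.prod (unitCube m)).prod T) :=
    (hmp2.integrable_comp_emb hemb).1 hL
  have hMi : Integrable M (ν.prod ((unitCube m).prod T)) :=
    (hmp3.integrable_comp_emb MeasurableEquiv.prodAssoc.measurableEmbedding).1 hL2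
  have hae : ∀ᵐ σ ∂ν, ∫ q, M (σ, q) ∂((unitCube m).prod T) =
      ∫ τ, (∏ j, ∫ ρ in Icc (0 : ℝ) 1, φ (k.succAbove j) σ τ ρ) * ψ σ τ ∂T := by
    filter_upwards [hMi.prod_right_ae] with σ hσ
    rw [integral_prod_symm _ hσ]
    refine integral_congr_ae (ae_of_all _ fun τ => ?_)
    refine (integral_mul_const (ψ σ τ) fun x : Fin m → ℝ => ∏ j, φ (k.succAbove j) σ τ (x j)).trans ?_
    rw [integral_unitCube_prod fun j => φ (k.succAbove j) σ τ]
  refine ⟨hMi.integral_prod_left.congr hae, ?_⟩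
  have e1 := integral_prod _ hL
  have e2 := hmp2.integral_comp hemb (M ∘ MeasurableEquiv.prodAssoc)
  have e3 := hmp3.integral_comp MeasurableEquiv.prodAssoc.measurableEmbedding M
  have e4 := integral_prod _ hMi
  rw [← e1, ← integral_congr_ae hae, ← e4, ← e3]
  exact e2

section Smeared

variable {h u u' z' : ℝ} {ζ : ℂ}

/-- Off the line Re ζ = z' the kernel is holomorphic in ζ, and near each point it is dominated by an
integrable density in the segment parameter. This makes the other propagators admissible factors in
the local identity. -/
theorem differentiableOn_segIntegral_Ghat (hh : 0 < h) (hu : 0 < u) (hu' : 0 < u') :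
    DifferentiableOn ℂ (fun ζ => segIntegral (z' - Complex.I * u') (z' + Complex.I * u')
      (Ghat h u ζ u' z')) {ζ | ζ.re ≠ z'} := by
  have hop : IsOpen {ζ : ℂ | ζ.re ≠ z'} := isOpen_ne_fun Complex.continuous_re continuous_const
  simp only [segIntegral, intervalIntegral.integral_of_le zero_le_one]
  refine DifferentiableOn.const_mul ?_ _
  refine differentiableOn_integral hop (fun ζ _ => ?_) (ae_of_all _ fun σ => ?_) fun ζ₀ hζ₀ => ?_
  · exact ((measurable_Ghat h u' z').comp (f := fun σ : ℝ => ((u, ζ), (z' - Complex.I * u' +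
      σ * (z' + Complex.I * u' - (z' - Complex.I * u')) : ℂ))) (by fun_prop)).aestronglyMeasurable
  · intro ζ hζ
    refine DifferentiableWithinAt.mul_const (DifferentiableAt.differentiableWithinAt ?_) _
    rw [segment_point]
    refine DifferentiableAt.comp (f := fun ζ : ℂ => ζ - (z' + (u' * (2 * σ - 1) : ℝ) * Complex.I)) ζ
      (differentiableAt_kernel h hu (sq_add_sq_mem_slitPlane_of_re_ne_zero u ?_)) (by fun_prop)
    simpa [sub_eq_zero] using hζ
  · have hD : 0 < |ζ₀.re - z'| := abs_pos.2 (sub_ne_zero.2 hζ₀)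
    obtain ⟨C, hC, hb⟩ := exists_norm_Ghat_off_axis_le (Y := |ζ₀.im| + |ζ₀.re - z'| / 2) hh.le hu'
      (half_pos hD)
    refine ⟨_, Metric.ball_mem_nhds ζ₀ (half_pos hD), fun σ => C * smearDensity h σ * u ^ h, ?_, ?_⟩
    · exact (((integrableOn_smearDensity hh).mono_set Ioc_subset_Icc_self).const_mul C).mul_const _
    · rw [← restrict_Ioo_eq_restrict_Ioc]
      filter_upwards [ae_restrict_mem measurableSet_Ioo] with σ hσ ζ hζ
      rw [Metric.mem_ball, dist_eq_norm] at hζ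
      have h1 : |ζ.re - ζ₀.re| < |ζ₀.re - z'| / 2 := by
        rw [← Complex.sub_re]; exact (Complex.abs_re_le_norm _).trans_lt hζ
      have h2 : |ζ.im - ζ₀.im| < |ζ₀.re - z'| / 2 := by
        rw [← Complex.sub_im]; exact (Complex.abs_im_le_norm _).trans_lt hζ
      rw [segment_point]
      refine (hb u z' ζ σ hσ hu ?_ ?_).trans ?_
      · have := abs_sub_abs_le_abs_sub (ζ₀.re - z') (ζ₀.re - ζ.re)
        rw [sub_sub_sub_cancel_left, abs_sub_comm ζ₀.re ζ.re] at this
        linarith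
      · have := abs_sub_abs_le_abs_sub ζ.im ζ₀.im
        linarith
      · refine mul_le_mul_of_nonneg_left (Real.rpow_le_rpow (by positivity) ?_ hh.le)
          (mul_nonneg hC.le (smearDensity_nonneg (Ioo_subset_Icc_self hσ)))
        rw [div_le_iff₀ (by positivity)]
        nlinarith [sq_nonneg u, sq_nonneg (ζ.re - z'), mul_nonneg hu.le (add_nonneg (sq_nonneg u)
          (sq_nonneg (ζ.re - z')))]

theorem segIntegrable_Ghat (hh : 0 < h) (hu : 0 < u) (hu' : 0 < u') (hζ : ζ.re ≠ z') :
    SegIntegrable (z' - Complex.I * u') (z' + Complex.I * u') (Ghat h u ζ u' z') := by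
  have hD : 0 < |ζ.re - z'| := abs_pos.2 (sub_ne_zero.2 hζ)
  obtain ⟨C, hC, hb⟩ := exists_norm_Ghat_off_axis_le (Y := |ζ.im|) hh.le hu' hD
  rw [SegIntegrable, intervalIntegrable_iff_integrableOn_Ioo_of_le zero_le_one]
  refine ((((integrableOn_smearDensity hh).mono_set Ioo_subset_Icc_self).const_mul C).mul_const
    ((u / (1 + u ^ 2 + (ζ.re - z') ^ 2)) ^ h)).mono' ?_ ?_
  · exact ((measurable_Ghat h u' z').comp (f := fun σ : ℝ => ((u, ζ), (z' - Complex.I * u' +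
      σ * (z' + Complex.I * u' - (z' - Complex.I * u')) : ℂ))) (by fun_prop)).aestronglyMeasurable
  · filter_upwards [ae_restrict_mem measurableSet_Ioo] with σ hσ
    rw [segment_point]
    exact hb u z' ζ σ hσ hu le_rfl le_rfl

end Smeared

/-! ### The punctured line. -/

/-- The point of the product of the segments `[z i - i u i, z i + i u i]` with parameter `s`. -/
noncomputable def wPoint {n : ℕ} (u z : Fin n → ℝ) (s : Fin n → ℝ) (i : Fin n) : ℂ :=
  wLow u z i + s i * (wHigh u z i - wLow u z i)

theorem wPoint_eq {n : ℕ} (u z s : Fin n → ℝ) (i : Fin n) :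
    wPoint u z s i = z i + (u i * (2 * s i - 1) : ℝ) * Complex.I := segment_point _ _ _

theorem segIntegral_eq_setIntegral_Icc (a b : ℂ) (F : ℂ → ℂ) :
    segIntegral a b F = (b - a) * ∫ s in Icc (0 : ℝ) 1, F (a + s * (b - a)) := by
  rw [segIntegral, intervalIntegral.integral_of_le zero_le_one, integral_Icc_eq_integral_Ioc]

section Punctured

variable {n : ℕ} {h u z : Fin n → ℝ} {f : ℝ → ℂ → ℂ}

theorem measurable_wPoint (u z : Fin n → ℝ) (i : Fin n) : Measurable fun s => wPoint u z s i := by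
  unfold wPoint
  fun_prop

theorem integrable_bulk (hf : BulkIntegrable h u z f) :
    Integrable (fun p : ℝ × ℝ => ((p.1 : ℂ) ^ 2)⁻¹ * bulkIntegrand h u z f p.1 p.2)
      ((volume.restrict (Ioi 0)).prod volume) := by
  rw [← Measure.restrict_univ (μ := (volume : Measure ℝ)), Measure.prod_restrict,
    Measure.restrict_univ]
  exact hf

theorem measurableSet_puncturedLine (z ε : Fin n → ℝ) : MeasurableSet (puncturedLine z ε) :=
  (isOpen_iUnion fun _ => Metric.isOpen_ball).measurableSet.compl

theorem aestronglyMeasurable_G {h u' z' : ℝ} (hh : 0 < h) (hu' : 0 < u') :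
    AEStronglyMeasurable (fun p : ℝ × ℝ => G h p.1 p.2 u' z')
      ((volume.restrict (Ioi 0)).prod volume) := by
  have hm : Measurable fun p : ℝ × ℝ => Complex.I * smearConst h / 2 *
      legendreQ h (2 * p.1 * u' / (p.1 ^ 2 + u' ^ 2 + (p.2 - z') ^ 2)) :=
    ((measurable_legendreQ h).comp (by fun_prop)).const_mul _
  refine hm.aestronglyMeasurable.congr ?_
  filter_upwards [Measure.quasiMeasurePreserving_fst.ae (ae_restrict_mem measurableSet_Ioi),
    Measure.quasiMeasurePreserving_snd.ae (compl_mem_ae_iff.2 (measure_singleton z'))] with p h1 h2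
  rw [← G_ofReal_add hh h1 hu' (Or.inr (sub_ne_zero.2 h2))]
  push_cast
  rw [add_sub_cancel]

theorem G_ne_zero {h r u' z' x : ℝ} (hh : 0 < h) (hr : 0 < r) (hu' : 0 < u') (hx : x ≠ z') :
    G h r x u' z' ≠ 0 := by
  obtain ⟨c, hc, hG⟩ := exists_le_norm_G hh hu'
  have h1 := hG r z' (x - z') hr (sub_ne_zero.2 hx)
  have e : (z' : ℂ) + (x - z' : ℝ) = x := by push_cast; ring
  rw [e] at h1
  exact norm_pos_iff.1 (lt_of_lt_of_le (by positivity) h1)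

/-- Regularity of f is assumed only on V. On the real line its measurability is recovered by
dividing the integrable bulk integrand by r^(-2) times the product of the G, which is almost
everywhere nonzero. -/
theorem aestronglyMeasurable_testFunction (hh : ∀ i, 0 < h i) (hu : ∀ i, 0 < u i)
    (hf : BulkIntegrable h u z f) :
    AEStronglyMeasurable (fun p : ℝ × ℝ => f p.1 p.2) ((volume.restrict (Ioi 0)).prod volume) := by
  have h1 : AEStronglyMeasurable (fun p : ℝ × ℝ => ((p.1 : ℂ) ^ 2)⁻¹ *
      ∏ i, G (h i) p.1 p.2 (u i) (z i)) ((volume.restrict (Ioi 0)).prod volume) := by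
    refine AEStronglyMeasurable.mul (Measurable.aestronglyMeasurable (by fun_prop)) ?_
    exact Finset.aestronglyMeasurable_fun_prod _ fun i _ => aestronglyMeasurable_G (hh i) (hu i)
  refine ((integrable_bulk hf).aestronglyMeasurable.mul (h1.aemeasurable.inv).aestronglyMeasurable).congr ?_
  have h2 : ∀ i, ∀ᵐ p : ℝ × ℝ ∂(volume.restrict (Ioi 0)).prod volume, p.2 ≠ z i := fun i =>
    Measure.quasiMeasurePreserving_snd.ae (compl_mem_ae_iff.2 (measure_singleton (z i)))
  filter_upwards [Measure.quasiMeasurePreserving_fst.ae (ae_restrict_mem measurableSet_Ioi),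
    ae_all_iff.2 h2] with p hp1 hp2
  have hp : (0 : ℝ) < p.1 := hp1
  have hprod : ∏ i, G (h i) p.1 p.2 (u i) (z i) ≠ 0 :=
    Finset.prod_ne_zero_iff.2 fun i _ => G_ne_zero (hh i) hp (hu i) (hp2 i)
  have hp' : (p.1 : ℂ) ≠ 0 := Complex.ofReal_ne_zero.2 hp.ne'
  simp only [Pi.mul_apply, Pi.inv_apply, bulkIntegrand]
  field_simp

theorem measurable_prod_Ghat {X : Type*} [MeasurableSpace X] {S : X → Fin n → ℝ} {r : X → ℝ}
    {ζ : X → ℂ} (hS : Measurable S) (hr : Measurable r) (hζ : Measurable ζ) (s : Finset (Fin n)) :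
    Measurable fun q => ∏ i ∈ s, Ghat (h i) (r q) (ζ q) (u i) (z i) (wPoint u z (S q) i) :=
  Finset.measurable_fun_prod _ fun i _ => (measurable_Ghat (h i) (u i) (z i)).comp
    (f := fun q => ((r q, ζ q), wPoint u z (S q) i))
    ((hr.prodMk hζ).prodMk ((measurable_wPoint u z i).comp hS))

/-- At distance at least ε i from each point, |Ĝ| is at most C and |G| at least c times one and the
same power, so their quotient is bounded by the density in s i. -/
theorem exists_norm_prod_Ghat_le {ε : Fin n → ℝ} (hε : ∀ i, 0 < ε i) (hh : ∀ i, 0 < h i)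
    (hu : ∀ i, 0 < u i) :
    ∃ C, ∀ s : Fin n → ℝ, (∀ i, s i ∈ Ioo (0 : ℝ) 1) → ∀ r : ℝ, 0 < r →
      ∀ x ∈ puncturedLine z ε, ‖∏ i, Ghat (h i) r x (u i) (z i) (wPoint u z s i)‖ ≤
        C * (∏ i, smearDensity (h i) (s i)) * ‖∏ i, G (h i) r x (u i) (z i)‖ := by
  have hC := fun i => exists_norm_Ghat_off_axis_le (Y := 0) (hh i).le (hu i) (hε i)
  have hc := fun i => exists_le_norm_G (hh i) (hu i)
  choose C hC0 hC using hC
  choose c hc0 hc using hc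
  refine ⟨∏ i, C i / c i, fun s hs r hr x hx => ?_⟩
  rw [norm_prod, norm_prod, ← Finset.prod_mul_distrib, ← Finset.prod_mul_distrib]
  refine Finset.prod_le_prod (fun i _ => norm_nonneg _) fun i _ => ?_
  have hxi : ε i ≤ |x - z i| := by
    by_contra hcon
    refine hx (mem_iUnion.2 ⟨i, ?_⟩)
    rw [Metric.mem_ball, Real.dist_eq]
    exact not_le.1 hcon
  have hD : x - z i ≠ 0 := abs_pos.1 ((hε i).trans_le hxi)
  have h1 := hC i r (z i) x (s i) (hs i) hr (by simpa using hxi) (by simp)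
  have h2 := hc i r (z i) (x - z i) hr hD
  have e : (z i : ℂ) + (x - z i : ℝ) = x := by push_cast; ring
  rw [e] at h2
  rw [Complex.ofReal_re] at h1
  rw [wPoint_eq]
  have hS := smearDensity_nonneg (h := h i) (Ioo_subset_Icc_self (hs i))
  refine h1.trans ?_
  have h3 : (r / (1 + r ^ 2 + (x - z i) ^ 2)) ^ h i ≤ ‖G (h i) r x (u i) (z i)‖ / c i := by
    rw [le_div_iff₀ (hc0 i), mul_comm]; exact h2
  calc _ ≤ C i * smearDensity (h i) (s i) * (‖G (h i) r x (u i) (z i)‖ / c i) :=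
        mul_le_mul_of_nonneg_left h3 (mul_nonneg (hC0 i).le hS)
    _ = _ := by ring

theorem integrable_punctured {ε : Fin n → ℝ} (hε : ∀ i, 0 < ε i) (hh : ∀ i, 0 < h i)
    (hu : ∀ i, 0 < u i) (hf : BulkIntegrable h u z f) :
    Integrable (fun q : (Fin n → ℝ) × (ℝ × ℝ) =>
      ((q.2.1 : ℂ) ^ 2)⁻¹ * hatIntegrand h u z f (wPoint u z q.1) q.2.1 q.2.2)
      ((unitCube n).prod ((volume.restrict (Ioi 0)).prod (volume.restrict (puncturedLine z ε)))) := by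
  have hle : (volume.restrict (Ioi (0 : ℝ))).prod (volume.restrict (puncturedLine z ε)) ≤
      (volume.restrict (Ioi 0)).prod volume := Measure.prod_mono le_rfl Measure.restrict_le_self
  obtain ⟨C, hC⟩ := exists_norm_prod_Ghat_le (z := z) hε hh hu
  have hb := ((integrable_prod_smearDensity hh).const_mul C).mul_prod
    ((integrable_bulk hf).mono_measure hle).norm
  refine hb.mono' ?_ ?_
  · refine AEStronglyMeasurable.mul (Measurable.aestronglyMeasurable (by fun_prop))
      (AEStronglyMeasurable.mul (Measurable.aestronglyMeasurable ?_)
      (((aestronglyMeasurable_testFunction hh hu hf).mono_measure hle).comp_snd))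
    exact measurable_prod_Ghat measurable_fst (by fun_prop) (by fun_prop) _
  · have h1 : ∀ᵐ p : ℝ × ℝ ∂(volume.restrict (Ioi (0 : ℝ))).prod
        (volume.restrict (puncturedLine z ε)), 0 < p.1 ∧ p.2 ∈ puncturedLine z ε := by
      filter_upwards [Measure.quasiMeasurePreserving_fst.ae (ae_restrict_mem measurableSet_Ioi),
        Measure.quasiMeasurePreserving_snd.ae (ae_restrict_mem (measurableSet_puncturedLine z ε))]
        with p h1 h2
      exact ⟨h1, h2⟩
    filter_upwards [Measure.quasiMeasurePreserving_fst.ae (ae_unitCube n),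
      Measure.quasiMeasurePreserving_snd.ae h1] with q hq1 hq2
    have h3 := hC q.1 hq1 q.2.1 hq2.1 q.2.2 hq2.2
    simp only [hatIntegrand, bulkIntegrand, norm_mul] at h3 ⊢
    calc _ ≤ ‖((q.2.1 : ℂ) ^ 2)⁻¹‖ * ((C * ∏ i, smearDensity (h i) (q.1 i)) *
          ‖∏ i, G (h i) q.2.1 q.2.2 (u i) (z i)‖ * ‖f q.2.1 q.2.2‖) := by gcongr
      _ = _ := by ring

theorem integral_prod_Ghat (r : ℝ) (ζ : ℂ) :
    (∏ i, (wHigh u z i - wLow u z i)) *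
      ∫ s, ∏ i, Ghat (h i) r ζ (u i) (z i) (wPoint u z s i) ∂unitCube n =
    ∏ i, segIntegral (wLow u z i) (wHigh u z i) (Ghat (h i) r ζ (u i) (z i)) := by
  have := integral_unitCube_prod fun i ρ => Ghat (h i) r ζ (u i) (z i)
    (wLow u z i + (ρ : ℂ) * (wHigh u z i - wLow u z i))
  unfold wPoint
  rw [this, ← Finset.prod_mul_distrib]
  simp_rw [segIntegral_eq_setIntegral_Icc]

/-- Fubini moves the w-integrals inside, where they factorise, and each of them turns a Ĝ into a G.
-/
theorem integral_punctured {ε : Fin n → ℝ} (hε : ∀ i, 0 < ε i) (hh : ∀ i, 0 < h i)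
    (hu : ∀ i, 0 < u i) (hf : BulkIntegrable h u z f) :
    (∏ i, (wHigh u z i - wLow u z i)) * ∫ s, (∫ r in Ioi (0 : ℝ), ((r : ℂ) ^ 2)⁻¹ *
        ∫ x : ℝ in puncturedLine z ε, hatIntegrand h u z f (wPoint u z s) r x) ∂unitCube n =
      ∫ r in Ioi (0 : ℝ), ((r : ℂ) ^ 2)⁻¹ *
        ∫ x : ℝ in puncturedLine z ε, bulkIntegrand h u z f r x := by
  have hi := integrable_punctured hε hh hu hf
  have hle : (volume.restrict (Ioi (0 : ℝ))).prod (volume.restrict (puncturedLine z ε)) ≤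
      (volume.restrict (Ioi 0)).prod volume := Measure.prod_mono le_rfl Measure.restrict_le_self
  have hbi := (integrable_bulk hf).mono_measure hle
  have e1 : ∫ s, (∫ r in Ioi (0 : ℝ), ((r : ℂ) ^ 2)⁻¹ *
        ∫ x : ℝ in puncturedLine z ε, hatIntegrand h u z f (wPoint u z s) r x) ∂unitCube n =
      ∫ s, (∫ p : ℝ × ℝ, ((p.1 : ℂ) ^ 2)⁻¹ * hatIntegrand h u z f (wPoint u z s) p.1 p.2
        ∂((volume.restrict (Ioi 0)).prod (volume.restrict (puncturedLine z ε)))) ∂unitCube n := by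
    refine integral_congr_ae ?_
    filter_upwards [hi.prod_right_ae] with s hs
    rw [integral_prod _ hs]
    simp_rw [integral_const_mul]
  have e2 : ∫ r in Ioi (0 : ℝ), ((r : ℂ) ^ 2)⁻¹ *
        ∫ x : ℝ in puncturedLine z ε, bulkIntegrand h u z f r x =
      ∫ p : ℝ × ℝ, ((p.1 : ℂ) ^ 2)⁻¹ * bulkIntegrand h u z f p.1 p.2
        ∂((volume.restrict (Ioi 0)).prod (volume.restrict (puncturedLine z ε))) := by
    rw [integral_prod _ hbi]
    simp_rw [integral_const_mul]
  rw [e1, e2, integral_integral_swap (f := fun s (p : ℝ × ℝ) => ((p.1 : ℂ) ^ 2)⁻¹ *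
    hatIntegrand h u z f (wPoint u z s) p.1 p.2) hi, ← integral_const_mul]
  refine integral_congr_ae ?_
  filter_upwards [Measure.quasiMeasurePreserving_fst.ae (ae_restrict_mem measurableSet_Ioi),
        Measure.quasiMeasurePreserving_snd.ae (ae_restrict_mem (measurableSet_puncturedLine z ε))]
        with p h1 h2
  simp only [hatIntegrand, bulkIntegrand, ← mul_assoc, integral_mul_const]
  rw [integral_const_mul, mul_left_comm, integral_prod_Ghat, mul_assoc, mul_assoc]
  congr 2
  refine Finset.prod_congr rfl fun i _ => ?_
  have hxi : p.2 ≠ z i := by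
    rintro h3
    refine h2 (mem_iUnion.2 ⟨i, ?_⟩)
    rw [h3]
    exact Metric.mem_ball_self (hε i)
  exact segIntegral_Ghat_eq_G (hh i) h1 (hu i) hxi

end Punctured

/-! ### Radial majorants and the legs of the bumps. -/

/-- The radial majorant of a single propagator. -/
noncomputable def radialBound (h η r : ℝ) : ℝ := if r ≤ 1 then r ^ (1 - h - η) else r ^ (-h)

/-- The radial majorant of the whole integrand. -/
noncomputable def radialMajorant (η r : ℝ) : ℝ := if r ≤ 1 then r ^ (-1 + η) else r ^ (-1 - η)

theorem integrableOn_radialMajorant {η : ℝ} (hη : 0 < η) :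
    IntegrableOn (radialMajorant η) (Ioi 0) := by
  rw [← Ioc_union_Ioi_eq_Ioi zero_le_one]
  refine IntegrableOn.union ?_ ?_
  · refine IntegrableOn.congr_fun ((intervalIntegrable_iff_integrableOn_Ioc_of_le zero_le_one).1
      (intervalIntegral.intervalIntegrable_rpow' (by linarith : -1 < -1 + η)))
      (fun r hr => ?_) measurableSet_Ioc
    exact (if_pos hr.2).symm
  · refine IntegrableOn.congr_fun (integrableOn_Ioi_rpow_of_lt (by linarith : -1 - η < -1) one_pos)
      (fun r hr => ?_) measurableSet_Ioi
    exact (if_neg (not_le.2 hr)).symm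

theorem rpow_div_le_of_le_one {h r D : ℝ} (hh : 0 ≤ h) (hr : 0 < r) :
    (r / (1 + r ^ 2 + D ^ 2)) ^ h ≤ r ^ h := by
  refine Real.rpow_le_rpow (by positivity) (div_le_self hr.le ?_) hh
  nlinarith [sq_nonneg r, sq_nonneg D]

theorem rpow_div_le_rpow_neg {h r D : ℝ} (hh : 0 ≤ h) (hr : 0 < r) :
    (r / (1 + r ^ 2 + D ^ 2)) ^ h ≤ r ^ (-h) := by
  rw [Real.rpow_neg hr.le, ← Real.inv_rpow hr.le]
  refine Real.rpow_le_rpow (by positivity) ?_ hh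
  rw [div_le_iff₀ (by positivity)]
  field_simp
  nlinarith [sq_nonneg D]

/-- For r ≤ 1 this compares r^h with r^(1-h-η), which uses h > 1/2. -/
theorem rpow_div_le_radialBound {h η r D : ℝ} (hh : 1 / 2 < h) (hη : 0 < η) (hr : 0 < r) :
    (r / (1 + r ^ 2 + D ^ 2)) ^ h ≤ radialBound h η r := by
  unfold radialBound
  split_ifs with h1
  · exact (rpow_div_le_of_le_one (by linarith) hr).trans
      (Real.rpow_le_rpow_of_exponent_ge hr h1 (by linarith))
  · exact rpow_div_le_rpow_neg (by linarith) hr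

theorem norm_kernel_ofReal_le_rpow_neg {h u : ℝ} (hh : 0 ≤ h) (hu : 0 < u) (x : ℝ) :
    ‖kernel h u x‖ ≤ u ^ (-h) := by
  have hpos : 0 < u ^ 2 + x ^ 2 := by positivity
  have e : (u : ℂ) / ((u : ℂ) ^ 2 + (x : ℂ) ^ 2) = ((u / (u ^ 2 + x ^ 2) : ℝ) : ℂ) := by
    push_cast; rfl
  rw [kernel, e, Complex.norm_cpow_real, Complex.norm_of_nonneg (by positivity),
    Real.rpow_neg hu.le, ← Real.inv_rpow hu.le]
  refine Real.rpow_le_rpow (by positivity) ?_ hh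
  rw [div_le_iff₀ hpos]
  field_simp
  nlinarith [sq_nonneg x]

theorem integrableOn_abs_rpow {η : ℝ} (hη : 0 < η) {ε : ℝ} (hε : 0 < ε) :
    IntegrableOn (fun τ : ℝ => |ε * (2 * τ - 1)| ^ (-1 + η)) (Ioc 0 1) := by
  have h1 : IntervalIntegrable (fun x : ℝ => (x : ℂ) ^ ((-1 + η : ℝ) : ℂ)) volume (-ε) ε :=
    intervalIntegral.intervalIntegrable_cpow' (by simpa using hη)
  have h2 := (h1.norm.comp_add_right (-ε)).comp_mul_left (c := 2 * ε)
  have e1 : (-ε - -ε) / (2 * ε) = 0 := by simp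
  have e2 : (ε - -ε) / (2 * ε) = 1 := by field_simp; ring
  rw [e1, e2, intervalIntegrable_iff_integrableOn_Ioc_of_le zero_le_one] at h2
  refine h2.congr_fun_ae ?_
  have h3 : ∀ᵐ τ : ℝ ∂volume.restrict (Ioc 0 1), τ ≠ 1 / 2 :=
    ae_restrict_of_ae (compl_mem_ae_iff.2 (measure_singleton _))
  filter_upwards [h3] with τ hτ
  have h4 : 2 * ε * τ + -ε ≠ 0 := by
    rw [show 2 * ε * τ + -ε = 2 * ε * (τ - 1 / 2) by ring]
    exact mul_ne_zero (by positivity) (sub_ne_zero.2 hτ)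
  rw [Complex.norm_cpow_real, Complex.norm_real, Real.norm_eq_abs]
  congr 2; ring

/-- A family of straight legs, from `A w` to `B w`, for `w` in the segment `[z - i u, z + i u]`, that
stays in a rectangle around the segment, with an integrable bound for the propagator along the leg. -/
structure IsLeg (h u z ε : ℝ) (A B : ℂ → ℂ) : Prop where
  continuous_left : Continuous A
  continuous_right : Continuous B
  mem : ∀ y ∈ Icc (-u) u, ∀ τ ∈ Icc (0 : ℝ) 1, ∀ w : ℂ, w = z + y * Complex.I →
    |(A w + τ * (B w - A w)).re - z| ≤ ε ∧ |(A w + τ * (B w - A w)).im| ≤ u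
  bound : ∀ η ∈ Ioc (0 : ℝ) 1, ∃ χ : ℝ → ℝ, IntegrableOn χ (Ioc 0 1) ∧
    ∀ᵐ τ : ℝ ∂(volume.restrict (Ioc (0 : ℝ) 1)), ∀ y ∈ Icc (-u) u, ∀ r : ℝ, 0 < r → ∀ w : ℂ,
      w = z + y * Complex.I → ‖kernel h r (A w + τ * (B w - A w) - w)‖ ≤ χ τ * radialBound h η r

theorem radialBound_nonneg {r : ℝ} (h η : ℝ) (hr : 0 < r) : 0 ≤ radialBound h η r := by
  unfold radialBound
  split_ifs <;> positivity

/-- On this leg z - w keeps real part -ε, so the off-axis bound holds with a constant χ. -/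
theorem isLeg_left {h u z ε : ℝ} (hh : 1 / 2 < h) (hε : 0 < ε) :
    IsLeg h u z ε (fun _ => z - ε) (fun w => w - ε) where
  continuous_left := continuous_const
  continuous_right := by fun_prop
  mem y hy τ hτ w hw := by
    subst hw
    have e : (z - ε + τ * (z + y * Complex.I - ε - (z - ε)) : ℂ) =
        (z - ε : ℝ) + (τ * y : ℝ) * Complex.I := by push_cast; ring
    rw [e]
    constructor
    · simp [abs_of_pos hε]
    · simp only [Complex.add_im, Complex.ofReal_im, Complex.im_ofReal_mul,
        Complex.I_im, mul_one, zero_add, abs_mul, abs_of_nonneg hτ.1]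
      exact (mul_le_of_le_one_left (abs_nonneg y) hτ.2).trans (abs_le.2 hy)
  bound η hη := by
    obtain ⟨C, hC, hk⟩ := exists_norm_kernel_off_axis_le (h := h) (Y := u) (by linarith) hε
    refine ⟨fun _ => C, integrableOn_const (by simp), ?_⟩
    filter_upwards [ae_restrict_mem measurableSet_Ioc] with τ hτ y hy r hr w hw
    subst hw
    have e : (z - ε + τ * (z + y * Complex.I - ε - (z - ε)) - (z + y * Complex.I) : ℂ) =
        (-ε : ℝ) + ((τ - 1) * y : ℝ) * Complex.I := by push_cast; ring
    rw [e]
    refine (hk r (-ε) _ hr (by rw [abs_neg, abs_of_pos hε]) ?_).trans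
      (mul_le_mul_of_nonneg_left (rpow_div_le_radialBound hh hη.1 hr) hC.le)
    rw [abs_mul, abs_sub_comm, abs_of_nonneg (sub_nonneg.2 hτ.2)]
    exact (mul_le_of_le_one_left (abs_nonneg y) (by linarith [hτ.1])).trans (abs_le.2 hy)

theorem isLeg_right {h u z ε : ℝ} (hh : 1 / 2 < h) (hε : 0 < ε) :
    IsLeg h u z ε (fun w => w + ε) (fun _ => z + ε) where
  continuous_left := by fun_prop
  continuous_right := continuous_const
  mem y hy τ hτ w hw := by
    subst hw
    have e : (z + y * Complex.I + ε + τ * (z + ε - (z + y * Complex.I + ε)) : ℂ) =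
        (z + ε : ℝ) + ((1 - τ) * y : ℝ) * Complex.I := by push_cast; ring
    rw [e]
    constructor
    · simp [abs_of_pos hε]
    · simp only [Complex.add_im, Complex.ofReal_im, Complex.im_ofReal_mul,
        Complex.I_im, mul_one, zero_add, abs_mul, abs_of_nonneg (sub_nonneg.2 hτ.2)]
      exact (mul_le_of_le_one_left (abs_nonneg y) (by linarith [hτ.1])).trans (abs_le.2 hy)
  bound η hη := by
    obtain ⟨C, hC, hk⟩ := exists_norm_kernel_off_axis_le (h := h) (Y := u) (by linarith) hε
    refine ⟨fun _ => C, integrableOn_const (by simp), ?_⟩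
    filter_upwards [ae_restrict_mem measurableSet_Ioc] with τ hτ y hy r hr w hw
    subst hw
    have e : (z + y * Complex.I + ε + τ * (z + ε - (z + y * Complex.I + ε)) -
        (z + y * Complex.I) : ℂ) = (ε : ℝ) + (-τ * y : ℝ) * Complex.I := by push_cast; ring
    rw [e]
    refine (hk r ε _ hr (by rw [abs_of_pos hε]) ?_).trans
      (mul_le_mul_of_nonneg_left (rpow_div_le_radialBound hh hη.1 hr) hC.le)
    rw [abs_mul, abs_neg, abs_of_nonneg hτ.1.le]
    exact (mul_le_of_le_one_left (abs_nonneg y) hτ.2).trans (abs_le.2 hy)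

/-- This leg passes through w itself. For r ≤ 1 some decay in r is given up so that only the
integrable singularity |x|^(-1+η) remains; for r > 1 the bound r^(-h) is enough. -/
theorem isLeg_top {h u z ε : ℝ} (hh : 1 / 2 < h) (hε : 0 < ε) :
    IsLeg h u z ε (fun w => w - ε) (fun w => w + ε) where
  continuous_left := by fun_prop
  continuous_right := by fun_prop
  mem y hy τ hτ w hw := by
    subst hw
    have e : (z + y * Complex.I - ε + τ * (z + y * Complex.I + ε - (z + y * Complex.I - ε)) : ℂ) =
        (z + ε * (2 * τ - 1) : ℝ) + y * Complex.I := by push_cast; ring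
    rw [e]
    constructor
    · simp only [Complex.add_re, Complex.ofReal_re, Complex.re_ofReal_mul, Complex.I_re, mul_zero,
        add_zero, add_sub_cancel_left, abs_mul, abs_of_pos hε]
      refine mul_le_of_le_one_right hε.le (abs_le.2 ⟨?_, ?_⟩) <;> linarith [hτ.1, hτ.2]
    · simpa using abs_le.2 hy
  bound η hη := by
    refine ⟨fun τ => 1 + |ε * (2 * τ - 1)| ^ (-1 + η),
      (integrableOn_const (by simp)).add (integrableOn_abs_rpow hη.1 hε), ?_⟩
    have h3 : ∀ᵐ τ : ℝ ∂volume.restrict (Ioc 0 1), τ ≠ 1 / 2 :=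
      ae_restrict_of_ae (compl_mem_ae_iff.2 (measure_singleton _))
    filter_upwards [h3] with τ hτ y hy r hr w hw
    subst hw
    have e : (z + y * Complex.I - ε + τ * (z + y * Complex.I + ε - (z + y * Complex.I - ε)) -
        (z + y * Complex.I) : ℂ) = (ε * (2 * τ - 1) : ℝ) := by push_cast; ring
    rw [e]
    have hx : ε * (2 * τ - 1) ≠ 0 :=
      mul_ne_zero hε.ne' fun h0 => hτ (by linarith)
    have hx0 : 0 ≤ |ε * (2 * τ - 1)| ^ (-1 + η) := by positivity
    unfold radialBound
    split_ifs with h1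
    · refine (norm_kernel_ofReal_le hh.le hη.1.le hη.2 hr hx).trans ?_
      rw [mul_comm]
      exact mul_le_mul_of_nonneg_right (by linarith) (by positivity)
    · refine (norm_kernel_ofReal_le_rpow_neg (by linarith) hr _).trans ?_
      exact le_mul_of_one_le_left (by positivity) (by linarith)

/-- Count of exponents: for r ≤ 1 the total is -1 + δ - η ≥ -1 + η, and for r > 1 it is -2 - S - h +
c ≤ -1 - η. This is where the two growth conditions on f are used. -/
theorem radial_product_le_radialMajorant {h η δ c S r : ℝ} (hδ : 2 * η ≤ δ)
    (hc : η ≤ 1 + (h + S) - c) (hr : 0 < r) :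
    (r ^ 2)⁻¹ * ((if r ≤ 1 then r ^ S else r ^ (-S)) * radialBound h η r *
      (if r ≤ 1 then r ^ (h - S + δ) else r ^ c)) ≤ radialMajorant η r := by
  have h2 : (r ^ 2)⁻¹ = r ^ (-2 : ℝ) := by
    rw [Real.rpow_neg hr.le, Real.rpow_two]
  rw [h2]
  unfold radialBound radialMajorant
  split_ifs with h1
  · rw [← Real.rpow_add hr, ← Real.rpow_add hr, ← Real.rpow_add hr]
    exact Real.rpow_le_rpow_of_exponent_ge hr h1 (by linarith)
  · rw [← Real.rpow_add hr, ← Real.rpow_add hr, ← Real.rpow_add hr]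
    exact Real.rpow_le_rpow_of_exponent_le (not_le.1 h1).le (by linarith)

/-- The regularity and the bounds that a test function has on the complex neighbourhood `V`. -/
structure IsRegularOn {n : ℕ} (h : Fin n → ℝ) (f : ℝ → ℂ → ℂ) (V : Set ℂ) : Prop where
  isOpen : IsOpen V
  continuousOn : ContinuousOn (fun p : ℝ × ℂ => f p.1 p.2) (Ioi (0 : ℝ) ×ˢ V)
  differentiableOn : ∀ r : ℝ, 0 < r → DifferentiableOn ℂ (f r) V
  bound_zero : ∀ k, ∃ δ > (0 : ℝ), ∃ M : ℝ, ∀ r ∈ Ioc (0 : ℝ) 1, ∀ ζ ∈ V,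
    ‖f r ζ‖ ≤ M * r ^ (h k - ∑ i ∈ Finset.univ.erase k, h i + δ)
  bound_infty : ∃ c < 1 + ∑ i, h i, ∃ M : ℝ, ∀ r : ℝ, 1 ≤ r → ∀ ζ ∈ V, ‖f r ζ‖ ≤ M * r ^ c

/-- Widths for which the contours around different points are disjoint and stay in `V`. -/
structure IsSmallWidth {n : ℕ} (u z ε : Fin n → ℝ) (V : Set ℂ) : Prop where
  pos : ∀ i, 0 < ε i
  add_le : ∀ i k, i ≠ k → ε i + ε k ≤ |z i - z k|
  mem : ∀ k, ∀ ζ : ℂ, |ζ.re - z k| ≤ ε k → |ζ.im| ≤ u k → ζ ∈ V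

section Leg

variable {n : ℕ} {h u z ε : Fin n → ℝ} {f : ℝ → ℂ → ℂ} {V : Set ℂ} {k : Fin n} {A B : ℂ → ℂ}

theorem IsSmallWidth.le_abs_re_sub (hε : IsSmallWidth u z ε V) {i k : Fin n} (hik : i ≠ k) {ζ : ℂ}
    (hζ : |ζ.re - z k| ≤ ε k) : ε i ≤ |ζ.re - z i| := by
  have h1 := hε.add_le i k hik
  have h2 := abs_sub_le (z i) ζ.re (z k)
  rw [abs_sub_comm (z i) ζ.re] at h2
  linarith

theorem IsRegularOn.exists_norm_le (hV : IsRegularOn h f V) (k : Fin n) :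
    ∃ δ > (0 : ℝ), ∃ c < 1 + ∑ i, h i, ∃ M, 0 ≤ M ∧ ∀ r : ℝ, 0 < r → ∀ ζ ∈ V, ‖f r ζ‖ ≤
      M * (if r ≤ 1 then r ^ (h k - ∑ i ∈ Finset.univ.erase k, h i + δ) else r ^ c) := by
  obtain ⟨δ, hδ, M, hM⟩ := hV.bound_zero k
  obtain ⟨c, hc, M', hM'⟩ := hV.bound_infty
  refine ⟨δ, hδ, c, hc, |M| + |M'|, by positivity, fun r hr ζ hζ => ?_⟩
  split_ifs with h1
  · refine (hM r ⟨hr, h1⟩ ζ hζ).trans (mul_le_mul_of_nonneg_right ?_ (by positivity))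
    linarith [le_abs_self M, abs_nonneg M']
  · refine (hM' r (not_le.1 h1).le ζ hζ).trans (mul_le_mul_of_nonneg_right ?_ (by positivity))
    linarith [le_abs_self M', abs_nonneg M]

/-- On the k-th bump only the k-th propagator can be singular; the others keep the distance ε i from
their points and contribute a power r^(h i) or r^(-h i). -/
theorem exists_norm_hatIntegrand_leg_le (hh : ∀ i, 1 / 2 < h i) (hu : ∀ i, 0 < u i)
    (hV : IsRegularOn h f V) (hε : IsSmallWidth u z ε V)
    (hL : IsLeg (h k) (u k) (z k) (ε k) A B) :
    ∃ η > (0 : ℝ), ∃ C : ℝ, ∃ χ : ℝ → ℝ, IntegrableOn χ (Ioc 0 1) ∧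
      ∀ᵐ τ : ℝ ∂(volume.restrict (Ioc (0 : ℝ) 1)), ∀ r : ℝ, 0 < r → ∀ s : Fin n → ℝ,
        (∀ i, s i ∈ Ioo (0 : ℝ) 1) → ∀ w : ℂ, w = wPoint u z s k →
        ‖((r : ℂ) ^ 2)⁻¹ * hatIntegrand h u z f (wPoint u z s) r (A w + τ * (B w - A w))‖ ≤
          C * (∏ i, smearDensity (h i) (s i)) * (radialMajorant η r * χ τ) := by
  obtain ⟨δ, hδ, c, hc, M, hM0, hM⟩ := hV.exists_norm_le k
  set S := ∑ i ∈ Finset.univ.erase k, h i with hS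
  have hsum : ∑ i, h i = h k + S := (Finset.add_sum_erase _ _ (Finset.mem_univ k)).symm
  -- η is at most half the margin at r → 0, at most the margin at infinity, and at most 1 as `IsLeg`
  -- requires.
  set η := min 1 (min (δ / 2) (1 + (h k + S) - c)) with hη
  have hη0 : 0 < η := lt_min one_pos (lt_min (by linarith) (by linarith))
  have hη1 : 2 * η ≤ δ := by
    have : η ≤ δ / 2 := (min_le_right _ _).trans (min_le_left _ _)
    linarith
  have hη2 : η ≤ 1 + (h k + S) - c := (min_le_right _ _).trans (min_le_right _ _)
  obtain ⟨χ, hχ, hb⟩ := hL.bound η ⟨hη0, min_le_left _ _⟩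
  have hC := fun i => exists_norm_Ghat_off_axis_le (Y := u k) (h := h i) (by linarith [hh i])
    (hu i) (hε.pos i)
  choose C hC0 hC using hC
  refine ⟨η, hη0, M * (‖smearConst (h k)‖ * (4 * u k) ^ (h k - 1)) *
    ∏ i ∈ Finset.univ.erase k, C i, fun τ => |χ τ|, hχ.abs, ?_⟩
  filter_upwards [hb, ae_restrict_mem measurableSet_Ioc] with τ hτ hτ1 r hr s hs w hw
  set y := u k * (2 * s k - 1) with hy
  have hyk : y ∈ Icc (-u k) (u k) := by
    have := hu k
    constructor <;> nlinarith [(hs k).1, (hs k).2]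
  rw [wPoint_eq] at hw
  obtain ⟨hre, him⟩ := hL.mem y hyk τ (Ioc_subset_Icc_self hτ1) w hw
  have hker := hτ y hyk r hr w hw
  set ζ := A w + τ * (B w - A w) with hζ
  have h1 := norm_Ghat_eq (h := h k) (hu k) (hs k) r (z k) ζ
  rw [← hw] at h1
  have h2 : ‖Ghat (h k) r ζ (u k) (z k) w‖ ≤ ‖smearConst (h k)‖ * (4 * u k) ^ (h k - 1) *
      smearDensity (h k) (s k) * (|χ τ| * radialBound (h k) η r) := by
    rw [h1]
    have := hu k
    refine mul_le_mul_of_nonneg_left (hker.trans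
      (mul_le_mul_of_nonneg_right (le_abs_self _) (radialBound_nonneg _ _ hr))) ?_
    have := smearDensity_nonneg (h := h k) (Ioo_subset_Icc_self (hs k))
    positivity
  have h3 : ‖∏ i ∈ Finset.univ.erase k, Ghat (h i) r ζ (u i) (z i) (wPoint u z s i)‖ ≤
      (∏ i ∈ Finset.univ.erase k, C i) * (∏ i ∈ Finset.univ.erase k, smearDensity (h i) (s i)) *
        (if r ≤ 1 then r ^ S else r ^ (-S)) := by
    have e : (if r ≤ 1 then r ^ S else r ^ (-S)) =
        ∏ i ∈ Finset.univ.erase k, (if r ≤ 1 then r ^ h i else r ^ (-h i)) := by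
      split_ifs
      · exact Real.rpow_sum_of_pos hr _ _
      · rw [hS, ← Finset.sum_neg_distrib]
        exact Real.rpow_sum_of_pos hr _ _
    rw [norm_prod, e, ← Finset.prod_mul_distrib, ← Finset.prod_mul_distrib]
    refine Finset.prod_le_prod (fun i _ => norm_nonneg _) fun i hi => ?_
    rw [wPoint_eq]
    refine (hC i r (z i) ζ (s i) (hs i) hr
      (hε.le_abs_re_sub (Finset.ne_of_mem_erase hi) hre) him).trans
      (mul_le_mul_of_nonneg_left ?_ (mul_nonneg (hC0 i).le
        (smearDensity_nonneg (Ioo_subset_Icc_self (hs i)))))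
    have hhi : 0 ≤ h i := by linarith [hh i]
    split_ifs
    · exact rpow_div_le_of_le_one hhi hr
    · exact rpow_div_le_rpow_neg hhi hr
  have h4 := hM r hr ζ (hε.mem k ζ hre him)
  have h5 := radial_product_le_radialMajorant (h := h k) hη1 hη2 hr
  have hn : ‖((r : ℂ) ^ 2)⁻¹‖ = (r ^ 2)⁻¹ := by
    rw [norm_inv, norm_pow, Complex.norm_of_nonneg hr.le]
  have hw' : wPoint u z s k = w := by rw [wPoint_eq, hw]
  rw [hatIntegrand, ← Finset.mul_prod_erase _ _ (Finset.mem_univ k), hw', norm_mul, norm_mul,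
    norm_mul, hn, ← Finset.mul_prod_erase _ (fun i => smearDensity (h i) (s i)) (Finset.mem_univ k)]
  have hd : ∀ i, 0 ≤ smearDensity (h i) (s i) := fun i =>
    smearDensity_nonneg (Ioo_subset_Icc_self (hs i))
  have hd' := Finset.prod_nonneg fun i (_ : i ∈ Finset.univ.erase k) => hd i
  have hdk := hd k
  have hC' := Finset.prod_nonneg fun i (_ : i ∈ Finset.univ.erase k) => (hC0 i).le
  have huk := hu k
  have hrb := radialBound_nonneg (h k) η hr
  calc _ ≤ (r ^ 2)⁻¹ * ((‖smearConst (h k)‖ * (4 * u k) ^ (h k - 1) *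
        smearDensity (h k) (s k) * (|χ τ| * radialBound (h k) η r)) *
        ((∏ i ∈ Finset.univ.erase k, C i) * (∏ i ∈ Finset.univ.erase k, smearDensity (h i) (s i)) *
        (if r ≤ 1 then r ^ S else r ^ (-S))) *
        (M * (if r ≤ 1 then r ^ (h k - S + δ) else r ^ c))) := by
        refine mul_le_mul_of_nonneg_left (mul_le_mul (mul_le_mul h2 h3 (norm_nonneg _)
          (by positivity)) h4 (norm_nonneg _) ?_) (by positivity)
        split_ifs <;> positivity
    _ = M * (‖smearConst (h k)‖ * (4 * u k) ^ (h k - 1)) * (∏ i ∈ Finset.univ.erase k, C i) *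
        (smearDensity (h k) (s k) * ∏ i ∈ Finset.univ.erase k, smearDensity (h i) (s i)) * |χ τ| *
        ((r ^ 2)⁻¹ * ((if r ≤ 1 then r ^ S else r ^ (-S)) * radialBound (h k) η r *
          (if r ≤ 1 then r ^ (h k - S + δ) else r ^ c))) := by ring
    _ ≤ M * (‖smearConst (h k)‖ * (4 * u k) ^ (h k - 1)) * (∏ i ∈ Finset.univ.erase k, C i) *
        (smearDensity (h k) (s k) * ∏ i ∈ Finset.univ.erase k, smearDensity (h i) (s i)) * |χ τ| *
        radialMajorant η r := mul_le_mul_of_nonneg_left h5 (by positivity)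
    _ = _ := by ring

open Classical in
theorem integrable_leg (hh : ∀ i, 1 / 2 < h i) (hu : ∀ i, 0 < u i)
    (hV : IsRegularOn h f V) (hε : IsSmallWidth u z ε V)
    (hL : IsLeg (h k) (u k) (z k) (ε k) A B) :
    Integrable (fun q : (Fin n → ℝ) × (ℝ × ℝ) => ((q.2.1 : ℂ) ^ 2)⁻¹ *
      hatIntegrand h u z f (wPoint u z q.1) q.2.1
        (A (wPoint u z q.1 k) + q.2.2 * (B (wPoint u z q.1 k) - A (wPoint u z q.1 k))))
      ((unitCube n).prod ((volume.restrict (Ioi 0)).prod (volume.restrict (Ioc 0 1)))) := by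
  obtain ⟨η, hη, C, χ, hχ, hb⟩ := exists_norm_hatIntegrand_leg_le hh hu hV hε hL
  have hbi := ((integrable_prod_smearDensity (h := h) fun i => by linarith [hh i]).const_mul C).mul_prod
    ((integrableOn_radialMajorant hη).mul_prod hχ)
  have hA := hL.continuous_left.measurable
  have hB := hL.continuous_right.measurable
  have hw : Measurable fun q : (Fin n → ℝ) × (ℝ × ℝ) => wPoint u z q.1 k :=
    (measurable_wPoint u z k).comp measurable_fst
  have hγ : Measurable fun q : (Fin n → ℝ) × (ℝ × ℝ) =>
      A (wPoint u z q.1 k) + q.2.2 * (B (wPoint u z q.1 k) - A (wPoint u z q.1 k)) :=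
    (hA.comp hw).add (Measurable.mul (by fun_prop) ((hB.comp hw).sub (hA.comp hw)))
  have hr : Measurable fun q : (Fin n → ℝ) × (ℝ × ℝ) => q.2.1 := by fun_prop
  -- Since f is controlled only on V, it is extended by zero for measurability; the leg stays in V,
  -- so nothing changes almost everywhere.
  have hfm : Measurable ((Ioi (0 : ℝ) ×ˢ V).piecewise (fun p : ℝ × ℂ => f p.1 p.2) fun _ => 0) :=
    hV.continuousOn.measurable_piecewise continuousOn_const
      (measurableSet_Ioi.prod hV.isOpen.measurableSet)
  have haeq : ∀ᵐ q : (Fin n → ℝ) × (ℝ × ℝ) ∂(unitCube n).prod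
      ((volume.restrict (Ioi 0)).prod (volume.restrict (Ioc 0 1))), (∀ i, q.1 i ∈ Ioo (0 : ℝ) 1) ∧
        0 < q.2.1 ∧ q.2.2 ∈ Ioc (0 : ℝ) 1 := by
    filter_upwards [Measure.quasiMeasurePreserving_fst.ae (ae_unitCube n),
      Measure.quasiMeasurePreserving_snd.ae (Measure.quasiMeasurePreserving_fst.ae
        (ae_restrict_mem measurableSet_Ioi)),
      Measure.quasiMeasurePreserving_snd.ae (Measure.quasiMeasurePreserving_snd.ae
        (ae_restrict_mem measurableSet_Ioc))] with q h1 h2 h3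
    exact ⟨h1, h2, h3⟩
  refine hbi.mono' ?_ ?_
  · have hm : Measurable fun q : (Fin n → ℝ) × (ℝ × ℝ) => ((q.2.1 : ℂ) ^ 2)⁻¹ *
      ((∏ i, Ghat (h i) q.2.1 (A (wPoint u z q.1 k) + q.2.2 * (B (wPoint u z q.1 k) -
          A (wPoint u z q.1 k))) (u i) (z i) (wPoint u z q.1 i)) *
        (Ioi (0 : ℝ) ×ˢ V).piecewise (fun p : ℝ × ℂ => f p.1 p.2) (fun _ => 0)
          (q.2.1, A (wPoint u z q.1 k) + q.2.2 * (B (wPoint u z q.1 k) -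
          A (wPoint u z q.1 k)))) :=
      Measurable.mul (by fun_prop)
        ((measurable_prod_Ghat measurable_fst hr hγ _).mul (hfm.comp (hr.prodMk hγ)))
    refine hm.aestronglyMeasurable.congr ?_
    filter_upwards [haeq] with q hq
    have hyk : u k * (2 * q.1 k - 1) ∈ Icc (-u k) (u k) := by
      have := hu k
      constructor <;> nlinarith [(hq.1 k).1, (hq.1 k).2]
    have hmem := hL.mem _ hyk _ (Ioc_subset_Icc_self hq.2.2) _ (wPoint_eq u z q.1 k)
    rw [hatIntegrand, Set.piecewise_eq_of_mem]
    exact ⟨hq.2.1, hε.mem k _ hmem.1 hmem.2⟩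
  · filter_upwards [haeq, Measure.quasiMeasurePreserving_snd.ae
      (Measure.quasiMeasurePreserving_snd.ae hb)] with q hq hq2
    exact hq2 q.2.1 hq.2.1 q.1 hq.1 _ rfl

end Leg

/-! ### Exchanging integrations along a leg. -/

theorem integrable_prod_rotate {X Y Z : Type*} [MeasurableSpace X] [MeasurableSpace Y]
    [MeasurableSpace Z] {μ : Measure X} {ν : Measure Y} {T : Measure Z} [SFinite μ] [SFinite ν]
    [SFinite T] {F : X × (Y × Z) → ℂ} (hF : Integrable F (μ.prod (ν.prod T))) :
    Integrable (fun q : Y × (X × Z) => F (q.2.1, (q.1, q.2.2))) (ν.prod (μ.prod T)) := by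
  have h1 := (measurePreserving_prodAssoc ν μ T).symm
  have h2 : MeasurePreserving (Prod.map Prod.swap id) ((ν.prod μ).prod T) ((μ.prod ν).prod T) :=
    Measure.measurePreserving_swap.prod (MeasurePreserving.id T)
  have h3 := (measurePreserving_prodAssoc μ ν T).comp (h2.comp h1)
  exact h3.integrable_comp_of_integrable hF

section Leg

variable {n : ℕ} {h u z ε : Fin n → ℝ} {f : ℝ → ℂ → ℂ} {V : Set ℂ} {k : Fin n} {A B : ℂ → ℂ}

/-- `f` times all propagators except the `k`-th, each integrated over its segment. -/
noncomputable def smearedOthers (h u z : Fin n → ℝ) (f : ℝ → ℂ → ℂ) (k : Fin n) (r : ℝ) (ζ : ℂ) :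
    ℂ :=
  (∏ i ∈ Finset.univ.erase k,
    segIntegral (wLow u z i) (wHigh u z i) (Ghat (h i) r ζ (u i) (z i))) * f r ζ

theorem IsLeg.norm_sub_le {h u z ε : ℝ} (hL : IsLeg h u z ε A B) {y : ℝ} (hy : y ∈ Icc (-u) u)
    {w : ℂ} (hw : w = z + y * Complex.I) : ‖B w - A w‖ ≤ 2 * (ε + u) := by
  obtain ⟨h1, h2⟩ := hL.mem y hy 0 (by simp) w hw
  obtain ⟨h3, h4⟩ := hL.mem y hy 1 (by simp) w hw
  simp only [Complex.ofReal_zero, zero_mul, add_zero, Complex.ofReal_one, one_mul,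
    add_sub_cancel] at h1 h2 h3 h4
  refine (Complex.norm_le_abs_re_add_abs_im _).trans ?_
  rw [Complex.sub_re, Complex.sub_im]
  have h5 := abs_sub_le (B w).re z (A w).re
  rw [abs_sub_comm z] at h5
  have h6 := abs_sub (B w).im (A w).im
  linarith

theorem integrable_leg_mul (hh : ∀ i, 1 / 2 < h i) (hu : ∀ i, 0 < u i)
    (hV : IsRegularOn h f V) (hε : IsSmallWidth u z ε V)
    (hL : IsLeg (h k) (u k) (z k) (ε k) A B) :
    Integrable (fun q : (Fin n → ℝ) × (ℝ × ℝ) => ((q.2.1 : ℂ) ^ 2)⁻¹ *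
      ((B (wPoint u z q.1 k) - A (wPoint u z q.1 k)) * hatIntegrand h u z f (wPoint u z q.1) q.2.1
        (A (wPoint u z q.1 k) + q.2.2 * (B (wPoint u z q.1 k) - A (wPoint u z q.1 k)))))
      ((unitCube n).prod ((volume.restrict (Ioi 0)).prod (volume.restrict (Ioc 0 1)))) := by
  have hw : Measurable fun q : (Fin n → ℝ) × (ℝ × ℝ) => wPoint u z q.1 k :=
    (measurable_wPoint u z k).comp measurable_fst
  have hm := (hL.continuous_right.measurable.comp hw).sub (hL.continuous_left.measurable.comp hw)
  refine ((integrable_leg hh hu hV hε hL).bdd_mul (c := 2 * (ε k + u k)) hm.aestronglyMeasurable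
    ?_).congr (ae_of_all _ fun q => mul_left_comm _ _ _)
  filter_upwards [Measure.quasiMeasurePreserving_fst.ae (ae_unitCube n)] with q hq
  refine hL.norm_sub_le (y := u k * (2 * q.1 k - 1)) ?_ (wPoint_eq u z q.1 k)
  have := hu k
  constructor <;> nlinarith [(hq k).1, (hq k).2]

theorem integral_leg_eq (F : ℂ → ℂ) (c a b : ℂ) :
    ∫ τ in Ioc (0 : ℝ) 1, c * ((b - a) * F (a + τ * (b - a))) = c * segIntegral a b F := by
  rw [segIntegral, intervalIntegral.integral_of_le zero_le_one, integral_const_mul,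
    integral_const_mul]

theorem integrable_leg_segIntegral (hh : ∀ i, 1 / 2 < h i) (hu : ∀ i, 0 < u i)
    (hV : IsRegularOn h f V) (hε : IsSmallWidth u z ε V)
    (hL : IsLeg (h k) (u k) (z k) (ε k) A B) :
    Integrable (fun q : (Fin n → ℝ) × ℝ => ((q.2 : ℂ) ^ 2)⁻¹ *
      segIntegral (A (wPoint u z q.1 k)) (B (wPoint u z q.1 k))
        (hatIntegrand h u z f (wPoint u z q.1) q.2))
      ((unitCube n).prod (volume.restrict (Ioi 0))) := by
  have h1 := (measurePreserving_prodAssoc (unitCube n) (volume.restrict (Ioi (0 : ℝ)))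
    (volume.restrict (Ioc (0 : ℝ) 1))).integrable_comp_of_integrable
      (integrable_leg_mul hh hu hV hε hL)
  refine h1.integral_prod_left.congr (ae_of_all _ fun q => ?_)
  exact integral_leg_eq (hatIntegrand h u z f (wPoint u z q.1) q.2) ((q.2 : ℂ) ^ 2)⁻¹
    (A (wPoint u z q.1 k)) (B (wPoint u z q.1 k))

theorem ae_segIntegrable_leg (hh : ∀ i, 1 / 2 < h i) (hu : ∀ i, 0 < u i)
    (hV : IsRegularOn h f V) (hε : IsSmallWidth u z ε V)
    (hL : IsLeg (h k) (u k) (z k) (ε k) A B) :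
    ∀ᵐ s ∂unitCube n, ∀ᵐ r : ℝ ∂(volume.restrict (Ioi 0)),
      SegIntegrable (A (wPoint u z s k)) (B (wPoint u z s k))
        (hatIntegrand h u z f (wPoint u z s) r) := by
  filter_upwards [(integrable_leg hh hu hV hε hL).prod_right_ae] with s hs
  filter_upwards [hs.prod_right_ae, ae_restrict_mem measurableSet_Ioi] with r hr hr0
  rw [SegIntegrable, intervalIntegrable_iff_integrableOn_Ioc_of_le zero_le_one]
  have hr0' : (r : ℂ) ^ 2 ≠ 0 := pow_ne_zero _ (Complex.ofReal_ne_zero.2 (ne_of_gt hr0))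
  refine (hr.const_mul ((r : ℂ) ^ 2)).congr (ae_of_all _ fun τ => ?_)
  exact mul_inv_cancel_left₀ hr0' _

/-- At a fixed point of the leg, which depends only on the k-th variable, the other w variables are
integrated first; their product becomes `smearedOthers`. -/
theorem ae_leg_fubini (hh : ∀ i, 1 / 2 < h i) (hu : ∀ i, 0 < u i)
    (hV : IsRegularOn h f V) (hε : IsSmallWidth u z ε V)
    (hL : IsLeg (h k) (u k) (z k) (ε k) A B) :
    ∀ᵐ r : ℝ ∂(volume.restrict (Ioi 0)),
      SegIntegrable (wLow u z k) (wHigh u z k) (fun w => segIntegral (A w) (B w) fun ζ =>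
        Ghat (h k) r ζ (u k) (z k) w * smearedOthers h u z f k r ζ) ∧
      (∏ i, (wHigh u z i - wLow u z i)) * (∫ s, ((r : ℂ) ^ 2)⁻¹ *
        segIntegral (A (wPoint u z s k)) (B (wPoint u z s k))
          (hatIntegrand h u z f (wPoint u z s) r) ∂unitCube n) =
      ((r : ℂ) ^ 2)⁻¹ * segIntegral (wLow u z k) (wHigh u z k) (fun w =>
        segIntegral (A w) (B w) fun ζ =>
          Ghat (h k) r ζ (u k) (z k) w * smearedOthers h u z f k r ζ) := by
  filter_upwards [(integrable_prod_rotate (integrable_leg_mul hh hu hV hε hL)).prod_right_ae,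
    ae_restrict_mem measurableSet_Ioi] with r hr hr0
  have hr0' : ((r : ℂ) ^ 2)⁻¹ ≠ 0 :=
    inv_ne_zero (pow_ne_zero _ (Complex.ofReal_ne_zero.2 (ne_of_gt hr0)))
  set w : ℝ → ℂ := fun σ => wLow u z k + σ * (wHigh u z k - wLow u z k) with hw
  set γ : ℝ → ℝ → ℂ := fun σ τ => A (w σ) + τ * (B (w σ) - A (w σ)) with hγ
  set φ : Fin n → ℝ → ℝ → ℝ → ℂ := fun i σ τ ρ => Ghat (h i) r (γ σ τ) (u i) (z i)
    (wLow u z i + ρ * (wHigh u z i - wLow u z i)) with hφ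
  set ψ : ℝ → ℝ → ℂ := fun σ τ => ((r : ℂ) ^ 2)⁻¹ * ((B (w σ) - A (w σ)) *
    (Ghat (h k) r (γ σ τ) (u k) (z k) (w σ) * f r (γ σ τ))) with hψ
  have e0 : ∀ (s : Fin n → ℝ) (τ : ℝ), ((r : ℂ) ^ 2)⁻¹ *
      ((B (wPoint u z s k) - A (wPoint u z s k)) * hatIntegrand h u z f (wPoint u z s) r
        (A (wPoint u z s k) + τ * (B (wPoint u z s k) - A (wPoint u z s k)))) =
      (∏ i ∈ Finset.univ.erase k, φ i (s k) τ (s i)) * ψ (s k) τ := by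
    intro s τ
    rw [hatIntegrand, ← Finset.mul_prod_erase _ _ (Finset.mem_univ k)]
    simp only [hφ, hψ, hγ, hw, wPoint]
    ring
  have hi : Integrable (fun p : (Fin n → ℝ) × ℝ =>
      (∏ i ∈ Finset.univ.erase k, φ i (p.1 k) p.2 (p.1 i)) * ψ (p.1 k) p.2)
      ((unitCube n).prod (volume.restrict (Ioc 0 1))) :=
    hr.congr (ae_of_all _ fun p => e0 p.1 p.2)
  obtain ⟨h1, h2⟩ := integral_unitCube_split hi
  have e1 : ∀ σ : ℝ, (∏ i ∈ Finset.univ.erase k, (wHigh u z i - wLow u z i)) *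
      (∫ τ in Ioc (0 : ℝ) 1, (∏ i ∈ Finset.univ.erase k, ∫ ρ in Icc (0 : ℝ) 1, φ i σ τ ρ) *
        ψ σ τ) = ((r : ℂ) ^ 2)⁻¹ * segIntegral (A (w σ)) (B (w σ)) fun ζ =>
          Ghat (h k) r ζ (u k) (z k) (w σ) * smearedOthers h u z f k r ζ := by
    intro σ
    rw [← integral_leg_eq, ← integral_const_mul]
    refine integral_congr_ae (ae_of_all _ fun τ => ?_)
    dsimp only
    rw [← mul_assoc, ← Finset.prod_mul_distrib, smearedOthers]
    simp only [hψ, segIntegral_eq_setIntegral_Icc, hφ]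
    ring
  refine ⟨?_, ?_⟩
  · rw [SegIntegrable, intervalIntegrable_iff_integrableOn_Icc_of_le zero_le_one]
    have h3 := (h1.const_mul (∏ i ∈ Finset.univ.erase k, (wHigh u z i - wLow u z i))).const_mul
      (((r : ℂ) ^ 2)⁻¹)⁻¹
    refine h3.congr (ae_of_all _ fun σ => ?_)
    dsimp only
    rw [e1, inv_mul_cancel_left₀ hr0']
  · have e2 : ∀ s : Fin n → ℝ, ((r : ℂ) ^ 2)⁻¹ *
        segIntegral (A (wPoint u z s k)) (B (wPoint u z s k))
          (hatIntegrand h u z f (wPoint u z s) r) = ∫ τ in Ioc (0 : ℝ) 1,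
          (∏ i ∈ Finset.univ.erase k, φ i (s k) τ (s i)) * ψ (s k) τ := by
      intro s
      rw [← integral_leg_eq]
      exact integral_congr_ae (ae_of_all _ fun τ => e0 s τ)
    simp_rw [e2]
    rw [h2, ← Finset.mul_prod_erase _ _ (Finset.mem_univ k), mul_assoc, ← integral_const_mul]
    simp_rw [e1]
    rw [integral_const_mul, segIntegral_eq_setIntegral_Icc, mul_left_comm]

end Leg

theorem segIntegral_add {a b : ℂ} {F₁ F₂ : ℂ → ℂ} (h₁ : SegIntegrable a b F₁)
    (h₂ : SegIntegrable a b F₂) :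
    segIntegral a b (fun w => F₁ w + F₂ w) = segIntegral a b F₁ + segIntegral a b F₂ := by
  rw [segIntegral, intervalIntegral.integral_add h₁ h₂, mul_add]
  rfl

/-! ### The contribution of one bump. -/

section Bump

variable {n : ℕ} {h u z ε : Fin n → ℝ} {f : ℝ → ℂ → ℂ} {V : Set ℂ} {k : Fin n}

theorem differentiableOn_smearedOthers (hh : ∀ i, 0 < h i) (hu : ∀ i, 0 < u i)
    (hV : IsRegularOn h f V) {r : ℝ} (hr : 0 < r) {S : Set ℂ} (hS : S ⊆ V)
    (hSz : ∀ i, i ≠ k → ∀ ζ ∈ S, ζ.re ≠ z i) :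
    DifferentiableOn ℂ (smearedOthers h u z f k r) S := by
  unfold smearedOthers
  refine DifferentiableOn.mul (DifferentiableOn.fun_finsetProd fun i hi => ?_)
    ((hV.differentiableOn r hr).mono hS)
  exact (differentiableOn_segIntegral_Ghat (hh i) hr (hu i)).mono
    (hSz i (Finset.ne_of_mem_erase hi))

theorem IsSmallWidth.re_ne (hε : IsSmallWidth u z ε V) {i : Fin n} (hik : i ≠ k) {ζ : ℂ}
    (hζ : |ζ.re - z k| ≤ ε k) : ζ.re ≠ z i := fun h0 => by
  have h1 := hε.le_abs_re_sub hik hζ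
  rw [h0, sub_self, abs_zero] at h1
  exact absurd (hε.pos i) (not_lt.2 h1)

theorem differentiableOn_smearedOthers_rect (hh : ∀ i, 0 < h i) (hu : ∀ i, 0 < u i)
    (hV : IsRegularOn h f V) (hε : IsSmallWidth u z ε V) {r : ℝ} (hr : 0 < r) :
    DifferentiableOn ℂ (smearedOthers h u z f k r) {ζ | |ζ.re - z k| ≤ ε k ∧ |ζ.im| ≤ u k} :=
  differentiableOn_smearedOthers hh hu hV hr (fun ζ hζ => hε.mem k ζ hζ.1 hζ.2)
    fun _ hik _ hζ => hε.re_ne hik hζ.1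

theorem smearedOthers_ofReal (hh : ∀ i, 0 < h i) (hu : ∀ i, 0 < u i) {r : ℝ} (hr : 0 < r) {x : ℝ}
    (hx : ∀ i, i ≠ k → x ≠ z i) :
    G (h k) r x (u k) (z k) * smearedOthers h u z f k r x = bulkIntegrand h u z f r x := by
  rw [bulkIntegrand, smearedOthers, ← mul_assoc, ← Finset.mul_prod_erase _ _ (Finset.mem_univ k)]
  congr 2
  exact Finset.prod_congr rfl fun i hi =>
    segIntegral_Ghat_eq_G (hh i) hr (hu i) (hx i (Finset.ne_of_mem_erase hi))

theorem Gtilde_mul_smearedOthers (r : ℝ) (ζ : ℂ) :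
    Gtilde (h k) r ζ (u k) (z k) * smearedOthers h u z f k r ζ = tildeIntegrand h u z f k r ζ := by
  rw [smearedOthers, tildeIntegrand]
  ring

theorem integrable_bump (hh : ∀ i, 1 / 2 < h i) (hu : ∀ i, 0 < u i)
    (hV : IsRegularOn h f V) (hε : IsSmallWidth u z ε V) :
    Integrable (fun q : (Fin n → ℝ) × ℝ => ((q.2 : ℂ) ^ 2)⁻¹ *
      bumpIntegral (z k) (ε k) (wPoint u z q.1 k) (hatIntegrand h u z f (wPoint u z q.1) q.2))
      ((unitCube n).prod (volume.restrict (Ioi 0))) := by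
  refine (((integrable_leg_segIntegral hh hu hV hε (isLeg_left (hh k) (hε.pos k))).add
    (integrable_leg_segIntegral hh hu hV hε (isLeg_top (hh k) (hε.pos k)))).add
    (integrable_leg_segIntegral hh hu hV hε (isLeg_right (hh k) (hε.pos k)))).congr
    (ae_of_all _ fun q => ?_)
  simp only [Pi.add_apply, bumpIntegral]
  ring

theorem ae_bumpIntegrable (hh : ∀ i, 1 / 2 < h i) (hu : ∀ i, 0 < u i)
    (hV : IsRegularOn h f V) (hε : IsSmallWidth u z ε V) (k : Fin n) :
    ∀ᵐ s ∂unitCube n, ∀ᵐ r : ℝ ∂(volume.restrict (Ioi 0)),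
      BumpIntegrable (z k) (ε k) (wPoint u z s k) (hatIntegrand h u z f (wPoint u z s) r) := by
  filter_upwards [ae_segIntegrable_leg hh hu hV hε (isLeg_left (hh k) (hε.pos k)),
    ae_segIntegrable_leg hh hu hV hε (isLeg_top (hh k) (hε.pos k)),
    ae_segIntegrable_leg hh hu hV hε (isLeg_right (hh k) (hε.pos k))] with s h1 h2 h3
  filter_upwards [h1, h2, h3] with r h1 h2 h3
  exact ⟨h1, h2, h3⟩

/-- Add the three legs and apply the local identity with `smearedOthers` as the test function. The
value r = u k, excluded there, has measure zero. -/
theorem ae_integral_bump (hh : ∀ i, 1 / 2 < h i) (hu : ∀ i, 0 < u i)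
    (hV : IsRegularOn h f V) (hε : IsSmallWidth u z ε V) (k : Fin n) :
    ∀ᵐ r : ℝ ∂(volume.restrict (Ioi 0)),
      (∏ i, (wHigh u z i - wLow u z i)) * (∫ s, ((r : ℂ) ^ 2)⁻¹ *
        bumpIntegral (z k) (ε k) (wPoint u z s k) (hatIntegrand h u z f (wPoint u z s) r)
          ∂unitCube n) =
      ((r : ℂ) ^ 2)⁻¹ * (∫ x : ℝ in Metric.ball (z k) (ε k), bulkIntegrand h u z f r x) -
        Real.pi * (if r < u k then tildeInner h u z f k r else 0) := by
  have L1 := isLeg_left (u := u k) (z := z k) (hh k) (hε.pos k)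
  have L2 := isLeg_top (u := u k) (z := z k) (hh k) (hε.pos k)
  have L3 := isLeg_right (u := u k) (z := z k) (hh k) (hε.pos k)
  have hne : ∀ᵐ r : ℝ ∂(volume.restrict (Ioi 0)), r ≠ u k :=
    ae_restrict_of_ae (compl_mem_ae_iff.2 (measure_singleton _))
  have hh0 : ∀ i, 0 < h i := fun i => by linarith [hh i]
  filter_upwards [ae_leg_fubini hh hu hV hε L1, ae_leg_fubini hh hu hV hε L2,
    ae_leg_fubini hh hu hV hε L3, (integrable_leg_segIntegral hh hu hV hε L1).prod_left_ae,
    (integrable_leg_segIntegral hh hu hV hε L2).prod_left_ae,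
    (integrable_leg_segIntegral hh hu hV hε L3).prod_left_ae, hne,
    ae_restrict_mem measurableSet_Ioi] with r f1 f2 f3 i1 i2 i3 hru hr
  have hr : 0 < r := hr
  simp only [bumpIntegral, mul_add]
  have e := integral_add (i1.add i2) i3
  simp only [Pi.add_apply] at e
  rw [e, integral_add i1 i2, mul_add, mul_add, f1.2, f2.2, f3.2,
    ← mul_add, ← segIntegral_add f1.1 f2.1, ← mul_add, ← segIntegral_add ?_ f3.1]
  · have key := segIntegral_bumpIntegral (z' := z k) (g := smearedOthers h u z f k r) (hh0 k) hr (hu k) hru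
      (hε.pos k) ?_
    · have e1 : (∫ x : ℝ in Metric.ball (z k) (ε k), G (h k) r x (u k) (z k) *
          smearedOthers h u z f k r x) =
          ∫ x : ℝ in Metric.ball (z k) (ε k), bulkIntegrand h u z f r x := by
        refine setIntegral_congr_fun measurableSet_ball fun x hx => ?_
        refine smearedOthers_ofReal hh0 hu hr fun i hik => ?_
        rw [Metric.mem_ball, Real.dist_eq] at hx
        simpa using hε.re_ne (ζ := x) hik (by simpa using hx.le)
      simp only [e1, Gtilde_mul_smearedOthers] at key
      refine (congrArg (((r : ℂ) ^ 2)⁻¹ * ·) key).trans ?_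
      split_ifs
      · rw [tildeInner]; ring
      · ring
    · refine DifferentiableOn.comp (f := fun ζ : ℂ => z k + ζ) (t := {ζ : ℂ | |ζ.re - z k| ≤ ε k ∧ |ζ.im| ≤ u k})
        (differentiableOn_smearedOthers_rect hh0 hu hV hε hr) (by fun_prop) fun ζ hζ => ?_
      rw [uIcc_of_le (by linarith [hε.pos k]), uIcc_of_le (by linarith [hu k])] at hζ
      have h1 := hζ.1
      have h2 := hζ.2
      simp only [mem_preimage] at h1 h2
      constructor
      · simpa using abs_le.2 h1
      · simpa using abs_le.2 h2
  · exact f1.1.add f2.1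

theorem integrable_ball_bulk (hf : BulkIntegrable h u z f) (S : Set ℝ) :
    IntegrableOn (fun r : ℝ => ((r : ℂ) ^ 2)⁻¹ * ∫ x : ℝ in S, bulkIntegrand h u z f r x)
      (Ioi 0) := by
  have hle : (volume.restrict (Ioi (0 : ℝ))).prod (volume.restrict S) ≤
      (volume.restrict (Ioi 0)).prod volume := Measure.prod_mono le_rfl Measure.restrict_le_self
  refine ((integrable_bulk hf).mono_measure hle).integral_prod_left.congr (ae_of_all _ fun r => ?_)
  exact integral_const_mul ((r : ℂ) ^ 2)⁻¹ fun x : ℝ => bulkIntegrand h u z f r x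

/-- No estimate of G̃ is needed: `ae_integral_bump` writes it as a difference of two functions
already known to be integrable. -/
theorem integrable_tildeInner_ite (hh : ∀ i, 1 / 2 < h i) (hu : ∀ i, 0 < u i)
    (hV : IsRegularOn h f V) (hε : IsSmallWidth u z ε V) (hf : BulkIntegrable h u z f) (k : Fin n) :
    IntegrableOn (fun r => if r < u k then tildeInner h u z f k r else 0) (Ioi 0) := by
  have h1 := integrable_ball_bulk hf (Metric.ball (z k) (ε k))
  have h2 := (integrable_bump (k := k) hh hu hV hε).integral_prod_right.const_mul
    (∏ i, (wHigh u z i - wLow u z i))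
  refine ((h1.sub h2).const_mul (Real.pi : ℂ)⁻¹).congr ?_
  filter_upwards [ae_integral_bump hh hu hV hε k] with r hr
  rw [Pi.sub_apply, hr, sub_sub_cancel, inv_mul_cancel_left₀ (Complex.ofReal_ne_zero.2 Real.pi_ne_zero)]

theorem integral_bump (hh : ∀ i, 1 / 2 < h i) (hu : ∀ i, 0 < u i)
    (hV : IsRegularOn h f V) (hε : IsSmallWidth u z ε V) (hf : BulkIntegrable h u z f) (k : Fin n) :
    (∏ i, (wHigh u z i - wLow u z i)) * (∫ s, (∫ r in Ioi (0 : ℝ), ((r : ℂ) ^ 2)⁻¹ *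
        bumpIntegral (z k) (ε k) (wPoint u z s k) (hatIntegrand h u z f (wPoint u z s) r))
          ∂unitCube n) =
      (∫ r in Ioi (0 : ℝ), ((r : ℂ) ^ 2)⁻¹ *
        ∫ x : ℝ in Metric.ball (z k) (ε k), bulkIntegrand h u z f r x) -
        Real.pi * tildeTerm h u z f k := by
  have h3 := integrable_tildeInner_ite hh hu hV hε hf k
  rw [integral_integral_swap (f := fun s (r : ℝ) => ((r : ℂ) ^ 2)⁻¹ *
        bumpIntegral (z k) (ε k) (wPoint u z s k) (hatIntegrand h u z f (wPoint u z s) r))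
        (integrable_bump hh hu hV hε), ← integral_const_mul,
    integral_congr_ae (ae_integral_bump hh hu hV hε k),
    integral_sub (integrable_ball_bulk hf _) (h3.const_mul _), integral_const_mul, tildeTerm]
  congr 2
  rw [← integral_indicator measurableSet_Ioo, ← integral_indicator measurableSet_Ioi]
  refine integral_congr_ae (ae_of_all _ fun r => ?_)
  simp only [indicator, mem_Ioi, mem_Ioo]
  split_ifs <;> first | rfl | (exfalso; tauto)

end Bump

/-! ### Convergence statements and assembly. -/

theorem segIntegrable_vertical {z' Y : ℝ} {F : ℂ → ℂ} (hY : Y ≠ 0)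
    (hF : IntervalIntegrable (fun t : ℝ => F (z' + t * Complex.I)) volume (-Y) Y) :
    SegIntegrable (z' - Complex.I * Y) (z' + Complex.I * Y) F := by
  have h1 := (hF.comp_add_right (-Y)).comp_mul_left (c := 2 * Y)
  have e1 : (-Y - -Y) / (2 * Y) = 0 := by simp
  have e2 : (Y - -Y) / (2 * Y) = 1 := by field_simp; ring
  rw [e1, e2] at h1
  unfold SegIntegrable
  convert h1 using 2 with s
  congr 1
  push_cast
  ring

section Converges

variable {n : ℕ} {h u z ε : Fin n → ℝ} {f : ℝ → ℂ → ℂ} {V : Set ℂ}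

/-- On the segment G̃ is a multiple of `legendreP` with argument in a compact subset of (0, 1],
hence bounded, and the remaining factor is continuous. -/
theorem segIntegrable_tildeIntegrand (hh : ∀ i, 0 < h i) (hu : ∀ i, 0 < u i)
    (hV : IsRegularOn h f V) (hε : IsSmallWidth u z ε V) {k : Fin n} {r : ℝ}
    (hr : r ∈ Ioo 0 (u k)) :
    SegIntegrable (z k - Complex.I * (r - u k)) (z k + Complex.I * (r - u k))
      (tildeIntegrand h u z f k r) := by
  have hg : ContinuousOn (fun v : ℝ => smearedOthers h u z f k r (z k + v * Complex.I))
      (Icc (-u k) (u k)) := by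
    refine (differentiableOn_smearedOthers_rect hh hu hV hε hr.1).continuousOn.comp
      (by fun_prop) fun v hv => ⟨?_, ?_⟩
    · simpa using (hε.pos k).le
    · simpa using abs_le.2 hv
  have h1 := (integrableOn_legendreP_mul (h := h k) hr.1 (hu k) hg).const_mul (smearConst (h k))
  rw [neg_sub] at h1
  rw [← Complex.ofReal_sub]
  refine segIntegrable_vertical (by linarith [hr.2]) (IntervalIntegrable.symm ?_)
  rw [intervalIntegrable_iff_integrableOn_Ioo_of_le (by linarith [hr.2]), neg_sub]
  refine IntegrableOn.congr_fun h1 (fun v hv => ?_) measurableSet_Ioo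
  rw [← Gtilde_mul_smearedOthers, Gtilde_eq (hh k) hr.1 (abs_lt.2 ⟨by linarith [hv.1], hv.2⟩)]
  ring

theorem tildeConverges (hh : ∀ i, 1 / 2 < h i) (hu : ∀ i, 0 < u i) (hz : Function.Injective z)
    (hV : IsRegularOn h f V) (hε : IsSmallWidth u z ε V) (hf : BulkIntegrable h u z f) (k : Fin n) :
    TildeConverges h u z f k := by
  have hh0 : ∀ i, 0 < h i := fun i => by linarith [hh i]
  refine ⟨fun r hr v i hik => ?_, fun r hr => segIntegrable_tildeIntegrand hh0 hu hV hε hr, ?_⟩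
  · refine segIntegrable_Ghat (hh0 i) hr.1 (hu i) ?_
    simpa using fun h0 => hik (hz h0).symm
  · refine ((integrable_tildeInner_ite hh hu hV hε hf k).mono_set Ioo_subset_Ioi_self).congr_fun
      (fun r hr => if_pos hr.2) measurableSet_Ioo

theorem integrable_hatInner (hh : ∀ i, 1 / 2 < h i) (hu : ∀ i, 0 < u i)
    (hV : IsRegularOn h f V) (hε : IsSmallWidth u z ε V) (hf : BulkIntegrable h u z f) :
    Integrable (fun q : (Fin n → ℝ) × ℝ => hatInner h u z f ε (wPoint u z q.1) q.2)
      ((unitCube n).prod (volume.restrict (Ioi 0))) := by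
  have h1 := (measurePreserving_prodAssoc (unitCube n) (volume.restrict (Ioi (0 : ℝ)))
    (volume.restrict (puncturedLine z ε))).integrable_comp_of_integrable
      (integrable_punctured hε.pos (fun i => by linarith [hh i]) hu hf)
  have h2 := integrable_finsetSum Finset.univ fun k _ => integrable_bump (k := k) hh hu hV hε
  refine (h1.integral_prod_left.add h2).congr (ae_of_all _ fun q => ?_)
  simp only [hatInner, contourIntegral, mul_add, Finset.mul_sum, Pi.add_apply]
  congr 1
  exact integral_const_mul ((q.2 : ℂ) ^ 2)⁻¹
    fun x : ℝ => hatIntegrand h u z f (wPoint u z q.1) q.2 x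

theorem hatConverges (hh : ∀ i, 1 / 2 < h i) (hu : ∀ i, 0 < u i)
    (hV : IsRegularOn h f V) (hε : IsSmallWidth u z ε V) (hf : BulkIntegrable h u z f) :
    HatConverges h u z f ε := by
  have hi := integrable_hatInner hh hu hV hε hf
  refine ⟨?_, ?_⟩
  · rw [volume_restrict_Icc_eq_unitCube]
    filter_upwards [hi.prod_right_ae, ae_all_iff.2 (ae_bumpIntegrable hh hu hV hε),
      (integrable_punctured hε.pos (fun i => by linarith [hh i]) hu hf).prod_right_ae]
      with s h1 h2 h3
    refine ⟨?_, h1⟩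
    filter_upwards [ae_all_iff.2 h2, h3.prod_right_ae, ae_restrict_mem measurableSet_Ioi]
      with r h4 h5 hr
    refine ⟨?_, h4⟩
    have hr0 : (r : ℂ) ^ 2 ≠ 0 := pow_ne_zero _ (Complex.ofReal_ne_zero.2 (ne_of_gt hr))
    refine (h5.const_mul ((r : ℂ) ^ 2)).congr (ae_of_all _ fun τ => ?_)
    exact mul_inv_cancel_left₀ hr0 _
  · rw [MultiSegIntegrable, IntegrableOn, volume_restrict_Icc_eq_unitCube]
    exact hi.integral_prod_left

theorem integral_punctured_add_sum_balls (hε : IsSmallWidth u z ε V) {F : ℝ → ℂ}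
    (hF : Integrable F) :
    (∫ x in puncturedLine z ε, F x) + ∑ k, ∫ x in Metric.ball (z k) (ε k), F x = ∫ x, F x := by
  have hd : Pairwise (Function.onFun Disjoint fun k => Metric.ball (z k) (ε k)) := fun i k hik => by
    refine Metric.ball_disjoint_ball ?_
    rw [Real.dist_eq]
    exact hε.add_le i k hik
  rw [← integral_iUnion_fintype (fun k => measurableSet_ball) hd fun k => hF.integrableOn, add_comm]
  exact integral_add_compl (MeasurableSet.iUnion fun k => measurableSet_ball) hF

/-- The punctured line and the disjoint balls make up the real line, so the G contributions add up
to the bulk integral, and each bump leaves -π times its G̃ term. The right-hand side does not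
contain the widths. -/
theorem hatTerm_eq (hh : ∀ i, 1 / 2 < h i) (hu : ∀ i, 0 < u i)
    (hV : IsRegularOn h f V) (hε : IsSmallWidth u z ε V) (hf : BulkIntegrable h u z f) :
    hatTerm h u z f ε = bulkIntegral h u z f - Real.pi * ∑ k, tildeTerm h u z f k := by
  have hh0 : ∀ i, 0 < h i := fun i => by linarith [hh i]
  have hpi : Integrable (fun q : (Fin n → ℝ) × ℝ => ((q.2 : ℂ) ^ 2)⁻¹ *
      ∫ x : ℝ in puncturedLine z ε, hatIntegrand h u z f (wPoint u z q.1) q.2 x)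
      ((unitCube n).prod (volume.restrict (Ioi 0))) := by
    have h1 := (measurePreserving_prodAssoc (unitCube n) (volume.restrict (Ioi (0 : ℝ)))
      (volume.restrict (puncturedLine z ε))).integrable_comp_of_integrable
        (integrable_punctured hε.pos hh0 hu hf)
    refine h1.integral_prod_left.congr (ae_of_all _ fun q => ?_)
    exact integral_const_mul ((q.2 : ℂ) ^ 2)⁻¹
      fun x : ℝ => hatIntegrand h u z f (wPoint u z q.1) q.2 x
  have hbi := fun k => integrable_bump (k := k) hh hu hV hε
  have e1 : hatTerm h u z f ε = (∏ i, (wHigh u z i - wLow u z i)) *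
      ∫ s, (∫ r in Ioi (0 : ℝ), hatInner h u z f ε (wPoint u z s) r) ∂unitCube n := by
    rw [hatTerm, multiSegIntegral, volume_restrict_Icc_eq_unitCube]
    rfl
  have e2 : ∫ s, (∫ r in Ioi (0 : ℝ), hatInner h u z f ε (wPoint u z s) r) ∂unitCube n =
      ∫ s, ((∫ r in Ioi (0 : ℝ), ((r : ℂ) ^ 2)⁻¹ *
        ∫ x : ℝ in puncturedLine z ε, hatIntegrand h u z f (wPoint u z s) r x) +
        ∑ k, ∫ r in Ioi (0 : ℝ), ((r : ℂ) ^ 2)⁻¹ *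
          bumpIntegral (z k) (ε k) (wPoint u z s k) (hatIntegrand h u z f (wPoint u z s) r))
        ∂unitCube n := by
    refine integral_congr_ae ?_
    filter_upwards [hpi.prod_right_ae, ae_all_iff.2 fun k => (hbi k).prod_right_ae] with s h1 h2
    rw [← integral_finsetSum _ fun k _ => h2 k,
      ← integral_add h1 (integrable_finsetSum _ fun k _ => h2 k)]
    simp only [hatInner, contourIntegral, mul_add, Finset.mul_sum]
  have e3 : bulkIntegral h u z f = (∫ r in Ioi (0 : ℝ), ((r : ℂ) ^ 2)⁻¹ *
      ∫ x : ℝ in puncturedLine z ε, bulkIntegrand h u z f r x) +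
      ∑ k, ∫ r in Ioi (0 : ℝ), ((r : ℂ) ^ 2)⁻¹ *
        ∫ x : ℝ in Metric.ball (z k) (ε k), bulkIntegrand h u z f r x := by
    rw [← integral_finsetSum _ fun k _ => integrable_ball_bulk hf (Metric.ball (z k) (ε k)),
      ← integral_add (integrable_ball_bulk hf (puncturedLine z ε))
        (integrable_finsetSum _ fun k _ => integrable_ball_bulk hf (Metric.ball (z k) (ε k)))]
    refine integral_congr_ae ?_
    filter_upwards [(integrable_bulk hf).prod_right_ae, ae_restrict_mem measurableSet_Ioi]
      with r h1 hr
    have hr0 : (r : ℂ) ^ 2 ≠ 0 := pow_ne_zero _ (Complex.ofReal_ne_zero.2 (ne_of_gt hr))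
    have h2 : Integrable fun x : ℝ => bulkIntegrand h u z f r x :=
      (h1.const_mul ((r : ℂ) ^ 2)).congr (ae_of_all _ fun x => mul_inv_cancel_left₀ hr0 _)
    rw [← integral_punctured_add_sum_balls hε h2, mul_add, Finset.mul_sum]
  have h4 := fun k => (hbi k).integral_prod_left
  rw [e1, e2, integral_add hpi.integral_prod_left (integrable_finsetSum _ fun k _ => h4 k),
    integral_finsetSum _ fun k _ => h4 k, mul_add, integral_punctured hε.pos hh0 hu hf,
    Finset.mul_sum]
  simp only [integral_bump hh hu hV hε hf]
  rw [Finset.sum_sub_distrib, e3, Finset.mul_sum]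
  ring

/-- A compact segment has a closed thickening inside V, and distinct z i leave room for disjoint
balls; finitely many conditions hold simultaneously. -/
theorem eventually_isSmallWidth (hz : Function.Injective z) (hV : IsOpen V)
    (hseg : ∀ k, ∀ t ∈ Icc (-u k) (u k), (z k : ℂ) + Complex.I * t ∈ V) :
    ∀ᶠ ε in 𝓝[Set.pi univ (fun _ : Fin n => Ioi (0 : ℝ))] (0 : Fin n → ℝ),
      IsSmallWidth u z ε V := by
  have h1 : ∀ k, ∃ δ > 0, ∀ ζ : ℂ, |ζ.re - z k| ≤ δ → |ζ.im| ≤ u k → ζ ∈ V := fun k => by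
    have hc : IsCompact ((fun t : ℝ => (z k : ℂ) + Complex.I * t) '' Icc (-u k) (u k)) :=
      isCompact_Icc.image (by fun_prop)
    obtain ⟨δ, hδ, hsub⟩ := hc.exists_cthickening_subset_open hV (image_subset_iff.2 (hseg k))
    refine ⟨δ, hδ, fun ζ hre him => hsub (Metric.mem_cthickening_of_dist_le ζ _ δ _
      (mem_image_of_mem _ (abs_le.1 him)) ?_)⟩
    have e : ζ - (z k + Complex.I * ζ.im) = (ζ.re - z k : ℝ) := by
      apply Complex.ext <;> simp
    rw [dist_eq_norm, e, Complex.norm_real]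
    exact hre
  choose δ hδ hmem using h1
  have h2 : ∀ k, ∀ᶠ ε in 𝓝 (0 : Fin n → ℝ), ε k < δ k := fun k =>
    (continuous_apply k).continuousAt.eventually_lt_const (hδ k)
  have h3 : ∀ i k, ∀ᶠ ε in 𝓝 (0 : Fin n → ℝ), i ≠ k → ε i + ε k < |z i - z k| := fun i k => by
    by_cases hik : i = k
    · exact Eventually.of_forall fun _ h0 => absurd hik h0
    · have hc : Continuous fun ε : Fin n → ℝ => ε i + ε k := by fun_prop
      refine (hc.continuousAt.eventually_lt_const (u := |z i - z k|) ?_).mono fun _ h0 _ => h0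
      simpa [sub_eq_zero] using fun h0 => hik (hz h0)
  filter_upwards [self_mem_nhdsWithin, nhdsWithin_le_nhds (eventually_all.2 h2),
    nhdsWithin_le_nhds (eventually_all.2 fun i => eventually_all.2 (h3 i))] with ε e1 e2 e3
  exact ⟨fun i => e1 i (mem_univ i), fun i k hik => (e3 i k hik).le,
    fun k ζ hre him => hmem k ζ (hre.trans (e2 k).le) him⟩

end Converges

end AdS2

open AdS2
theorem lemma5 (n : ℕ) (h u z : Fin n → ℝ) (hh : ∀ i, 1 / 2 < h i) (hu : ∀ i, 0 < u i)
    (hz : Function.Injective z) (f : ℝ → ℂ → ℂ) (hf : IsTestFunction h u z f) :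
    (∀ k, TildeConverges h u z f k) ∧
    (∀ᶠ ε in 𝓝[Set.pi univ (fun _ : Fin n => Ioi (0 : ℝ))] (0 : Fin n → ℝ),
      HatConverges h u z f ε) ∧
    ∃ L : ℂ,
      Tendsto (fun ε => hatTerm h u z f ε)
        (𝓝[Set.pi univ (fun _ : Fin n => Ioi (0 : ℝ))] (0 : Fin n → ℝ)) (𝓝 L) ∧
      bulkIntegral h u z f = (Real.pi : ℂ) * ∑ k, tildeTerm h u z f k + L := by
  obtain ⟨V, hVo, hseg, hc, hd, hb0, hb1⟩ := hf.exists_nhds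
  have hV : IsRegularOn h f V := ⟨hVo, hc, hd, hb0, hb1⟩
  have hev := eventually_isSmallWidth hz hVo hseg
  have hne : (𝓝[Set.pi univ (fun _ : Fin n => Ioi (0 : ℝ))] (0 : Fin n → ℝ)).NeBot :=
    nhdsWithin_pi_neBot.2 fun _ _ => nhdsGT_neBot 0
  -- The G̃ terms do not depend on the widths, so one admissible choice proves their convergence.
  obtain ⟨ε, hε⟩ := hev.exists
  refine ⟨tildeConverges hh hu hz hV hε hf.integrable,
    hev.mono fun ε hε => hatConverges hh hu hV hε hf.integrable,
    bulkIntegral h u z f - Real.pi * ∑ k, tildeTerm h u z f k, ?_, by ring⟩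
  -- The Ĝ term is eventually constant along the filter.
  exact tendsto_const_nhds.congr' (hev.mono fun ε hε => (hatTerm_eq hh hu hV hε hf.integrable).symm)
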